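/- Let $A,B$ be vector spaces over a field $K$ of characteristic $0$. For a vector space $E$ let $\bigoplus_{n\ge0}\mathrm{Hom}(E^{\otimes n+1},E)$ (with $\mathrm{Hom}(E^{\otimes n+1},E)$ in degree $n$) carry the Gerstenhaber bracket $[f,g]=f\diamond g-(-1)^{mn}g\diamond f$, where for $f,g$ of degrees $m,n$ $$(f\diamond g)(v_1,\dots,v_{m+n+1})=\sum_{i=1}^{m+1}(-1)^{(i-1)n}f(v_1,\dots,v_{i-1},g(v_i,\dots,v_{i+n}),v_{i+n+1},\dots,v_{m+n+1}).$$ Put $\mathfrak g=\bigoplus_{n\ge0}\mathrm{Hom}((A\oplus B)^{\otimes n+1},A\oplus B)$. Let $C^{k|l}\subset\mathfrak g_{k+l}$ be the space of maps that send every tensor product of $k+1$ copies of $A$ and $l$ copies of $B$ (in any order) into $A$, every tensor product of $k$ copies of $A$ and $l+1$ copies of $B$ into $B$, and vanish on all other tensor products of copies of $A$ and $B$. Let $\mathscr Q=\bigoplus_{n\ge 0}\mathscr Q_n$, $\mathscr Q_n=C^{n+1|-1}\oplus C^{n|0}\oplus\dots\oplus C^{0|n}$, a subspace closed under the bracket,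 let $\mathfrak a=\bigoplus_{n\ge0}\mathrm{Hom}(A^{\otimes n+1},B)\subset\mathfrak g$, and let $P:\mathfrak g\to\mathfrak a$ be the projection (restrict to arguments in $A$, take the $B$-component). Let $\mathscr Q[1]\oplus\mathfrak a$ have degree-$d$ part $\mathscr Q_{d+1}\oplus\mathfrak a_d$. An $L_\infty$-algebra is a $\mathbb Z$-graded vector space with graded symmetric multilinear operations $l_k$, $k\ge1$, of degree $1$ such that $\sum_{i}\sum_{\sigma\in Sh(i,N-i)}\epsilon(\sigma)\,l_{N-i+1}(l_i(x_{\sigma(1)},\dots,x_{\sigma(i)}),x_{\sigma(i+1)},\dots,x_{\sigma(N)})=0$ for all $N$ and all homogeneous $x_1,\dots,x_N$, where $\epsilon(\sigma)$ is the Koszul sign. It is weakly filtered if there are a descending filtration $\mathcal F_1\supset\mathcal F_2\supset\cdots$ of it by graded subspaces, with $\mathcal F_1$ the whole space and complete in each degree, and an index $N$ such that $l_k$ has values in $\mathcal F_k$ for all $k\ge N$. A Maurer–Cartan element is an element $\alpha$ of degree $0$ with $\sum_{k\ge1}\frac1{k!}l_k(\alpha,\dots,\alpha)=0$. **Theorem.**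 (1) $\mathscr Q[1]\oplus\mathfrak a$ is a weakly filtered $L_\infty$-algebra with the operations $\tilde l_k$, $k\ge 1$, determined by multilinearity, graded symmetry and $$\tilde l_1(F[1])=P(F),\quad \tilde l_2(F[1],G[1])=(-1)^{|F|}[F,G][1],\quad \tilde l_k(F[1],f_1,\dots,f_{k-1})=P[\cdots[[F,f_1],f_2],\dots,f_{k-1}]\ (k\ge2)$$ for homogeneous $F,G\in\mathscr Q$, $f_i\in\mathfrak a$; up to permutation of the entries, all other operations vanish. (2) For bilinear maps $\mu:A\times A\to A$, $\nu:B\times B\to B$, $\vartriangleright:A\times B\to B$, $\vartriangleleft:B\times A\to B$, $\rightharpoonup:B\times A\to A$, $\leftharpoonup:A\times B\to A$, $\theta:A\times A\to B$, write $a\cdot_Ab=\mu(a,b)$, $x\cdot_By=\nu(x,y)$, and let $\Omega\in\mathscr Q_1$ be the bilinear map $$\Omega((a,x),(b,y))=(a\cdot_A b+a\leftharpoonup y+x\rightharpoonup b,\ x\cdot_B y+a\vartriangleright y+x\vartriangleleft b+\theta(a,b)).$$ The degree $0$ elements of $\mathscr Q[1]\oplus\mathfrak a$ are exactly the $(\Omega[1],D)$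 for such bilinear maps and a linear map $D:A\to B$, all of them uniquely determined. The element $(\Omega[1],D)$ is a Maurer–Cartan element if and only if $\Omega$ is a quasi-twilled associative algebra structure, i.e. an associative multiplication on $A\oplus B$ with $B$ as a subalgebra, and $D$ is a strong deformation map in it, i.e. for all $a,b\in A$ $$D(a\cdot_Ab+a\leftharpoonup D(b)+D(a)\rightharpoonup b)=D(a)\cdot_BD(b)+a\vartriangleright D(b)+D(a)\vartriangleleft b+\theta(a,b).$$ (3) Let $\alpha=(\Omega[1],D)$ be as in (2), with $\Omega$ a quasi-twilled associative algebra structure and $D$ a strong deformation map in it. The series $$\tilde l_k^{\alpha}(x_1,\dots,x_k)=\sum_{n\ge0}\frac1{n!}\tilde l_{n+k}(\alpha,\dots,\alpha,x_1,\dots,x_k),\quad k\ge1,$$ have only finitely many non-zero terms and make $\mathscr Q[1]\oplus\mathfrak a$ a weakly filtered $L_\infty$-algebra. It governs the simultaneous deformations of the pair: for every $\Omega'\in\mathscr Q_1$ and every linear map $D':A\to B$, $\Omega+\Omega'$ is a quasi-twilled associative algebra structure and $D+D'$ is a strong deformation map in it if and only if $(\Omega'[1],D')$ is a Maurer–Cartan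 element of $(\mathscr Q[1]\oplus\mathfrak a,\{\tilde l_k^{\alpha}\}_{k\ge1})$. -/

import Mathlib

open scoped DirectSum

namespace QTwilled

/-! ### Curved `L_∞`-algebras -/

section LInfinity

variable {K V : Type*} [Field K] [AddCommGroup V] [Module K V]

/-- The Koszul sign `ε(σ) = ε(σ; x_1, …, x_k)` of a permutation `σ`, for homogeneous elements `x_i`
of degree `d i`: each inversion `i < j`, `σ j < σ i` contributes `(-1)^{d (σ i) d (σ j)}`. -/
def koszulSign {k : ℕ} (d : Fin k → ℤ) (σ : Equiv.Perm (Fin k)) : ℤ :=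
  ∏ p : Fin k × Fin k,
    if p.1 < p.2 ∧ σ p.2 < σ p.1 then ((Int.negOnePow (d (σ p.1) * d (σ p.2)) : ℤˣ) : ℤ) else 1

/-- `σ` is an `(i, N - i)`-shuffle: it is increasing on the first `i` and on the last `N - i`
positions. -/
def IsShuffle {N : ℕ} (i : ℕ) (σ : Equiv.Perm (Fin N)) : Prop :=
  ∀ a b : Fin N, a < b → ((b : ℕ) < i ∨ i ≤ (a : ℕ)) → σ a < σ b

/-- The term `l_{N-i+1}(l_i(x_{σ(1)}, …, x_{σ(i)}), x_{σ(i+1)}, …, x_{σ(N)})`. -/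
def jacobiTerm (l : ∀ k : ℕ, (Fin k → V) → V) {N : ℕ} (x : Fin N → V) (i : Fin (N + 1))
    (σ : Equiv.Perm (Fin N)) : V :=
  l (N - (i : ℕ) + 1)
    (Fin.cons (α := fun _ => V)
      (l (i : ℕ) fun j => x (σ ⟨(j : ℕ), by omega⟩))
      (fun j : Fin (N - (i : ℕ)) => x (σ ⟨(i : ℕ) + (j : ℕ), by omega⟩)))

/-- `(V, {l_k}_{k ≥ 0})` is a curved `L_∞`-algebra, where `V` is graded by the subspaces `𝒢 d`,
`d ∈ ℤ`. -/
structure IsCurvedLInfinity (𝒢 : ℤ → Submodule K V) (l : ∀ k : ℕ, (Fin k → V) → V) : Prop where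
  graded : DirectSum.IsInternal 𝒢
  multilinear : ∀ k : ℕ, ∃ M : MultilinearMap K (fun _ : Fin k => V) V, ∀ x, M x = l k x
  degree_one : ∀ (k : ℕ) (d : Fin k → ℤ) (x : Fin k → V), (∀ i, x i ∈ 𝒢 (d i)) →
    l k x ∈ 𝒢 ((∑ i, d i) + 1)
  symmetric : ∀ (k : ℕ) (d : Fin k → ℤ) (x : Fin k → V), (∀ i, x i ∈ 𝒢 (d i)) →
    ∀ σ : Equiv.Perm (Fin k), l k (fun i => x (σ i)) = koszulSign d σ • l k x
  jacobi : ∀ (N : ℕ) (d : Fin N → ℤ) (x : Fin N → V), (∀ i, x i ∈ 𝒢 (d i)) →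
    open Classical in
    ∑ i : Fin (N + 1), ∑ σ : Equiv.Perm (Fin N) with IsShuffle (i : ℕ) σ,
      koszulSign d σ • jacobiTerm l x i σ = 0

/-- An `L_∞`-algebra is a curved `L_∞`-algebra with `l_0 = 0`. -/
structure IsLInfinity (𝒢 : ℤ → Submodule K V) (l : ∀ k : ℕ, (Fin k → V) → V) : Prop
    extends IsCurvedLInfinity 𝒢 l where
  flat : ∀ x, l 0 x = 0

/-- The operations are weakly filtered: there are a descending filtration `Fil 1 ⊇ Fil 2 ⊇ ⋯` of the
graded space by graded subspaces, `Fil 1` being everything, and an index `N`, such that the graded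
space is the limit of its quotients by the `Fil k` (the limit being taken in each degree), and
`l_k` takes values in `Fil k` for all `k ≥ N`. -/
def IsWeaklyFiltered (𝒢 : ℤ → Submodule K V) (l : ∀ k : ℕ, (Fin k → V) → V) : Prop :=
  ∃ (Fil : ℕ → ℤ → Submodule K V) (N : ℕ), 1 ≤ N ∧
    (∀ d, Fil 1 d = 𝒢 d) ∧
    (∀ k, 1 ≤ k → ∀ d, Fil (k + 1) d ≤ Fil k d) ∧
    (∀ d x, (∀ k, 1 ≤ k → x ∈ Fil k d) → x = 0) ∧
    (∀ d (u : ℕ → V), (∀ k, 1 ≤ k → u k ∈ 𝒢 d) → (∀ k, 1 ≤ k → u (k + 1) - u k ∈ Fil k d) →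
      ∃ x ∈ 𝒢 d, ∀ k, 1 ≤ k → x - u k ∈ Fil k d) ∧
    (∀ k, N ≤ k → ∀ (d : Fin k → ℤ) (x : Fin k → V), (∀ i, x i ∈ 𝒢 (d i)) →
      l k x ∈ Fil k ((∑ i, d i) + 1))

/-- `α` is a Maurer–Cartan element: it has degree `0`, the series
`l_0 + ∑_{k ≥ 1} (1 / k!) l_k(α, …, α)` has only finitely many non-zero terms, and its sum is `0`. -/
def IsMaurerCartan (𝒢 : ℤ → Submodule K V) (l : ∀ k : ℕ, (Fin k → V) → V) (α : V) : Prop :=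
  α ∈ 𝒢 0 ∧ {k : ℕ | l k (fun _ => α) ≠ 0}.Finite ∧
    ∑ᶠ k : ℕ, ((Nat.factorial k : K)⁻¹) • l k (fun _ => α) = 0

/-- For all `α` and `x_1, …, x_k`, the series `∑_n (1 / n!) l_{n+k}(α, …, α, x_1, …, x_k)` has only
finitely many non-zero terms. -/
def TwistConverges (l : ∀ k : ℕ, (Fin k → V) → V) : Prop :=
  ∀ (α : V) (k : ℕ) (x : Fin k → V), {n : ℕ | l (n + k) (Fin.append (fun _ => α) x) ≠ 0}.Finite

variable (K) in
/-- The twisted operations `l^α_k(x_1, …, x_k) = ∑_n (1 / n!) l_{n+k}(α, …, α, x_1, …, x_k)`. For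
`k = 0` this is the left-hand side of the Maurer–Cartan equation of `α`. -/
noncomputable def twist (l : ∀ k : ℕ, (Fin k → V) → V) (α : V) (k : ℕ) (x : Fin k → V) : V :=
  ∑ᶠ n : ℕ, ((Nat.factorial n : K)⁻¹) • l (n + k) (Fin.append (fun _ => α) x)

end LInfinity

/-! ### The Gerstenhaber bracket -/

section Gerstenhaber

variable (K E : Type*) [Field K] [AddCommGroup E] [Module K E]

/-- `Hom(E^{⊗ n+1}, F)`. -/
abbrev Hm (E F : Type*) [AddCommGroup E] [Module K E] [AddCommGroup F] [Module K F] (n : ℕ) :=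
  MultilinearMap K (fun _ : Fin (n + 1) => E) F

/-- `⨁_{n ≥ 0} Hom(E^{⊗ n+1}, F)`, the `n`-th summand having degree `n`. -/
abbrev HmSum (E F : Type*) [AddCommGroup E] [Module K E] [AddCommGroup F] [Module K F] :=
  ⨁ n : ℕ, Hm K E F n

variable {K E}

/-- The arguments of the outer map in the `i`-th insertion (with `i` counted from `0`):
`(v_0, …, v_{i-1}, g(v_i, …, v_{i+n}), v_{i+n+1}, …, v_{m+n})`. -/
def insArgs {m n : ℕ} (i : Fin (m + 1)) (g : (Fin (n + 1) → E) → E) (v : Fin (m + n + 1) → E) :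
    Fin (m + 1) → E := fun j =>
  if j < i then v ⟨(j : ℕ), by omega⟩
  else if j = i then g (fun t => v ⟨(i : ℕ) + (t : ℕ), by omega⟩)
  else v ⟨(j : ℕ) + n, by omega⟩

theorem insArgs_update_lt {m n : ℕ} (i : Fin (m + 1)) (g : (Fin (n + 1) → E) → E)
    (v : Fin (m + n + 1) → E) (p : Fin (m + n + 1)) (z : E) (h : (p : ℕ) < i) :
    insArgs i g (Function.update v p z) =
      Function.update (insArgs i g v) ⟨(p : ℕ), by omega⟩ z := by
  have e : ∀ q : Fin (m + n + 1), (q : ℕ) ≠ p → Function.update v p z q = v q := fun q hq =>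
    Function.update_of_ne (fun h => hq (congrArg Fin.val h)) _ _
  have hp : (p : ℕ) < m + 1 := by omega
  funext j
  by_cases hj : (j : ℕ) = p
  · obtain rfl : (⟨(p : ℕ), hp⟩ : Fin (m + 1)) = j := Fin.ext hj.symm
    have h1 : (⟨(p : ℕ), by omega⟩ : Fin (m + 1)) < i := Fin.lt_def.2 h
    simp [insArgs, h1]
  · rw [Function.update_of_ne (fun h => hj (congrArg Fin.val h))]
    unfold insArgs
    split_ifs with h1 h2
    · exact e _ hj
    · congr 1; funext t; apply e; simp only; omega
    · apply e
      have : (j : ℕ) ≠ i := fun h => h2 (Fin.ext h)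
      simp only [Fin.lt_def] at h1 ⊢
      omega

theorem insArgs_update_gt {m n : ℕ} (i : Fin (m + 1)) (g : (Fin (n + 1) → E) → E)
    (v : Fin (m + n + 1) → E) (p : Fin (m + n + 1)) (z : E) (h : (i : ℕ) + n < p) :
    insArgs i g (Function.update v p z) =
      Function.update (insArgs i g v) ⟨(p : ℕ) - n, by omega⟩ z := by
  have e : ∀ q : Fin (m + n + 1), (q : ℕ) ≠ p → Function.update v p z q = v q := fun q hq =>
    Function.update_of_ne (fun h => hq (congrArg Fin.val h)) _ _
  have hp : (p : ℕ) - n < m + 1 := by omega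
  funext j
  by_cases hj : (j : ℕ) = p - n
  · obtain rfl : (⟨(p : ℕ) - n, hp⟩ : Fin (m + 1)) = j := Fin.ext hj.symm
    have h1 : ¬ (⟨(p : ℕ) - n, by omega⟩ : Fin (m + 1)) < i := by
      simp only [Fin.lt_def]; omega
    have h2 : ¬ (⟨(p : ℕ) - n, by omega⟩ : Fin (m + 1)) = i := by
      simp only [Fin.ext_iff]; omega
    have h3 : (⟨(p : ℕ) - n + n, by omega⟩ : Fin (m + n + 1)) = p := by
      simp only [Fin.ext_iff]; omega
    simp [insArgs, h1, h2, h3]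
  · rw [Function.update_of_ne (fun h => hj (congrArg Fin.val h))]
    unfold insArgs
    split_ifs with h1 h2
    · apply e; simp only [Fin.lt_def] at h1 ⊢; omega
    · congr 1; funext t; apply e; simp only; omega
    · apply e; simp only; omega

theorem insArgs_update_mid {m n : ℕ} (i : Fin (m + 1)) (g : (Fin (n + 1) → E) → E)
    (v : Fin (m + n + 1) → E) (p : Fin (m + n + 1)) (z : E) (h1 : (i : ℕ) ≤ p)
    (h2 : (p : ℕ) ≤ i + n) :
    insArgs i g (Function.update v p z) =
      Function.update (insArgs i g v) i
        (g (Function.update (fun t => v ⟨(i : ℕ) + (t : ℕ), by omega⟩)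
          ⟨(p : ℕ) - i, by omega⟩ z)) := by
  have e : ∀ q : Fin (m + n + 1), (q : ℕ) ≠ p → Function.update v p z q = v q := fun q hq =>
    Function.update_of_ne (fun h => hq (congrArg Fin.val h)) _ _
  funext j
  by_cases hj : j = i
  · subst hj
    simp only [insArgs, lt_irrefl, if_false, if_true, Function.update_self]
    congr 1
    funext t
    by_cases ht : (t : ℕ) = p - j
    · have h3 : t = ⟨(p : ℕ) - j, by omega⟩ := Fin.ext ht
      have h4 : (⟨(j : ℕ) + t, by omega⟩ : Fin (m + n + 1)) = p := by
        simp only [Fin.ext_iff]; omega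
      rw [h4, h3]
      simp
    · rw [Function.update_of_ne (a := t) (fun h => ht (congrArg Fin.val h))]
      apply e; simp only; omega
  · rw [Function.update_of_ne hj]
    have : (j : ℕ) ≠ i := fun h => hj (Fin.ext h)
    unfold insArgs
    split_ifs with h3
    · apply e; simp only [Fin.lt_def] at h3 ⊢; omega
    · apply e; simp only [Fin.lt_def] at h3 ⊢; omega

theorem insArgs_eq_update {m n : ℕ} (i : Fin (m + 1)) (g g' : (Fin (n + 1) → E) → E)
    (v : Fin (m + n + 1) → E) :
    insArgs i g v = Function.update (insArgs i g' v) i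
      (g (fun t => v ⟨(i : ℕ) + (t : ℕ), by omega⟩)) := by
  funext j
  by_cases hj : j = i
  · subst hj; simp [insArgs]
  · rw [Function.update_of_ne hj]; simp [insArgs, hj]

/-- The insertion `(v_0, …, v_{m+n}) ↦ f(v_0, …, v_{i-1}, g(v_i, …, v_{i+n}), …, v_{m+n})`. -/
def ins {m n : ℕ} (i : Fin (m + 1)) (f : Hm K E E m) (g : Hm K E E n) : Hm K E E (m + n) :=
  MultilinearMap.mk' (fun v => f (insArgs i g v))
    (by
      intro v p x y
      rcases lt_or_ge (p : ℕ) i with h | h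
      · simp only [insArgs_update_lt _ _ _ _ _ h, f.map_update_add]
      · rcases le_or_gt (p : ℕ) (i + n) with h' | h'
        · simp only [insArgs_update_mid _ _ _ _ _ h h', f.map_update_add, g.map_update_add]
        · simp only [insArgs_update_gt _ _ _ _ _ h', f.map_update_add])
    (by
      intro v p c x
      rcases lt_or_ge (p : ℕ) i with h | h
      · simp only [insArgs_update_lt _ _ _ _ _ h, f.map_update_smul]
      · rcases le_or_gt (p : ℕ) (i + n) with h' | h'
        · simp only [insArgs_update_mid _ _ _ _ _ h h', f.map_update_smul, g.map_update_smul]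
        · simp only [insArgs_update_gt _ _ _ _ _ h', f.map_update_smul])

@[simp] theorem ins_apply {m n : ℕ} (i : Fin (m + 1)) (f : Hm K E E m) (g : Hm K E E n)
    (v : Fin (m + n + 1) → E) : ins i f g v = f (insArgs i g v) := rfl

/-- The insertion as a bilinear map. -/
def insL {m n : ℕ} (i : Fin (m + 1)) : Hm K E E m →ₗ[K] Hm K E E n →ₗ[K] Hm K E E (m + n) :=
  LinearMap.mk₂ K (fun f g => ins i f g)
    (fun f f' g => by ext v; simp)
    (fun c f g => by ext v; simp)
    (fun f g g' => by
      ext v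
      simp only [ins_apply, _root_.add_apply]
      rw [insArgs_eq_update i (g + g' : Hm K E E n) 0 v, insArgs_eq_update i g 0 v,
        insArgs_eq_update i g' 0 v, _root_.add_apply, f.map_update_add])
    (fun c f g => by
      ext v
      simp only [ins_apply, _root_.smul_apply]
      rw [insArgs_eq_update i (c • g : Hm K E E n) 0 v, insArgs_eq_update i g 0 v,
        _root_.smul_apply, f.map_update_smul])

/-- `f ⋄ g = ∑_i (-1)^{i n} f(…, g(…), …)` for `f ∈ Hom(E^{⊗ m+1}, E)`, `g ∈ Hom(E^{⊗ n+1}, E)`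
(with the position `i` of the insertion counted from `0`). -/
def diamond (m n : ℕ) : Hm K E E m →ₗ[K] Hm K E E n →ₗ[K] Hm K E E (m + n) :=
  ∑ i : Fin (m + 1), ((-1 : K) ^ ((i : ℕ) * n)) • insL i

/-- The Gerstenhaber bracket `[f, g] = f ⋄ g - (-1)^{mn} g ⋄ f` of `f ∈ Hom(E^{⊗ m+1}, E)` and
`g ∈ Hom(E^{⊗ n+1}, E)`, placed in the direct sum. -/
def bracketHom (m n : ℕ) : Hm K E E m →ₗ[K] Hm K E E n →ₗ[K] HmSum K E E :=
  LinearMap.mk₂ K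
    (fun f g => DirectSum.lof K ℕ (Hm K E E) (m + n) (diamond m n f g) -
      ((-1 : K) ^ (m * n)) • DirectSum.lof K ℕ (Hm K E E) (n + m) (diamond n m g f))
    (fun f f' g => by simp only [map_add, LinearMap.add_apply, smul_add]; abel)
    (fun c f g => by
      simp only [map_smul, LinearMap.smul_apply, smul_sub, smul_comm c ((-1 : K) ^ (m * n))])
    (fun f g g' => by simp only [map_add, LinearMap.add_apply, smul_add]; abel)
    (fun c f g => by
      simp only [map_smul, LinearMap.smul_apply, smul_sub, smul_comm c ((-1 : K) ^ (m * n))])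

variable (K E) in
/-- The Gerstenhaber bracket on `⨁_n Hom(E^{⊗ n+1}, E)`. -/
def bracket : HmSum K E E →ₗ[K] HmSum K E E →ₗ[K] HmSum K E E :=
  DirectSum.toModule K ℕ _ fun m =>
    (DirectSum.toModule K ℕ _ fun n => (bracketHom m n).flip).flip

/-- The iterated bracket `F ↦ [⋯[[F, f_1], f_2], …, f_r]` for a list `f_1, …, f_r`. -/
def iterBracket : List (HmSum K E E) → (HmSum K E E →ₗ[K] HmSum K E E)
  | [] => LinearMap.id
  | f :: fs => iterBracket fs ∘ₗ (bracket K E).flip f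

end Gerstenhaber

/-! ### Homogeneous parts -/

section Degrees

variable (K : Type*) [Field K] (E F : Type*) [AddCommGroup E] [Module K E] [AddCommGroup F]
  [Module K F]

/-- The elements of degree `d ∈ ℤ` in `⨁_{n ≥ 0} Hom(E^{⊗ n+1}, F)`. -/
def degPart (d : ℤ) : Submodule K (HmSum K E F) where
  carrier := {x | ∀ n : ℕ, (n : ℤ) ≠ d → x n = 0}
  add_mem' := fun hx hy n hn => by rw [DirectSum.add_apply, hx n hn, hy n hn, add_zero]
  zero_mem' := fun n _ => rfl
  smul_mem' := fun c x hx n hn => by rw [DirectSum.smul_apply, hx n hn, smul_zero]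

/-- The operator that is multiplication by `(-1)^n` in degree `n`. -/
def parity : HmSum K E F →ₗ[K] HmSum K E F :=
  DirectSum.toModule K ℕ _ fun n => ((-1 : K) ^ n) • DirectSum.lof K ℕ (Hm K E F) n

end Degrees

/-! ### Bidegrees, the subalgebra `𝒬`, and the abelian subalgebra `𝔞` -/

section Bidegree

variable (K A B : Type*) [Field K] [AddCommGroup A] [Module K A] [AddCommGroup B] [Module K B]

/-- The space `C^{k|l}` of those `f ∈ Hom((A ⊕ B)^{⊗ n+1}, A ⊕ B)` that map `𝒜^{k+1,l}` into `A`
and `𝒜^{k,l+1}` into `B`, and vanish on all other `𝒜^{p,q}`. Here `s` is the set of the positions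
that hold an argument from `A`. (It is `0` unless `k + l = n`.) -/
def bidegree (n : ℕ) (k l : ℤ) : Submodule K (Hm K (A × B) (A × B) n) where
  carrier := {f | ∀ (s : Finset (Fin (n + 1))) (v : Fin (n + 1) → A × B),
    (∀ i ∈ s, (v i).2 = 0) → (∀ i ∉ s, (v i).1 = 0) →
      (((s.card : ℤ) = k + 1 ∧ (sᶜ.card : ℤ) = l) → (f v).2 = 0) ∧
      (((s.card : ℤ) = k ∧ (sᶜ.card : ℤ) = l + 1) → (f v).1 = 0) ∧
      (¬ ((s.card : ℤ) = k + 1 ∧ (sᶜ.card : ℤ) = l) →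
        ¬ ((s.card : ℤ) = k ∧ (sᶜ.card : ℤ) = l + 1) → f v = 0)}
  add_mem' := by
    intro f g hf hg s v h1 h2
    obtain ⟨a1, a2, a3⟩ := hf s v h1 h2
    obtain ⟨b1, b2, b3⟩ := hg s v h1 h2
    refine ⟨fun h => ?_, fun h => ?_, fun h h' => ?_⟩
    · simp [a1 h, b1 h]
    · simp [a2 h, b2 h]
    · simp [a3 h h', b3 h h']
  zero_mem' := by intro s v _ _; simp
  smul_mem' := by
    intro c f hf s v h1 h2
    obtain ⟨a1, a2, a3⟩ := hf s v h1 h2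
    refine ⟨fun h => ?_, fun h => ?_, fun h h' => ?_⟩
    · simp [a1 h]
    · simp [a2 h]
    · simp [a3 h h']

/-- `𝒬_n = C^{n+1|-1} ⊕ C^{n|0} ⊕ ⋯ ⊕ C^{0|n}`. -/
def quasiPart (n : ℕ) : Submodule K (Hm K (A × B) (A × B) n) :=
  ⨆ k ∈ Finset.range (n + 2), bidegree K A B n k (n - k)

variable {K A B}

/-- The projection of `A ⊕ B` to `A` or to `B`, as an endomorphism of `A ⊕ B`. -/
def proj (K A B : Type*) [Field K] [AddCommGroup A] [Module K A] [AddCommGroup B] [Module K B]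
    (b : Prop) [Decidable b] : (A × B) →ₗ[K] (A × B) :=
  if b then LinearMap.inl K A B ∘ₗ LinearMap.fst K A B
  else LinearMap.inr K A B ∘ₗ LinearMap.snd K A B

/-- The restriction of `f` to the arguments from `A` in the positions `s` and from `B` elsewhere,
with values in `A` or `B`. -/
def piece {n : ℕ} (f : Hm K (A × B) (A × B) n) (s : Finset (Fin (n + 1))) (b : Prop)
    [Decidable b] : Hm K (A × B) (A × B) n :=
  (proj K A B b).compMultilinearMap (f.compLinearMap fun i => proj K A B (i ∈ s))

theorem piece_mem {n : ℕ} (f : Hm K (A × B) (A × B) n) (s : Finset (Fin (n + 1))) (b : Prop)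
    [Decidable b] (k : ℤ) (hk : (s.card : ℤ) = if b then k + 1 else k) :
    piece f s b ∈ bidegree K A B n k (n - k) := by
  intro t v h1 h2
  by_cases hst : t = s
  · subst hst
    have hc : (tᶜ.card : ℤ) = n + 1 - t.card := by
      rw [Finset.card_compl, Fintype.card_fin, Nat.cast_sub (by simpa using t.card_le_univ)]
      push_cast; ring
    by_cases hb : b
    · simp only [hb, if_true] at hk
      refine ⟨fun _ => ?_, fun h => ?_, fun h _ => ?_⟩
      · simp [piece, proj, hb]
      · omega
      · exact absurd ⟨hk, by omega⟩ h
    · simp only [hb, if_false] at hk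
      refine ⟨fun h => ?_, fun _ => ?_, fun _ h => ?_⟩
      · omega
      · simp [piece, proj, hb]
      · exact absurd ⟨hk, by omega⟩ h
  · have h0 : piece f s b v = 0 := by
      obtain ⟨i, hi⟩ : ∃ i, ¬ (i ∈ t ↔ i ∈ s) := by
        by_contra hcon
        push Not at hcon
        exact hst (Finset.ext hcon)
      have hz : proj K A B (i ∈ s) (v i) = 0 := by
        by_cases his : i ∈ s
        · have : i ∉ t := fun h => hi ⟨fun _ => his, fun _ => h⟩
          simp [proj, his, h2 i this]
        · have : i ∈ t := by
            by_contra h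
            exact hi ⟨fun h' => absurd h' h, fun h' => absurd h' his⟩
          simp [proj, his, h1 i this]
      simp only [piece, LinearMap.compMultilinearMap_apply, MultilinearMap.compLinearMap_apply]
      rw [f.map_coord_zero i hz, map_zero]
    simp [h0]

theorem sum_piece {n : ℕ} (f : Hm K (A × B) (A × B) n) :
    ∑ s : Finset (Fin (n + 1)), (piece f s True + piece f s False) = f := by
  ext1 v
  have hv : v = (fun i => ((v i).1, (0 : B))) + (fun i => ((0 : A), (v i).2)) := by
    funext i; simp
  conv_rhs => rw [hv, f.map_add_univ]
  rw [_root_.sum_apply]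
  refine Finset.sum_congr rfl fun s _ => ?_
  have : s.piecewise (fun i => ((v i).1, (0 : B))) (fun i => ((0 : A), (v i).2)) =
      fun i => proj K A B (i ∈ s) (v i) := by
    funext i
    by_cases hi : i ∈ s <;> simp [Finset.piecewise, proj, hi]
  rw [this]
  simp [piece, proj]

/-- `𝒬_n` consists of the maps that send `B^{⊗ n+1}` into `B`. -/
theorem mem_quasiPart_iff {n : ℕ} (f : Hm K (A × B) (A × B) n) :
    f ∈ quasiPart K A B n ↔ ∀ v : Fin (n + 1) → A × B, (∀ i, (v i).1 = 0) → (f v).1 = 0 := by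
  constructor
  · intro hf v hv
    have key : quasiPart K A B n ≤
        LinearMap.ker (LinearMap.fst K A B ∘ₗ
          ({ toFun := fun g => g v, map_add' := fun _ _ => rfl, map_smul' := fun _ _ => rfl } :
            Hm K (A × B) (A × B) n →ₗ[K] A × B)) := by
      refine iSup₂_le fun k _ g hg => ?_
      obtain ⟨h1, h2, h3⟩ := hg ∅ v (by simp) (fun i _ => hv i)
      have : (g v).1 = 0 := by
        by_cases h : ((∅ : Finset (Fin (n + 1))).card : ℤ) = k ∧
            (((∅ : Finset (Fin (n + 1)))ᶜ.card : ℤ) = n - k + 1)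
        · exact h2 h
        · rw [h3 (fun h' => by simp at h'; omega) h]; rfl
      simpa using this
    simpa using key hf
  · intro hf
    rw [← sum_piece f]
    refine Submodule.sum_mem _ fun s _ => Submodule.add_mem _ ?_ ?_
    · by_cases hs : s = ∅
      · have : piece f s True = 0 := by
          ext1 v
          subst hs
          have := hf (fun i => (0, (v i).2)) (fun _ => rfl)
          simp [piece, proj, this]
        rw [this]; exact Submodule.zero_mem _
      · have hpos := Finset.card_pos.2 (Finset.nonempty_iff_ne_empty.2 hs)
        have hle : s.card ≤ n + 1 := by simpa using s.card_le_univ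
        refine Submodule.mem_iSup_of_mem (s.card - 1) (Submodule.mem_iSup_of_mem
          (Finset.mem_range.2 (by omega)) ?_)
        apply piece_mem
        simp only [if_true]
        omega
    · have hle : s.card ≤ n + 1 := by simpa using s.card_le_univ
      refine Submodule.mem_iSup_of_mem s.card (Submodule.mem_iSup_of_mem
        (Finset.mem_range.2 (by omega)) ?_)
      apply piece_mem
      simp

variable (K A B)

/-- `𝒬 = ⨁_n 𝒬_n`, as a subspace of `𝔤 = ⨁_n Hom((A ⊕ B)^{⊗ n+1}, A ⊕ B)`. -/
def quasi : Submodule K (HmSum K (A × B) (A × B)) where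
  carrier := {F | ∀ n, F n ∈ quasiPart K A B n}
  add_mem' := fun hF hG n => by
    rw [DirectSum.add_apply]; exact Submodule.add_mem _ (hF n) (hG n)
  zero_mem' := fun n => Submodule.zero_mem _
  smul_mem' := fun c F hF n => by
    rw [DirectSum.smul_apply]; exact Submodule.smul_mem _ c (hF n)

/-- `𝔞 = ⨁_n Hom(A^{⊗ n+1}, B)`. -/
abbrev Abel := HmSum K A B

/-- The inclusion of `𝔞` in `𝔤`: a map `f` is extended by `((a_i, x_i))_i ↦ (0, f(a_0, …, a_n))`. -/
def incl : Abel K A B →ₗ[K] HmSum K (A × B) (A × B) :=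
  DirectSum.toModule K ℕ _ fun n =>
    DirectSum.lof K ℕ (Hm K (A × B) (A × B)) n ∘ₗ
      { toFun := fun f => (LinearMap.inr K A B).compMultilinearMap
          (f.compLinearMap fun _ => LinearMap.fst K A B)
        map_add' := fun f g => by ext v <;> simp
        map_smul' := fun c f => by ext v <;> simp }

/-- The projection `P : 𝔤 → 𝔞`: a map `F` is restricted to arguments from `A` and the `B`-component
of its values is taken. -/
def projP : HmSum K (A × B) (A × B) →ₗ[K] Abel K A B :=
  DirectSum.toModule K ℕ _ fun n =>
    DirectSum.lof K ℕ (Hm K A B) n ∘ₗ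
      { toFun := fun f => (LinearMap.snd K A B).compMultilinearMap
          (f.compLinearMap fun _ => LinearMap.inl K A B)
        map_add' := fun f g => by ext v; simp
        map_smul' := fun c f => by ext v; simp }

variable {K A B}

theorem lof_mem_quasi {n : ℕ} {f : Hm K (A × B) (A × B) n} (hf : f ∈ quasiPart K A B n) :
    DirectSum.lof K ℕ (Hm K (A × B) (A × B)) n f ∈ quasi K A B := by
  intro m
  by_cases h : n = m
  · subst h; rw [DirectSum.lof_apply]; exact hf
  · rw [DirectSum.lof_eq_of, DirectSum.of_eq_of_ne _ _ _ (Ne.symm h)]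
    exact Submodule.zero_mem _

theorem ins_mem_quasiPart {m n : ℕ} (i : Fin (m + 1)) {f : Hm K (A × B) (A × B) m}
    {g : Hm K (A × B) (A × B) n} (hf : f ∈ quasiPart K A B m) (hg : g ∈ quasiPart K A B n) :
    ins i f g ∈ quasiPart K A B (m + n) := by
  rw [mem_quasiPart_iff] at *
  intro v hv
  apply hf
  intro j
  unfold insArgs
  split_ifs
  · exact hv _
  · exact hg _ fun t => hv _
  · exact hv _

theorem diamond_mem_quasiPart {m n : ℕ} {f : Hm K (A × B) (A × B) m}
    {g : Hm K (A × B) (A × B) n} (hf : f ∈ quasiPart K A B m) (hg : g ∈ quasiPart K A B n) :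
    diamond m n f g ∈ quasiPart K A B (m + n) := by
  simp only [diamond, LinearMap.sum_apply, LinearMap.smul_apply]
  exact Submodule.sum_mem _ fun i _ => Submodule.smul_mem _ _ (ins_mem_quasiPart i hf hg)

theorem bracketHom_mem_quasi {m n : ℕ} {f : Hm K (A × B) (A × B) m}
    {g : Hm K (A × B) (A × B) n} (hf : f ∈ quasiPart K A B m) (hg : g ∈ quasiPart K A B n) :
    bracketHom m n f g ∈ quasi K A B := by
  simp only [bracketHom, LinearMap.mk₂_apply]
  exact Submodule.sub_mem _ (lof_mem_quasi (diamond_mem_quasiPart hf hg))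
    (Submodule.smul_mem _ _ (lof_mem_quasi (diamond_mem_quasiPart hg hf)))

theorem eq_sum_lof (F : HmSum K (A × B) (A × B)) :
    open Classical in
    F = ∑ n ∈ DFinsupp.support F, DirectSum.lof K ℕ (Hm K (A × B) (A × B)) n (F n) := by
  classical
  exact (DirectSum.sum_support_of F).symm

/-- `𝒬` is closed under the Gerstenhaber bracket. -/
theorem bracket_mem_quasi {F G : HmSum K (A × B) (A × B)} (hF : F ∈ quasi K A B)
    (hG : G ∈ quasi K A B) : bracket K (A × B) F G ∈ quasi K A B := by
  classical
  rw [eq_sum_lof F, eq_sum_lof G]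
  simp only [map_sum, LinearMap.sum_apply]
  refine Submodule.sum_mem _ fun m _ => Submodule.sum_mem _ fun n _ => ?_
  simp only [bracket, DirectSum.toModule_lof, LinearMap.flip_apply]
  exact bracketHom_mem_quasi (hF _) (hG _)

theorem parity_mem_quasi {F : HmSum K (A × B) (A × B)} (hF : F ∈ quasi K A B) :
    parity K (A × B) (A × B) F ∈ quasi K A B := by
  classical
  rw [eq_sum_lof F]
  simp only [map_sum, parity, DirectSum.toModule_lof, LinearMap.smul_apply]
  exact Submodule.sum_mem _ fun m _ => Submodule.smul_mem _ _ (lof_mem_quasi (hF m))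

end Bidegree

/-! ### The `L_∞`-algebra `𝒬[1] ⊕ 𝔞` -/

section Voronov

variable (K A B : Type*) [Field K] [AddCommGroup A] [Module K A] [AddCommGroup B] [Module K B]

/-- The space `𝒬[1] ⊕ 𝔞`. -/
abbrev Total := (quasi K A B) × (Abel K A B)

/-- The elements of degree `d` of `𝒬[1] ⊕ 𝔞`: the pairs `(F[1], f)` with `F` of degree `d + 1` in
`𝒬` and `f` of degree `d` in `𝔞`. -/
def grading (d : ℤ) : Submodule K (Total K A B) :=
  ((degPart K (A × B) (A × B) (d + 1)).comap (quasi K A B).subtype).prod (degPart K A B d)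

variable {K A B}

/-- The list of the `f_j`, `j ≠ i`, in increasing order of `j`, where for `j < i` each `f_j` carries
the Koszul sign `(-1)^{(n-1)|f_j|}` of moving an element `F[1]` with `|F| = n` in front of it. -/
def otherArgs {k : ℕ} (f : Fin k → Abel K A B) (i : Fin k) (n : ℕ) :
    List (HmSum K (A × B) (A × B)) :=
  ((List.finRange k).filter fun j => j ≠ i).map fun j =>
    incl K A B (if j < i then ((parity K A B) ^ (n + 1)) (f j) else f j)

/-- The value of the derived bracket on `(f_1, …, f_{i-1}, F[1], f_{i+1}, …, f_k)`; for `F` of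
degree `n` it is `± P[⋯[[F, f_1], f_2], …, f_k]` (without `f_i`), with the Koszul sign of moving
`F[1]` to the front. -/
def mixedTerm {k : ℕ} (i : Fin k) (F : HmSum K (A × B) (A × B)) (f : Fin k → Abel K A B) :
    Abel K A B :=
  DirectSum.toModule K ℕ (Abel K A B)
    (fun n => projP K A B ∘ₗ iterBracket (otherArgs f i n) ∘ₗ
      DirectSum.lof K ℕ (Hm K (A × B) (A × B)) n) F

/-- The component in `𝒬[1]`: it is `(-1)^{|F|} [F, G][1]` for two arguments, otherwise `0`. -/
def quasiTerm : ∀ k : ℕ, (Fin k → Total K A B) → quasi K A B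
  | 2, x => ⟨bracket K (A × B) (parity K (A × B) (A × B) (x 0).1) (x 1).1,
      bracket_mem_quasi (parity_mem_quasi (x 0).1.2) (x 1).1.2⟩
  | _, _ => 0

variable (K A B)

/-- The operations `l̃_k` on `𝒬[1] ⊕ 𝔞` from the higher derived brackets, for `Δ = 0`. -/
def lTilde (k : ℕ) (x : Fin k → Total K A B) : Total K A B :=
  (quasiTerm k x, ∑ i : Fin k, mixedTerm i (x i).1 (fun j => (x j).2))

/-- The values that Voronov's construction (with `Δ = 0`) prescribes for operations on `𝒬[1] ⊕ 𝔞`.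
Together with graded symmetry and multilinearity they determine the operations. -/
structure IsVoronov (l : ∀ k : ℕ, (Fin k → Total K A B) → Total K A B) : Prop where
  /-- `l_1(F[1]) = P(F)` and `l_k(F[1], f_1, …, f_{k-1}) = P[⋯[[F, f_1], f_2], …, f_{k-1}]`. -/
  mixed : ∀ (r : ℕ) (F : quasi K A B) (f : Fin r → Abel K A B),
    l (r + 1) (Fin.cons (α := fun _ => Total K A B) (F, 0) fun j => (0, f j)) =
      (0, projP K A B (iterBracket (List.ofFn fun j => incl K A B (f j)) F))
  /-- `l_2(F[1], G[1]) = (-1)^{|F|} [F, G][1]`. -/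
  binary : ∀ (n : ℕ) (F G : quasi K A B),
    (F : HmSum K (A × B) (A × B)) ∈ degPart K (A × B) (A × B) n →
      (((l 2 ![(F, 0), (G, 0)]).1 : quasi K A B) : HmSum K (A × B) (A × B)) =
          ((-1 : K) ^ n) • bracket K (A × B) F G ∧
        (l 2 ![(F, 0), (G, 0)]).2 = 0
  /-- The operations vanish on `𝔞`. -/
  abelian : ∀ (k : ℕ) (f : Fin k → Abel K A B), l k (fun j => (0, f j)) = 0
  /-- For `k ≥ 3`, `l_k` vanishes if two of its arguments are from `𝒬[1]`. -/
  vanish : ∀ (k : ℕ) (x : Fin k → Total K A B) (i j : Fin k), 3 ≤ k → i ≠ j →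
    (x i).2 = 0 → (x j).2 = 0 → l k x = 0

end Voronov

/-! ### Quasi-twilled associative algebras and strong deformation maps -/

section QuasiTwilled

variable (K A B : Type*) [Field K] [AddCommGroup A] [Module K A] [AddCommGroup B] [Module K B]

/-- Bilinear maps `μ, ν, ▷, ◁, ⇀, ↼, θ`, without any conditions. -/
structure Ops where
  /-- `a ·_A b` -/
  mu : A →ₗ[K] A →ₗ[K] A
  /-- `x ·_B y` -/
  nu : B →ₗ[K] B →ₗ[K] B
  /-- `a ▷ x` -/
  actL : A →ₗ[K] B →ₗ[K] B
  /-- `x ◁ a` -/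
  actR : B →ₗ[K] A →ₗ[K] B
  /-- `x ⇀ a` -/
  harL : B →ₗ[K] A →ₗ[K] A
  /-- `a ↼ x` -/
  harR : A →ₗ[K] B →ₗ[K] A
  /-- `θ(a, b)` -/
  theta : A →ₗ[K] A →ₗ[K] B

variable {K A B}

namespace Ops

/-- Componentwise addition. -/
instance : Add (Ops K A B) where
  add T S := ⟨T.mu + S.mu, T.nu + S.nu, T.actL + S.actL, T.actR + S.actR, T.harL + S.harL,
    T.harR + S.harR, T.theta + S.theta⟩

/-- The multiplication on `A ⊕ B` with the components `T`. -/
def mul (T : Ops K A B) (p q : A × B) : A × B :=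
  (T.mu p.1 q.1 + T.harR p.1 q.2 + T.harL p.2 q.1,
    T.nu p.2 q.2 + T.actL p.1 q.2 + T.actR p.2 q.1 + T.theta p.1 q.1)

/-- `T` is a quasi-twilled associative algebra: the multiplication on `A ⊕ B` is associative, and
`B` is a subalgebra. -/
structure IsQuasiTwilled (T : Ops K A B) : Prop where
  assoc : ∀ p q r : A × B, T.mul (T.mul p q) r = T.mul p (T.mul q r)
  subalgebra : ∀ x y : B, (T.mul (0, x) (0, y)).1 = 0

/-- The linear map `D : A → B` is a strong deformation map in `T`. -/
def IsStrongDeformationMap (T : Ops K A B) (D : A →ₗ[K] B) : Prop :=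
  ∀ a b : A, D (T.mu a b + T.harR a (D b) + T.harL (D a) b) =
    T.nu (D a) (D b) + T.actL a (D b) + T.actR (D a) b + T.theta a b

/-- `θ̃((a, x), (b, y)) = (0, θ(a, b))` -/
def thetaTilde (T : Ops K A B) : (A × B) →ₗ[K] (A × B) →ₗ[K] (A × B) :=
  LinearMap.mk₂ K (fun p q => (0, T.theta p.1 q.1))
    (by intros; simp) (by intros; simp) (by intros; simp) (by intros; simp)

/-- `μ_{▷,◁}((a, x), (b, y)) = (a ·_A b, a ▷ y + x ◁ b)` -/
def muTilde (T : Ops K A B) : (A × B) →ₗ[K] (A × B) →ₗ[K] (A × B) :=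
  LinearMap.mk₂ K (fun p q => (T.mu p.1 q.1, T.actL p.1 q.2 + T.actR p.2 q.1))
    (by intros; ext <;> simp; abel) (by intros; ext <;> simp)
    (by intros; ext <;> simp; abel) (by intros; ext <;> simp)

/-- `ν_{⇀,↼}((a, x), (b, y)) = (a ↼ y + x ⇀ b, x ·_B y)` -/
def nuTilde (T : Ops K A B) : (A × B) →ₗ[K] (A × B) →ₗ[K] (A × B) :=
  LinearMap.mk₂ K (fun p q => (T.harR p.1 q.2 + T.harL p.2 q.1, T.nu p.2 q.2))
    (by intros; ext <;> simp; abel) (by intros; ext <;> simp)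
    (by intros; ext <;> simp; abel) (by intros; ext <;> simp)

end Ops

/-- A bilinear map as an element of `Hom(E^{⊗ 2}, E)`. -/
def ofBilin {E : Type*} [AddCommGroup E] [Module K E] (m : E →ₗ[K] E →ₗ[K] E) : Hm K E E 1 :=
  MultilinearMap.mk' (fun v => m (v 0) (v 1))
    (by intro v i x y; fin_cases i <;> simp)
    (by intro v i c x; fin_cases i <;> simp)

/-- `Ω = θ̃ + μ_{▷,◁} + ν_{⇀,↼}` as an element of `𝒬_1 ⊆ 𝒬`. -/
def Omega (T : Ops K A B) : quasi K A B :=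
  ⟨DirectSum.lof K ℕ (Hm K (A × B) (A × B)) 1
      (ofBilin T.thetaTilde + ofBilin T.muTilde + ofBilin T.nuTilde),
    lof_mem_quasi ((mem_quasiPart_iff _).2 fun v hv => by
      simp [ofBilin, Ops.thetaTilde, Ops.muTilde, Ops.nuTilde, hv])⟩

/-- A linear map `D : A → B` as an element of `𝔞_0 = Hom(A, B)`. -/
def ofLinear (D : A →ₗ[K] B) : Abel K A B :=
  DirectSum.lof K ℕ (Hm K A B) 0 (MultilinearMap.ofSubsingleton K A B (0 : Fin 1) D)

/-- The element `(Ω[1], D)` of `𝒬[1] ⊕ 𝔞`. -/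
def mcElement (T : Ops K A B) (D : A →ₗ[K] B) : Total K A B := (Omega T, ofLinear D)

end QuasiTwilled

end QTwilled

/-! The operations are Voronov's higher derived brackets for the data `(𝔤, 𝔞, P, Δ = 0)`, with the
outer part restricted to the subalgebra `𝒬`. Three facts make this work. The product `⋄` is graded
right pre-Lie (`dia_assoc`), so its commutator satisfies the graded Jacobi identity
(`bracket_jacobi`). The subspace `𝔞` is abelian, because its elements take arguments in `A` and have
values in `B` (`dia_incl_incl`). Finally `P(x ⋄ y) = P(x ⋄ Py) + P(Px ⋄ y)` (`projP_dia`). The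
generalized Jacobi identity is multilinear and graded symmetric, so it suffices to test it on
entries from `𝒬[1]` followed by entries from `𝔞`. With at most one entry from `𝒬[1]` every term
vanishes. With two, the identity is the Leibniz rule for iterated brackets followed by `P`
(`projP_iterBracket_bracket`). With three and nothing else, it is the Jacobi identity of the
bracket. In all remaining cases every term vanishes again.

Weak filtration rests on a weight argument. Bracketing with the projection to `B` (`euler`)
multiplies `C^{k|l}` by `l` and `𝔞` by `-1`, and `P` sees only weight `-1`. Hence, in characteristic
`0`, `P[⋯[F, f_1], …, f_r]` can be non-zero only if `l - r = -1`, which forces `r ≤ n + 1` for `F`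
in `𝒬_n` (`projP_iterBracket_eq_zero`). In each degree only finitely many operations survive, so a
filtration that is eventually zero in every degree suffices, and all exponential series are finite.

For `α = (Ω[1], D)` the Maurer–Cartan series has the components `-½[Ω, Ω]` and `P(Ω) + P[Ω, D] +
½P[[Ω, D], D]` (`twistList_mcElement`). The first vanishes exactly when `Ω` is associative, the
second exactly when `D` is a strong deformation map (`mcSum_apply`).

Twisting is formal once the series are finite. The Jacobi identity on `n` copies of `α` and further
entries, divided by `n!` and summed over `n`, is the Jacobi identity of the twisted operations
(`ListLInf.twistList_jacobi`). The binomial formula identifies the Maurer–Cartan series of `β` after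
twisting with that of `α + β` (`isMaurerCartan_twist_iff`).

For the bookkeeping, operations are functions of lists, symmetry is checked on neighbouring entries
only, and shuffle sums become the recursion `unsh` (`sum_shuffles_eq_unsh`). -/

namespace QTwilled

/-! ### Signs -/

/-- The sign `(-1)^d`. -/
def sg (d : ℤ) : ℤ := ((Int.negOnePow d : ℤˣ) : ℤ)

theorem sg_add (a b : ℤ) : sg (a + b) = sg a * sg b := by
  simp [sg, Int.negOnePow_add]

@[simp] theorem sg_zero : sg 0 = 1 := by simp [sg]

@[simp] theorem sg_one : sg 1 = -1 := by simp [sg]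

theorem sg_eq_or (a : ℤ) : sg a = 1 ∨ sg a = -1 := by
  rcases Int.even_or_odd a with h | h
  · left; simp [sg, Int.negOnePow_even a h]
  · right; simp [sg, Int.negOnePow_odd a h]

@[simp] theorem sg_mul_self (a : ℤ) : sg a * sg a = 1 := by
  rcases sg_eq_or a with h | h <;> simp [h]

/-- Signs depend on exponents modulo 2 only, so every later comparison of Koszul signs becomes a
finite check over `ZMod 2`, closed by `decide`. -/
theorem sg_congr {a b : ℤ} (h : (a : ZMod 2) = b) : sg a = sg b := by
  have h1 : Even (a - b) := by
    rw [even_iff_two_dvd]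
    have := (ZMod.intCast_eq_intCast_iff_dvd_sub b a 2).1 h.symm
    simpa using this
  have := (Int.negOnePow_eq_iff a b).2 h1
  simp [sg, this]

theorem neg_one_pow_smul_eq_sg {K M : Type*} [Field K] [AddCommGroup M] [Module K M] (n : ℕ)
    (x : M) : ((-1 : K) ^ n) • x = sg n • x := by
  rcases Nat.even_or_odd n with h | h
  · have : sg n = 1 := by simp [sg, Int.negOnePow_even (n : ℤ) (by exact_mod_cast h)]
    simp [this, h.neg_one_pow]
  · have : sg n = -1 := by simp [sg, Int.negOnePow_odd (n : ℤ) (by exact_mod_cast h)]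
    simp [this, h.neg_one_pow]

/-! ### Signed unshuffles of lists -/

section Unshuffle

variable {H M N : Type*} [AddCommGroup M] [AddCommGroup N] (deg : H → ℤ)

/-- The sum of the degrees of the entries of a list. -/
def dsum (I : List H) : ℤ := (I.map deg).sum

@[simp] theorem dsum_nil : dsum deg ([] : List H) = 0 := rfl

@[simp] theorem dsum_cons (x : H) (I : List H) : dsum deg (x :: I) = deg x + dsum deg I := by
  simp [dsum]

@[simp] theorem dsum_append (I J : List H) : dsum deg (I ++ J) = dsum deg I + dsum deg J := by
  simp [dsum]

/-- The signed sum of `φ I J` over the ways to distribute the entries of a list to two sublists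
`I` and `J`, with the Koszul sign of the unshuffle. -/
def unsh : List H → (List H → List H → M) → M
  | [], φ => φ [] []
  | x :: xs, φ => unsh xs (fun I J => φ (x :: I) J) +
      unsh xs (fun I J => sg (deg x * dsum deg I) • φ I (x :: J))

variable {deg}

/-- The permutation hypothesis transports properties of the entries to `I` and `J`. The sublist
hypotheses leave finitely many `I` and `J`, which allows uniform bounds in the twisting argument. -/
theorem unsh_congr {xs : List H} {φ ψ : List H → List H → M}
    (h : ∀ I J : List H, (I ++ J).Perm xs → I.Sublist xs → J.Sublist xs → φ I J = ψ I J) :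
    unsh deg xs φ = unsh deg xs ψ := by
  induction xs generalizing φ ψ with
  | nil => exact h [] [] (by simp) (by simp) (by simp)
  | cons x xs ih =>
    simp only [unsh]
    congr 1
    · exact ih fun I J h1 h2 h3 => h _ _ (by simpa using h1) (h2.cons_cons x) (h3.cons x)
    · refine ih fun I J h1 h2 h3 => ?_
      rw [h _ _ (List.perm_middle.trans (h1.cons x)) (h2.cons x) (h3.cons_cons x)]

theorem unsh_add (xs : List H) (φ ψ : List H → List H → M) :
    unsh deg xs (fun I J => φ I J + ψ I J) = unsh deg xs φ + unsh deg xs ψ := by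
  induction xs generalizing φ ψ with
  | nil => rfl
  | cons x xs ih => simp only [unsh, smul_add, ih]; abel

theorem unsh_map {F : Type*} [FunLike F M N] [AddMonoidHomClass F M N] (g : F) (xs : List H)
    (φ : List H → List H → M) :
    unsh deg xs (fun I J => g (φ I J)) = g (unsh deg xs φ) := by
  induction xs generalizing φ with
  | nil => rfl
  | cons x xs ih => simp only [unsh, map_add, ← ih, map_zsmul]

theorem unsh_zsmul (c : ℤ) (xs : List H) (φ : List H → List H → M) :
    unsh deg xs (fun I J => c • φ I J) = c • unsh deg xs φ :=
  unsh_map (zsmulAddGroupHom c : M →+ M) xs φ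

theorem unsh_zero (xs : List H) : unsh deg xs (fun _ _ => (0 : M)) = 0 := by
  simpa using unsh_zsmul (deg := deg) 0 xs (fun _ _ => (0 : M))

theorem unsh_eq_zero {xs : List H} {φ : List H → List H → M}
    (h : ∀ I J : List H, (I ++ J).Perm xs → φ I J = 0) : unsh deg xs φ = 0 := by
  rw [← unsh_zero (deg := deg) (M := M) xs]
  exact unsh_congr fun I J h1 _ _ => h I J h1

theorem unsh_sum {ι : Type*} (s : Finset ι) (xs : List H) (φ : ι → List H → List H → M) :
    unsh deg xs (fun I J => ∑ i ∈ s, φ i I J) = ∑ i ∈ s, unsh deg xs (φ i) := by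
  classical
  induction s using Finset.induction_on with
  | empty => simp [unsh_zero]
  | insert a s ha ih => simp only [Finset.sum_insert ha, unsh_add, ih]

/-- Exchanging the two halves is an involution on the splittings, and it changes the Koszul sign by
that of moving all of `J` past all of `I`. -/
theorem unsh_swap (xs : List H) (φ : List H → List H → M) :
    unsh deg xs (fun I J => sg (dsum deg I * dsum deg J) • φ J I) = unsh deg xs φ := by
  induction xs generalizing φ with
  | nil => simp [unsh]
  | cons x xs ih =>
    simp only [unsh]
    rw [add_comm, ← ih fun I J => φ (x :: I) J,
      ← ih fun I J => sg (deg x * dsum deg I) • φ I (x :: J)]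
    congr 1 <;>
    · refine unsh_congr fun I J _ _ _ => ?_
      simp only [smul_smul, ← sg_add, dsum_cons]
      congr 1
      apply sg_congr
      push_cast
      generalize (deg x : ZMod 2) = a
      generalize (dsum deg I : ZMod 2) = b
      generalize (dsum deg J : ZMod 2) = c
      revert a b c; decide

theorem unsh_eq_left (xs : List H) (φ : List H → List H → M)
    (h : ∀ a I J, φ (a :: I) J = 0) : unsh deg xs φ = φ [] xs := by
  induction xs generalizing φ with
  | nil => rfl
  | cons x xs ih =>
    simp only [unsh, h, unsh_zero, zero_add]
    rw [ih _ (by simp [h])]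
    simp

/-- Graded symmetry of a function of a list, for the exchange of neighbours. -/
def SwapSymm (deg : H → ℤ) (Φ : List H → M) : Prop :=
  ∀ p a b q, Φ (p ++ a :: b :: q) = sg (deg a * deg b) • Φ (p ++ b :: a :: q)

theorem SwapSymm.cons {Φ : List H → M} (h : SwapSymm deg Φ) (x : H) :
    SwapSymm deg fun I => Φ (x :: I) := fun p => h (x :: p)

theorem SwapSymm.dsum_smul {Φ : List H → M} (h : SwapSymm deg Φ) (c : ℤ) :
    SwapSymm deg fun I => sg (c * dsum deg I) • Φ I := fun p a b q => by
  simp only [dsum_append, dsum_cons]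
  rw [h p a b q, smul_comm, add_left_comm (deg a) (deg b)]

theorem SwapSymm.zsmul {Φ : List H → M} (h : SwapSymm deg Φ) (c : ℤ) :
    SwapSymm deg fun I => c • Φ I := fun p a b q => by
  simp only []
  rw [h p a b q, smul_comm]

/-- The signs of the successive exchanges of `a` with the entries of `q` multiply to one sign with
exponent `deg a * dsum deg q`. -/
theorem SwapSymm.swap_sublist {Φ : List H → M} (h : SwapSymm deg Φ) (p : List H) (a : H)
    (q r : List H) :
    Φ (p ++ a :: (q ++ r)) = sg (deg a * dsum deg q) • Φ (p ++ q ++ a :: r) := by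
  induction q generalizing p with
  | nil => simp
  | cons b q ih =>
    have := ih (p ++ [b])
    simp only [List.append_assoc, List.cons_append, List.nil_append] at this ⊢
    rw [h p a b, this, smul_smul, ← sg_add, dsum_cons, mul_add]

/-- One sign must serve all symmetric `φ` at once: in the `cons` case the induction hypothesis is
applied to two different functions built from `φ`, and both need the same `s`. Its value is
irrelevant, as only vanishing is transported. -/
theorem unsh_perm {xs ys : List H} (h : xs.Perm ys) :
    ∃ s : ℤ, ∀ φ : List H → List H → M, (∀ J, SwapSymm deg fun I => φ I J) →
      (∀ I, SwapSymm deg fun J => φ I J) → unsh deg xs φ = s • unsh deg ys φ := by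
  induction h with
  | nil => exact ⟨1, fun φ _ _ => by simp⟩
  | cons x h ih =>
    obtain ⟨s, hs⟩ := ih
    refine ⟨s, fun φ h1 h2 => ?_⟩
    simp only [unsh, smul_add]
    rw [hs _ (fun J => (h1 J).cons x) (fun I => h2 (x :: I)),
      hs _ (fun J => (h1 (x :: J)).dsum_smul _) (fun I => ((h2 I).cons x).zsmul _)]
  | swap x y xs =>
    refine ⟨sg (deg x * deg y), fun φ h1 h2 => ?_⟩
    simp only [unsh, ← unsh_add, ← unsh_zsmul]
    refine unsh_congr fun I J _ _ _ => ?_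
    have e1 := h1 J [] x y I
    have e2 := h2 I [] x y J
    simp only [List.nil_append] at e1 e2
    rw [e1, e2]
    simp only [dsum_cons, smul_add, smul_smul, ← sg_add]
    have t : ∀ {a b : ℤ} {z : M}, (a : ZMod 2) = b → sg a • z = sg b • z :=
      fun h => by rw [sg_congr h]
    -- The four terms place the two exchanged entries both in `I`, one in each half (in two ways),
    -- or both in `J`. The two mixed placements trade places; the others match by the symmetry of
    -- `φ`.
    have key : ∀ a b c d : M, a + b + (c + d) = a + c + (b + d) := fun a b c d => by abel
    rw [key]
    congr 1
    · congr 1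
      · rw [sg_add, sg_mul_self, one_smul]
      · apply t
        push_cast
        generalize (deg x : ZMod 2) = a
        generalize (deg y : ZMod 2) = b
        generalize (dsum deg I : ZMod 2) = c
        revert a b c; decide
    · congr 1
      · apply t
        push_cast
        generalize (deg x : ZMod 2) = a
        generalize (deg y : ZMod 2) = b
        generalize (dsum deg I : ZMod 2) = c
        revert a b c; decide
      · apply t
        push_cast
        generalize (deg x : ZMod 2) = a
        generalize (deg y : ZMod 2) = b
        generalize (dsum deg I : ZMod 2) = c
        revert a b c; decide
  | trans _ _ ih1 ih2 =>
    obtain ⟨s, hs⟩ := ih1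
    obtain ⟨t, ht⟩ := ih2
    exact ⟨s * t, fun φ h1 h2 => by rw [hs φ h1 h2, ht φ h1 h2, smul_smul]⟩

/-- Repeated entries of degree `0` are distributed with binomial coefficients. -/
theorem unsh_replicate {a : H} (ha : deg a = 0) (n : ℕ) (xs : List H)
    (φ : List H → List H → M) :
    unsh deg (List.replicate n a ++ xs) φ = ∑ p ∈ Finset.HasAntidiagonal.antidiagonal (n : ℕ), n.choose p.1 •
      unsh deg xs (fun I J => φ (List.replicate p.1 a ++ I) (List.replicate p.2 a ++ J)) := by
  induction n generalizing φ with
  | zero => simp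
  | succ n ih =>
    -- Pascal's rule: the first copy of `a` goes to the left or to the right list, without sign
    -- because its degree is `0`.
    rw [Finset.sum_antidiagonal_choose_succ_nsmul
      (fun i j => unsh deg xs fun I J => φ (List.replicate i a ++ I) (List.replicate j a ++ J))]
    simp only [List.replicate_succ, List.cons_append, unsh, ha, zero_mul, sg_zero, one_smul]
    rw [ih, ih, add_comm]
    congr 1
    refine Finset.sum_congr rfl fun p hp => ?_
    have : n.choose p.1 = n.choose p.2 := by
      rw [← Finset.HasAntidiagonal.mem_antidiagonal.1 hp, Nat.choose_symm_add]
    rw [this]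

end Unshuffle


/-! ### The Koszul sign of a permutation and the sum over shuffles -/

section Koszul

variable {ι H M : Type*} [LinearOrder ι] [AddCommGroup M]

/-- The product of the Koszul signs of the inversions of a list of indices. -/
def lsgn (d : ι → ℤ) : List ι → ℤ
  | [] => 1
  | a :: L => (L.map fun b => if b < a then sg (d a * d b) else 1).prod * lsgn d L

theorem lsgn_mul_self (d : ι → ℤ) (L : List ι) : lsgn d L * lsgn d L = 1 := by
  induction L with
  | nil => rfl
  | cons a L ih =>
    simp only [lsgn]
    rw [mul_mul_mul_comm, ih, mul_one, ← List.prod_map_mul]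
    apply List.prod_eq_one
    simp only [List.mem_map]
    rintro _ ⟨b, _, rfl⟩
    split_ifs <;> simp

theorem lsgn_sorted (d : ι → ℤ) {L : List ι} (h : L.Pairwise (· < ·)) : lsgn d L = 1 := by
  induction L with
  | nil => rfl
  | cons a L ih =>
    rw [List.pairwise_cons] at h
    simp only [lsgn, ih h.2, mul_one]
    apply List.prod_eq_one
    simp only [List.mem_map]
    rintro _ ⟨b, hb, rfl⟩
    rw [if_neg (h.1 b hb).not_gt]

/-- A neighbour exchange changes `lsgn` and `Φ` by the same sign, so the product is invariant.
Distinctness of the indices ensures that exactly one of the two orders is an inversion. Comparison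
with the sorted list, whose sign is `1`, upgrades symmetry for neighbours to symmetry for all
permutations. -/
theorem lsgn_smul_of_perm (d : ι → ℤ) {L L' : List ι} (h : L.Perm L') :
    ∀ (Φ : List ι → M), L.Nodup → SwapSymm d Φ → lsgn d L • Φ L = lsgn d L' • Φ L' := by
  induction h with
  | nil => intro Φ _ _; rfl
  | cons x h ih =>
    intro Φ hn hΦ
    simp only [lsgn, mul_smul]
    rw [ih (fun I => Φ (x :: I)) (List.nodup_cons.1 hn).2 (hΦ.cons x), (h.map _).prod_eq]
  | swap x y L =>
    intro Φ hn hΦ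
    have hxy : y ≠ x := by
      rintro rfl
      simp at hn
    have e := hΦ [] y x L
    simp only [List.nil_append] at e
    rw [e]
    simp only [lsgn, List.map_cons, List.prod_cons, smul_smul]
    congr 1
    rcases hxy.lt_or_gt with h | h
    · rw [if_neg h.not_gt, if_pos h, mul_comm (d y)]; ring
    · rw [if_neg h.not_gt, if_pos h]
      rcases sg_eq_or (d y * d x) with h' | h' <;> rw [h'] <;> ring
  | trans h1 _ ih1 ih2 =>
    intro Φ hn hΦ
    rw [ih1 Φ hn hΦ, ih2 Φ (h1.nodup_iff.1 hn) hΦ]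

theorem prod_inversions_eq_lsgn (d : ι → ℤ) {k : ℕ} (a : Fin k → ι) :
    (∏ p : Fin k × Fin k, if p.1 < p.2 ∧ a p.2 < a p.1 then sg (d (a p.1) * d (a p.2)) else 1) =
      lsgn d (List.ofFn a) := by
  induction k with
  | zero => simp [lsgn]
  | succ k ih =>
    rw [Fintype.prod_prod_type, Fin.prod_univ_succ, List.ofFn_succ, lsgn, ← ih,
      Fintype.prod_prod_type]
    congr 1
    · rw [Fin.prod_univ_succ, List.map_ofFn, List.prod_ofFn]
      simp
    · refine Finset.prod_congr rfl fun i _ => ?_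
      rw [Fin.prod_univ_succ]
      simp

theorem koszulSign_eq_lsgn {k : ℕ} (d : Fin k → ℤ) (σ : Equiv.Perm (Fin k)) :
    koszulSign d σ = lsgn d (List.ofFn σ) := by
  rw [← prod_inversions_eq_lsgn]
  rfl

theorem ofFn_perm_finRange {k : ℕ} (σ : Equiv.Perm (Fin k)) :
    (List.ofFn σ).Perm (List.finRange k) := by
  rw [List.ofFn_eq_map]
  exact Equiv.Perm.map_finRange_perm σ

theorem apply_ofFn_perm {k : ℕ} (d : Fin k → ℤ) (σ : Equiv.Perm (Fin k)) (Φ : List (Fin k) → M)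
    (h : SwapSymm d Φ) : Φ (List.ofFn σ) = koszulSign d σ • Φ (List.finRange k) := by
  have := lsgn_smul_of_perm d (ofFn_perm_finRange σ) Φ (by
    rw [List.nodup_ofFn]; exact σ.injective) h
  rw [lsgn_sorted d (List.pairwise_lt_finRange k), one_smul] at this
  rw [koszulSign_eq_lsgn, ← this, smul_smul, lsgn_mul_self, one_smul]

/-- The ways to distribute the entries of a list to two sublists. -/
def splits : List ι → List (List ι × List ι)
  | [] => [([], [])]
  | x :: L => (splits L).map (fun p => (x :: p.1, p.2)) ++ (splits L).map fun p => (p.1, x :: p.2)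

theorem mem_splits_cons {ι : Type*} {x : ι} {L : List ι} {p : List ι × List ι} :
    p ∈ splits (x :: L) ↔ (∃ I J, (I, J) ∈ splits L ∧ p = (x :: I, J)) ∨
      ∃ I J, (I, J) ∈ splits L ∧ p = (I, x :: J) := by
  simp [splits, eq_comm]

theorem perm_of_mem_splits {ι : Type*} {L I J : List ι} (h : (I, J) ∈ splits L) : (I ++ J).Perm L := by
  induction L generalizing I J with
  | nil => simp_all [splits]
  | cons x L ih =>
    rcases mem_splits_cons.1 h with ⟨I', J', h', e⟩ | ⟨I', J', h', e⟩ <;> cases e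
    · exact (ih h').cons x
    · exact List.perm_middle.trans ((ih h').cons x)

theorem nodup_splits {L : List ι} (h : L.Nodup) : (splits L).Nodup := by
  induction L with
  | nil => simp [splits]
  | cons x L ih =>
    rw [List.nodup_cons] at h
    rw [splits, List.nodup_append]
    refine ⟨(ih h.2).map fun p q e => ?_, (ih h.2).map fun p q e => ?_, ?_⟩
    · simp only [Prod.mk.injEq, List.cons.injEq, true_and] at e
      exact Prod.ext e.1 e.2
    · simp only [Prod.mk.injEq, List.cons.injEq, true_and] at e
      exact Prod.ext e.1 e.2
    · simp only [List.mem_map]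
      rintro _ ⟨p, hp, rfl⟩ _ ⟨q, hq, rfl⟩ e
      simp only [Prod.mk.injEq] at e
      refine h.1 ((perm_of_mem_splits hq).subset ?_)
      rw [← e.1]
      simp

/-- The least entry of `L` must be the head of whichever of `I`, `J` contains it, and it can be
stripped off there. -/
theorem mem_splits_of_sorted {L I J : List ι} (hL : L.Pairwise (· < ·)) (hI : I.Pairwise (· < ·))
    (hJ : J.Pairwise (· < ·)) (h : (I ++ J).Perm L) : (I, J) ∈ splits L := by
  induction L generalizing I J with
  | nil => simp_all [splits]
  | cons x L ih =>
    rw [List.pairwise_cons] at hL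
    rw [mem_splits_cons]
    have hmin : ∀ y ∈ I ++ J, x ≤ y := fun y hy => by
      rcases List.mem_cons.1 (h.subset hy) with rfl | h
      · exact le_rfl
      · exact (hL.1 y h).le
    have head : ∀ K : List ι, K.Pairwise (· < ·) → (∀ y ∈ K, x ≤ y) → x ∈ K →
        ∃ K', K = x :: K' := by
      rintro (_ | ⟨y, K⟩) h1 h2 h3
      · simp at h3
      · refine ⟨K, ?_⟩
        rcases List.mem_cons.1 h3 with rfl | h3
        · rfl
        · exact absurd ((List.pairwise_cons.1 h1).1 x h3) (h2 y (by simp)).not_gt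
    rcases List.mem_append.1 (h.symm.subset (List.mem_cons_self (a := x))) with hx | hx
    · obtain ⟨I, rfl⟩ := head I hI (fun y hy => hmin y (by simp [hy])) hx
      refine Or.inl ⟨I, J, ih hL.2 (List.pairwise_cons.1 hI).2 hJ ?_, rfl⟩
      exact (List.perm_cons x).1 h
    · obtain ⟨J, rfl⟩ := head J hJ (fun y hy => hmin y (by simp [hy])) hx
      refine Or.inr ⟨I, J, ih hL.2 hI (List.pairwise_cons.1 hJ).2 ?_, rfl⟩
      exact (List.perm_cons x).1 (List.perm_middle.symm.trans h)

theorem lsgn_cons_of_lt (d : ι → ℤ) {x : ι} {L : List ι} (h : ∀ y ∈ L, x < y) :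
    lsgn d (x :: L) = lsgn d L := by
  rw [lsgn, List.prod_eq_one, one_mul]
  simp only [List.mem_map]
  rintro _ ⟨b, hb, rfl⟩
  rw [if_neg (h b hb).not_gt]

/-- The least index `x` forms an inversion with every entry of `I` and with none of `J`. This is the
sign that the recursion of `unsh` inserts. -/
theorem lsgn_append_cons (d : ι → ℤ) {x : ι} {I J : List ι} (h : ∀ y ∈ I ++ J, x < y) :
    lsgn d (I ++ x :: J) = sg (d x * dsum d I) * lsgn d (I ++ J) := by
  induction I with
  | nil => simp [lsgn_cons_of_lt d (L := J) (by simpa using h)]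
  | cons a I ih =>
    have hx : x < a := h a (by simp)
    simp only [List.cons_append, lsgn, List.map_append, List.map_cons, List.prod_append,
      List.prod_cons, if_pos hx, ih fun y hy => h y (by simp at hy ⊢; tauto), dsum_cons, mul_add,
      sg_add, mul_comm (d x) (d a)]
    ring

theorem unsh_eq_sum_splits (deg : H → ℤ) (h : ι → H) {L : List ι} (hL : L.Pairwise (· < ·))
    (φ : List H → List H → M) :
    unsh deg (L.map h) φ = ((splits L).map fun p =>
      lsgn (fun i => deg (h i)) (p.1 ++ p.2) • φ (p.1.map h) (p.2.map h)).sum := by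
  induction L generalizing φ with
  | nil => simp [splits, unsh, lsgn]
  | cons x L ih =>
    rw [List.pairwise_cons] at hL
    simp only [List.map_cons, unsh, splits, List.map_append, List.sum_append, List.map_map]
    rw [ih hL.2, ih hL.2]
    have hlt : ∀ p ∈ splits L, ∀ y ∈ p.1 ++ p.2, x < y := fun p hp y hy =>
      hL.1 y ((perm_of_mem_splits hp).subset hy)
    congr 2
    · refine List.map_congr_left fun p hp => ?_
      simp [lsgn_cons_of_lt _ (hlt p hp)]
    · refine List.map_congr_left fun p hp => ?_
      simp only [Function.comp, List.map_cons]
      rw [lsgn_append_cons _ (hlt p hp), smul_smul, mul_comm]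
      congr 3
      simp [dsum, Function.comp_def]

/-- The sum over all shuffles as a sum over unshuffles of a list. -/
theorem sum_shuffles_eq_unsh (deg : H → ℤ) {N : ℕ} (h : Fin N → H) (φ : List H → List H → M) :
    (open Classical in
    ∑ i : Fin (N + 1), ∑ σ : Equiv.Perm (Fin N) with IsShuffle (i : ℕ) σ,
      koszulSign (fun j => deg (h j)) σ •
        φ (List.ofFn fun j : Fin (i : ℕ) => h (σ ⟨(j : ℕ), by omega⟩))
          (List.ofFn fun j : Fin (N - (i : ℕ)) => h (σ ⟨(i : ℕ) + (j : ℕ), by omega⟩))) =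
      unsh deg (List.ofFn h) φ := by
  classical
  rw [List.ofFn_eq_map, unsh_eq_sum_splits deg h (List.pairwise_lt_finRange N)]
  rw [← List.sum_toFinset _ (nodup_splits (List.nodup_finRange N)), Finset.sum_sigma']
  have happ : ∀ (i : Fin (N + 1)) (σ : Equiv.Perm (Fin N)),
      (List.ofFn fun j : Fin (i : ℕ) => σ ⟨(j : ℕ), by omega⟩) ++
        (List.ofFn fun j : Fin (N - (i : ℕ)) => σ ⟨(i : ℕ) + (j : ℕ), by omega⟩) =
      List.ofFn σ := by
    intro i σ
    apply List.ext_getElem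
    · simp; omega
    · intro n h1 h2
      rw [List.getElem_append]
      split_ifs with h3
      · simp
      · simp only [List.getElem_ofFn, List.length_ofFn]
        congr 2
        simp at h3
        omega
  -- A shuffle `(i, σ)` corresponds to the lists of its first `i` and of its remaining values.
  -- Conversely, `i` is the length of `I`, and `σ` enumerates `I ++ J`.
  refine Finset.sum_bij (fun s _ =>
    (List.ofFn fun j : Fin (s.1 : ℕ) => s.2 ⟨(j : ℕ), by omega⟩,
      List.ofFn fun j : Fin (N - (s.1 : ℕ)) => s.2 ⟨(s.1 : ℕ) + (j : ℕ), by omega⟩)) ?_ ?_ ?_ ?_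
  · rintro ⟨i, σ⟩ hs
    simp only [Finset.mem_sigma, Finset.mem_univ, Finset.mem_filter, true_and] at hs
    rw [List.mem_toFinset]
    refine mem_splits_of_sorted (List.pairwise_lt_finRange N) ?_ ?_ ?_
    · rw [List.pairwise_ofFn]
      intro a b hab
      exact hs _ _ (by simpa using hab) (Or.inl (by simp))
    · rw [List.pairwise_ofFn]
      intro a b hab
      exact hs _ _ (by simpa using hab) (Or.inr (by simp))
    · rw [happ]
      exact ofFn_perm_finRange σ
  · rintro ⟨i, σ⟩ _ ⟨j, τ⟩ _ e
    simp only [Prod.mk.injEq] at e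
    have h1 := congrArg List.length e.1
    simp only [List.length_ofFn] at h1
    have h2 : List.ofFn σ = List.ofFn τ := by rw [← happ i σ, ← happ j τ, e.1, e.2]
    have h3 : i = j := Fin.ext h1
    have h4 : σ = τ := DFunLike.coe_injective (List.ofFn_injective h2)
    rw [h3, h4]
  · rintro ⟨I, J⟩ hp
    rw [List.mem_toFinset] at hp
    have hperm := perm_of_mem_splits hp
    have hlen : (I ++ J).length = N := by simpa using hperm.length_eq
    have hnd : (I ++ J).Nodup := hperm.nodup_iff.2 (List.nodup_finRange N)
    have hinj : Function.Injective fun k : Fin N => (I ++ J)[(k : ℕ)]'(by omega) := by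
      intro a b hab
      exact Fin.ext ((hnd.getElem_inj_iff).1 hab)
    let σ : Equiv.Perm (Fin N) := Equiv.ofBijective _ (Finite.injective_iff_bijective.1 hinj)
    have hσ : ∀ (k : ℕ) (hk : k < N), σ ⟨k, hk⟩ = (I ++ J)[k]'(by omega) := fun k hk => rfl
    have hle : I.length ≤ N := by simp at hlen; omega
    have hIJ : I.Pairwise (· < ·) ∧ J.Pairwise (· < ·) := by
      have key : ∀ (L I J : List (Fin N)), L.Pairwise (· < ·) → (I, J) ∈ splits L →
          I.Sublist L ∧ J.Sublist L := by
        intro L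
        induction L with
        | nil => intro I J _ h; simp_all [splits]
        | cons x L ih =>
          intro I J hL h
          rw [List.pairwise_cons] at hL
          rcases mem_splits_cons.1 h with ⟨I', J', h', e⟩ | ⟨I', J', h', e⟩ <;> cases e
          · exact ⟨(ih _ _ hL.2 h').1.cons_cons x, (ih _ _ hL.2 h').2.cons x⟩
          · exact ⟨(ih _ _ hL.2 h').1.cons x, (ih _ _ hL.2 h').2.cons_cons x⟩
      have hs := List.pairwise_lt_finRange N
      exact ⟨hs.sublist (key _ _ _ hs hp).1, hs.sublist (key _ _ _ hs hp).2⟩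
    refine ⟨⟨⟨I.length, by omega⟩, σ⟩, ?_, ?_⟩
    · simp only [Finset.mem_sigma, Finset.mem_univ, Finset.mem_filter, true_and]
      intro a b hab hc
      rw [show a = ⟨a.1, a.2⟩ from rfl, show b = ⟨b.1, b.2⟩ from rfl, hσ, hσ]
      have hab' : a.1 < b.1 := hab
      rcases hc with hc | hc
      · rw [List.getElem_append_left (by omega), List.getElem_append_left (by omega)]
        exact List.pairwise_iff_getElem.1 hIJ.1 _ _ _ _ hab'
      · rw [List.getElem_append_right (by omega), List.getElem_append_right (by simpa using by omega)]
        exact List.pairwise_iff_getElem.1 hIJ.2 _ _ _ _ (by omega)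
    · simp only [Prod.mk.injEq]
      constructor
      · apply List.ext_getElem
        · simp
        · intro n h1 h2
          simp only [List.getElem_ofFn, hσ]
          rw [List.getElem_append_left]
      · apply List.ext_getElem
        · simp at hlen ⊢; omega
        · intro n h1 h2
          simp only [List.getElem_ofFn, hσ]
          rw [List.getElem_append_right (by omega)]
          simp
  · rintro ⟨i, σ⟩ _
    simp only [happ, koszulSign_eq_lsgn, List.map_ofFn, Function.comp_def]

end Koszul


/-! ### `L_∞`-algebras in terms of lists -/

section ListOperations

variable {K V : Type*} [Field K] [AddCommGroup V] [Module K V]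

/-- The homogeneous elements, together with their degrees. -/
abbrev Homog (𝒢 : ℤ → Submodule K V) := (d : ℤ) × 𝒢 d

/-- The entries of a list of homogeneous elements. -/
def vals {𝒢 : ℤ → Submodule K V} (xs : List (Homog 𝒢)) : List V := xs.map fun h => h.2.1

section

variable {𝒢 : ℤ → Submodule K V}

@[simp] theorem vals_nil : vals ([] : List (Homog 𝒢)) = [] := rfl

@[simp] theorem vals_cons (x : Homog 𝒢) (xs : List (Homog 𝒢)) :
    vals (x :: xs) = x.2.1 :: vals xs := rfl

@[simp] theorem vals_append (xs ys : List (Homog 𝒢)) : vals (xs ++ ys) = vals xs ++ vals ys := by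
  simp [vals]

@[simp] theorem vals_replicate (n : ℕ) (x : Homog 𝒢) :
    vals (List.replicate n x) = List.replicate n x.2.1 := by
  simp [vals]

@[simp] theorem length_vals (xs : List (Homog 𝒢)) : (vals xs).length = xs.length := by
  simp [vals]

end

/-- A family of operations as a function of a list of arguments. -/
def onList {V : Type*} (l : ∀ k : ℕ, (Fin k → V) → V) (xs : List V) : V := l xs.length xs.get

theorem onList_ofFn {V : Type*} (l : ∀ k : ℕ, (Fin k → V) → V) {k : ℕ} (x : Fin k → V) :
    onList l (List.ofFn x) = l k x := by
  -- The length of `List.ofFn x` equals `k` only propositionally, so the arity is generalized before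
  -- it is substituted.
  have key : ∀ (n : ℕ) (e : n = k) (y : Fin n → V), (∀ i : Fin n, y i = x (Fin.cast e i)) →
      l n y = l k x := by
    rintro n rfl y h
    congr 1
    funext i
    exact h i
  exact key _ (List.length_ofFn) _ fun i => by simp [Fin.cast]

/-- The axioms of a curved `L_∞`-algebra for operations that are given as a function of a list of
arguments. -/
structure ListLInf (𝒢 : ℤ → Submodule K V) (m : List V → V) : Prop where
  add : ∀ p x y q, m (p ++ (x + y) :: q) = m (p ++ x :: q) + m (p ++ y :: q)
  smul : ∀ p (c : K) x q, m (p ++ (c • x) :: q) = c • m (p ++ x :: q)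
  degree : ∀ xs : List (Homog 𝒢), m (vals xs) ∈ 𝒢 (dsum Sigma.fst xs + 1)
  symm : SwapSymm Sigma.fst fun xs : List (Homog 𝒢) => m (vals xs)
  jacobi : ∀ xs : List (Homog 𝒢), unsh Sigma.fst xs (fun I J => m (m (vals I) :: vals J)) = 0

theorem exists_multilinearMap_of_onList {l : ∀ k : ℕ, (Fin k → V) → V}
    (add : ∀ p x y q, onList l (p ++ (x + y) :: q) = onList l (p ++ x :: q) + onList l (p ++ y :: q))
    (smul : ∀ p (c : K) x q, onList l (p ++ (c • x) :: q) = c • onList l (p ++ x :: q)) (k : ℕ) :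
    ∃ M : MultilinearMap K (fun _ : Fin k => V) V, ∀ x, M x = l k x := by
  have key : ∀ (v : Fin k → V) (i : Fin k), ∃ p q : List V,
      ∀ z, l k (Function.update v i z) = onList l (p ++ z :: q) := by
    intro v i
    refine ⟨(List.ofFn v).take i, (List.ofFn v).drop (i + 1), fun z => ?_⟩
    rw [← onList_ofFn l]
    congr 1
    have : List.ofFn (Function.update v i z) = (List.ofFn v).set i z := by
      apply List.ext_getElem
      · simp
      · intro n h1 h2
        rw [List.getElem_set]
        simp only [List.getElem_ofFn]
        split_ifs with h
        · subst h; simp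
        · rw [Function.update_of_ne]
          intro e
          exact h (congrArg Fin.val e).symm
    rw [this, List.set_eq_take_append_cons_drop, if_pos (by simp)]
  refine ⟨MultilinearMap.mk' (fun x => l k x) ?_ ?_, fun x => rfl⟩
  · intro v i x y
    obtain ⟨p, q, h⟩ := key v i
    rw [h, h, h, add]
  · intro v i c x
    obtain ⟨p, q, h⟩ := key v i
    rw [h, h, smul]

/-- The bridge to the official definition: exchanges of neighbours generate all permutations
(`apply_ofFn_perm`), and the unshuffle sum is the shuffle sum (`sum_shuffles_eq_unsh`). -/
theorem ListLInf.isCurvedLInfinity {𝒢 : ℤ → Submodule K V} {l : ∀ k : ℕ, (Fin k → V) → V}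
    (h : ListLInf 𝒢 (onList l)) (hg : DirectSum.IsInternal 𝒢) : IsCurvedLInfinity 𝒢 l where
  graded := hg
  multilinear := exists_multilinearMap_of_onList h.add h.smul
  degree_one k d x hx := by
    have := h.degree (List.ofFn fun i => (⟨d i, x i, hx i⟩ : Homog 𝒢))
    rw [← onList_ofFn l]
    simpa [vals, dsum, List.map_ofFn, Function.comp_def, List.sum_ofFn] using this
  symmetric k d x hx σ := by
    have := apply_ofFn_perm d σ (fun L => onList l (L.map x)) (by
      intro p a b q
      have := h.symm (p.map fun i => ⟨d i, x i, hx i⟩) ⟨d a, x a, hx a⟩ ⟨d b, x b, hx b⟩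
        (q.map fun i => ⟨d i, x i, hx i⟩)
      simpa [vals, Function.comp_def] using this)
    rw [← List.ofFn_eq_map, onList_ofFn] at this
    rw [← this, ← onList_ofFn l, List.map_ofFn]
    rfl
  jacobi N d x hx := by
    rw [← h.jacobi (List.ofFn fun i => ⟨d i, x i, hx i⟩), ← sum_shuffles_eq_unsh]
    refine Finset.sum_congr rfl fun i _ => Finset.sum_congr rfl fun σ _ => ?_
    congr 1
    rw [jacobiTerm, ← onList_ofFn l, List.ofFn_cons, ← onList_ofFn l]
    simp [vals, List.map_ofFn, Function.comp_def]

/-! ### Consequences of multilinearity and of the symmetry of entries of degree `0` -/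

section Linear

variable {𝒢 : ℤ → Submodule K V} {m : List V → V} (h : ListLInf 𝒢 m)
include h

theorem ListLInf.zero (p q : List V) : m (p ++ 0 :: q) = 0 := by
  simpa using h.smul p 0 0 q

theorem ListLInf.sum {ι : Type*} (s : Finset ι) (p : List V) (c : ι → K) (z : ι → V)
    (q : List V) : m (p ++ (∑ i ∈ s, c i • z i) :: q) = ∑ i ∈ s, c i • m (p ++ z i :: q) := by
  classical
  induction s using Finset.induction_on with
  | empty => simpa using h.zero p q
  | insert a s ha ih => rw [Finset.sum_insert ha, h.add, h.smul, ih, Finset.sum_insert ha]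

theorem ListLInf.replicate_append {a : Homog 𝒢} (ha : a.1 = 0) (n : ℕ) (z : Homog 𝒢)
    (xs ys : List (Homog 𝒢)) :
    m (vals ys ++ (List.replicate n a.2.1 ++ z.2.1 :: vals xs)) =
      m (vals ys ++ z.2.1 :: (List.replicate n a.2.1 ++ vals xs)) := by
  have := h.symm.swap_sublist ys z (List.replicate n a) xs
  have e : dsum Sigma.fst (List.replicate n a) = 0 := by simp [dsum, ha]
  simp only [e, mul_zero, sg_zero, one_smul] at this
  simpa using this.symm

/-- Binomial formula: the first entry is expanded, and a resulting `b` is moved behind the copies of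
`a`, which costs no sign since `a` has degree `0`. The prefix `ys` is there to absorb the expanded
entry in the induction. -/
theorem ListLInf.add_replicate {a b : Homog 𝒢} (ha : a.1 = 0) (n : ℕ)
    (ys : List (Homog 𝒢)) :
    m (vals ys ++ List.replicate n (a.2.1 + b.2.1)) =
      ∑ p ∈ Finset.HasAntidiagonal.antidiagonal n, n.choose p.1 •
        m (vals ys ++ (List.replicate p.1 a.2.1 ++ List.replicate p.2 b.2.1)) := by
  induction n generalizing ys with
  | zero => simp
  | succ n ih =>
    rw [Finset.sum_antidiagonal_choose_succ_nsmul (fun i j =>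
      m (vals ys ++ (List.replicate i a.2.1 ++ List.replicate j b.2.1)))]
    have e1 := ih (ys ++ [a])
    have e2 := ih (ys ++ [b])
    simp only [vals_append, vals_cons, vals_nil, List.append_assoc, List.cons_append,
      List.nil_append] at e1 e2
    rw [List.replicate_succ, h.add, e1, e2, add_comm]
    congr 1
    · refine Finset.sum_congr rfl fun p _ => ?_
      have := h.replicate_append ha p.1 b (List.replicate p.2 b) ys
      rw [List.replicate_succ]
      simp only [vals_replicate] at this
      rw [this]
    · refine Finset.sum_congr rfl fun p hp => ?_
      have : n.choose p.1 = n.choose p.2 := by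
        rw [← Finset.HasAntidiagonal.mem_antidiagonal.1 hp, Nat.choose_symm_add]
      rw [this]
      rfl

end Linear

/-! ### Twisting -/

/-- The operations vanish on all sufficiently long lists of elements of a given finite set. -/
def EventuallyZero (m : List V → V) : Prop :=
  ∀ S : Set V, S.Finite → ∃ M : ℕ, ∀ xs : List V, (∀ x ∈ xs, x ∈ S) → M ≤ xs.length → m xs = 0

variable (K) in
/-- The twisted operations as a function of a list of arguments. -/
noncomputable def twistList (m : List V → V) (α : V) (xs : List V) : V :=
  ∑ᶠ n : ℕ, ((Nat.factorial n : K)⁻¹) • m (List.replicate n α ++ xs)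

theorem onList_append {V : Type*} (l : ∀ k : ℕ, (Fin k → V) → V) (α : V) (n k : ℕ) (x : Fin k → V) :
    l (n + k) (Fin.append (fun _ => α) x) = onList l (List.replicate n α ++ List.ofFn x) := by
  rw [← onList_ofFn l, List.ofFn_fin_append, List.ofFn_const]

theorem onList_twist (l : ∀ k : ℕ, (Fin k → V) → V) (α : V) :
    onList (twist K l α) = twistList K (onList l) α := by
  funext xs
  change twist K l α _ xs.get = _
  simp only [twist, twistList, onList_append l, List.ofFn_get]

theorem twistList_eq_sum {m : List V → V} {α : V} {xs : List V} {M : ℕ}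
    (h : ∀ n, M ≤ n → m (List.replicate n α ++ xs) = 0) :
    twistList K m α xs =
      ∑ n ∈ Finset.range M, ((Nat.factorial n : K)⁻¹) • m (List.replicate n α ++ xs) := by
  refine finsum_eq_sum_of_support_subset _ fun n hn => ?_
  by_contra hc
  simp only [Finset.coe_range, Set.mem_Iio, not_lt] at hc
  exact hn (by simp [h n hc])

theorem EventuallyZero.exists_bound {m : List V → V} (h : EventuallyZero m) (α : V)
    (xs : List V) : ∃ M, ∀ n, M ≤ n → m (List.replicate n α ++ xs) = 0 := by
  obtain ⟨M, hM⟩ := h (insert α {x | x ∈ xs}) ((List.finite_toSet xs).insert α)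
  refine ⟨M, fun n hn => hM _ ?_ (by simp; omega)⟩
  intro x hx
  rcases List.mem_append.1 hx with hx | hx
  · exact Or.inl (List.eq_of_mem_replicate hx)
  · exact Or.inr hx

theorem EventuallyZero.twistConverges {l : ∀ k : ℕ, (Fin k → V) → V}
    (h : EventuallyZero (onList l)) : TwistConverges l := by
  intro α k x
  obtain ⟨M, hM⟩ := h.exists_bound α (List.ofFn x)
  refine (Set.finite_Iio M).subset fun n hn => ?_
  by_contra hc
  simp only [Set.mem_Iio, not_lt] at hc
  exact hn (by rw [onList_append l, hM n hc])

/-- A Cauchy product of exponential series, by `(1/n!) * n.choose p = 1/(p! q!)` for `p + q = n`.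
All non-zero terms have `p, q < M`, so the antidiagonals below `2 * M` exhaust them. -/
theorem sum_box [CharZero K] (f : ℕ → ℕ → V) (M : ℕ) (h : ∀ p q, M ≤ p ∨ M ≤ q → f p q = 0) :
    ∑ n ∈ Finset.range (2 * M), ((Nat.factorial n : K)⁻¹) •
      ∑ p ∈ Finset.HasAntidiagonal.antidiagonal n, n.choose p.1 • f p.1 p.2 =
    ∑ q ∈ Finset.range M, ∑ p ∈ Finset.range M,
      ((Nat.factorial q : K)⁻¹) • ((Nat.factorial p : K)⁻¹) • f p q := by
  classical
  rw [Finset.sum_comm, ← Finset.sum_product'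
    (f := fun p q => ((Nat.factorial q : K)⁻¹) • ((Nat.factorial p : K)⁻¹) • f p q),
    ← Finset.sum_fiberwise_of_maps_to (s := Finset.range M ×ˢ Finset.range M)
    (t := Finset.range (2 * M)) (g := fun p => p.1 + p.2) (by
      intro p hp
      simp only [Finset.mem_product, Finset.mem_range] at hp ⊢
      omega)]
  refine Finset.sum_congr rfl fun n _ => ?_
  rw [Finset.smul_sum]
  symm
  have hsub : (Finset.range M ×ˢ Finset.range M).filter (fun p => p.1 + p.2 = n) ⊆
      Finset.HasAntidiagonal.antidiagonal n := by
    intro p hp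
    rw [Finset.mem_filter] at hp
    exact Finset.HasAntidiagonal.mem_antidiagonal.2 hp.2
  rw [Finset.sum_subset hsub]
  · refine Finset.sum_congr rfl fun p hp => ?_
    have hn := Finset.HasAntidiagonal.mem_antidiagonal.1 hp
    subst hn
    rw [← Nat.cast_smul_eq_nsmul K, smul_smul, smul_smul]
    congr 1
    rw [Nat.choose_symm_add, Nat.add_choose, Nat.cast_div (Nat.factorial_mul_factorial_dvd_factorial_add _ _)]
    · have h1 : ((p.1 + p.2).factorial : K) ≠ 0 := by
        exact_mod_cast Nat.factorial_ne_zero _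
      push_cast
      field_simp
    · push_cast
      exact mul_ne_zero (by exact_mod_cast Nat.factorial_ne_zero _)
        (by exact_mod_cast Nat.factorial_ne_zero _)
  · intro p hp hp'
    rw [h p.1 p.2, smul_zero, smul_zero]
    by_contra hc
    push Not at hc
    exact hp' (Finset.mem_filter.2 ⟨Finset.mem_product.2
      ⟨Finset.mem_range.2 hc.1, Finset.mem_range.2 hc.2⟩,
      Finset.HasAntidiagonal.mem_antidiagonal.1 hp⟩)

/-- The Jacobi identity of `m` on `n` copies of `α` followed by `xs` distributes the copies with
binomial coefficients. Dividing by `n!` and summing over `n` gives the product of the inner and the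
outer exponential series. Only truncations to common finite bounds have to be justified. -/
theorem ListLInf.twistList_jacobi [CharZero K] {𝒢 : ℤ → Submodule K V} {m : List V → V}
    (h : ListLInf 𝒢 m) (hz : EventuallyZero m) {α : V} (hα : α ∈ 𝒢 0) (xs : List (Homog 𝒢)) :
    unsh Sigma.fst xs
      (fun I J => twistList K m α (twistList K m α (vals I) :: vals J)) = 0 := by
  classical
  let a : Homog 𝒢 := ⟨0, α, hα⟩
  obtain ⟨M₁, hM₁⟩ := hz (insert α {x | x ∈ vals xs}) ((List.finite_toSet _).insert α)
  have inner : ∀ I : List (Homog 𝒢), I.Sublist xs → ∀ p, M₁ ≤ p →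
      m (List.replicate p α ++ vals I) = 0 := by
    intro I hI p hp
    refine hM₁ _ (fun x hx => ?_) (by simp; omega)
    rcases List.mem_append.1 hx with hx | hx
    · exact Or.inl (List.eq_of_mem_replicate hx)
    · exact Or.inr ((hI.map _).subset hx)
  -- The outer bound must be uniform in the inner value, so the finite set also contains all values
  -- of `m` on `p` copies of `α` and a sublist of `xs` with `p < M₁`; for `p ≥ M₁` the inner value
  -- is zero. This is why `EventuallyZero` quantifies over finite sets.
  obtain ⟨M₂, hM₂⟩ := hz (insert α {x | x ∈ vals xs} ∪
    ((Finset.range M₁ ×ˢ xs.sublists.toFinset).image fun s =>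
      m (List.replicate s.1 α ++ vals s.2) : Finset V))
    (((List.finite_toSet _).insert α).union (Finset.finite_toSet _))
  have outer : ∀ I J : List (Homog 𝒢), I.Sublist xs → J.Sublist xs → ∀ p q,
      M₁ ≤ p ∨ M₂ ≤ q →
      m (m (List.replicate p α ++ vals I) :: (List.replicate q α ++ vals J)) = 0 := by
    intro I J hI hJ p q hpq
    by_cases hp : M₁ ≤ p
    · rw [inner I hI p hp]
      exact h.zero [] _
    · refine hM₂ _ (fun x hx => ?_) (by simp; omega)
      rcases List.mem_cons.1 hx with rfl | hx
      · right
        rw [Finset.mem_coe, Finset.mem_image]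
        exact ⟨(p, I), by simpa using ⟨by omega, hI⟩, rfl⟩
      · left
        rcases List.mem_append.1 hx with hx | hx
        · exact Or.inl (List.eq_of_mem_replicate hx)
        · exact Or.inr ((hJ.map _).subset hx)
  set M := max M₁ M₂ with hM
  have expand : ∀ I J : List (Homog 𝒢), I.Sublist xs → J.Sublist xs →
      twistList K m α (twistList K m α (vals I) :: vals J) =
        ∑ q ∈ Finset.range M, ∑ p ∈ Finset.range M,
          ((Nat.factorial q : K)⁻¹) • ((Nat.factorial p : K)⁻¹) •
          m (m (List.replicate p α ++ vals I) :: (List.replicate q α ++ vals J)) := by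
    intro I J hI hJ
    rw [twistList_eq_sum (M := M) (xs := vals I) fun n hn => inner I hI n (by omega)]
    have e : ∀ q, m (List.replicate q α ++ (∑ p ∈ Finset.range M, ((Nat.factorial p : K)⁻¹) •
        m (List.replicate p α ++ vals I)) :: vals J) =
        ∑ p ∈ Finset.range M, ((Nat.factorial p : K)⁻¹) •
          m (m (List.replicate p α ++ vals I) :: (List.replicate q α ++ vals J)) := by
      intro q
      rw [h.sum]
      refine Finset.sum_congr rfl fun p _ => ?_
      have hd := h.degree (List.replicate p a ++ I)
      rw [vals_append, vals_replicate] at hd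
      rw [← List.nil_append (List.replicate q α ++ _), ← vals_nil (𝒢 := 𝒢),
        h.replicate_append (a := a) rfl q ⟨_, _, hd⟩ J []]
      rfl
    rw [twistList_eq_sum (M := M)]
    · refine Finset.sum_congr rfl fun q _ => ?_
      rw [e, Finset.smul_sum]
    · intro q hq
      rw [e]
      exact Finset.sum_eq_zero fun p _ => by
        rw [outer I J hI hJ p q (Or.inr (by omega)), smul_zero]
  rw [unsh_congr fun I J _ hI hJ => expand I J hI hJ]
  have jac : ∀ n, ∑ p ∈ Finset.HasAntidiagonal.antidiagonal n, n.choose p.1 •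
      unsh Sigma.fst xs (fun I J =>
        m (m (List.replicate p.1 α ++ vals I) :: (List.replicate p.2 α ++ vals J))) = 0 := by
    intro n
    have := h.jacobi (List.replicate n a ++ xs)
    rw [unsh_replicate (show a.1 = 0 from rfl)] at this
    simpa only [vals_append, vals_replicate] using this
  have box := sum_box (K := K) (fun p q => unsh Sigma.fst xs (fun I J =>
        m (m (List.replicate p α ++ vals I) :: (List.replicate q α ++ vals J)))) M (by
    intro p q hpq
    rw [← unsh_zero (deg := Sigma.fst) xs]
    exact unsh_congr fun I J _ hI hJ => outer I J hI hJ p q (by omega))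
  simp only [jac, smul_zero, Finset.sum_const_zero] at box
  rw [unsh_sum, box]
  refine Finset.sum_congr rfl fun q _ => ?_
  rw [unsh_sum]
  refine Finset.sum_congr rfl fun p _ => ?_
  simp only [smul_smul]
  exact unsh_map (DistribSMul.toAddMonoidHom V _) xs _

theorem ListLInf.twistList [CharZero K] {𝒢 : ℤ → Submodule K V} {m : List V → V}
    (h : ListLInf 𝒢 m) (hz : EventuallyZero m) {α : V} (hα : α ∈ 𝒢 0) :
    ListLInf 𝒢 (twistList K m α) where
  add p x y q := by
    obtain ⟨M₁, h₁⟩ := hz.exists_bound α (p ++ x :: q)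
    obtain ⟨M₂, h₂⟩ := hz.exists_bound α (p ++ y :: q)
    rw [twistList_eq_sum (M := max M₁ M₂) fun n hn => h₁ n (by omega),
      twistList_eq_sum (M := max M₁ M₂) fun n hn => h₂ n (by omega), ← Finset.sum_add_distrib,
      twistList_eq_sum (M := max M₁ M₂) fun n hn => by
        rw [← List.append_assoc, h.add, List.append_assoc, List.append_assoc, h₁ n (by omega),
          h₂ n (by omega), add_zero]]
    refine Finset.sum_congr rfl fun n _ => ?_
    rw [← List.append_assoc, h.add, List.append_assoc, List.append_assoc, smul_add]
  smul p c x q := by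
    obtain ⟨M, hM⟩ := hz.exists_bound α (p ++ x :: q)
    rw [twistList_eq_sum (M := M) hM, Finset.smul_sum, twistList_eq_sum (M := M) fun n hn => by
      rw [← List.append_assoc, h.smul, List.append_assoc, hM n hn, smul_zero]]
    refine Finset.sum_congr rfl fun n _ => ?_
    rw [← List.append_assoc, h.smul, List.append_assoc, smul_comm]
  degree xs := by
    obtain ⟨M, hM⟩ := hz.exists_bound α (vals xs)
    rw [twistList_eq_sum (M := M) hM]
    refine Submodule.sum_mem _ fun n _ => Submodule.smul_mem _ _ ?_
    have := h.degree (List.replicate n (⟨0, α, hα⟩ : Homog 𝒢) ++ xs)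
    simpa [dsum] using this
  symm p a b q := by
    simp only [QTwilled.twistList]
    obtain ⟨M, hM⟩ := hz.exists_bound α (vals (p ++ b :: a :: q))
    have e : ∀ n, m (List.replicate n α ++ vals (p ++ a :: b :: q)) =
        sg (a.1 * b.1) • m (List.replicate n α ++ vals (p ++ b :: a :: q)) := by
      intro n
      have := h.symm (List.replicate n (⟨0, α, hα⟩ : Homog 𝒢) ++ p) a b q
      simpa [List.append_assoc] using this
    change QTwilled.twistList K m α _ = _ • QTwilled.twistList K m α _
    rw [twistList_eq_sum (M := M) hM, Finset.smul_sum, twistList_eq_sum (M := M) fun n hn => by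
      rw [e, hM n hn, smul_zero]]
    refine Finset.sum_congr rfl fun n _ => ?_
    rw [e, smul_comm]
  jacobi := h.twistList_jacobi hz hα

/-- The same filtration and index work: `l_{n+k}` has values in `Fil (n + k) ⊆ Fil k`, and copies of
`α` do not change the degree. -/
theorem isWeaklyFiltered_twist {𝒢 : ℤ → Submodule K V} {l : ∀ k : ℕ, (Fin k → V) → V}
    (h : IsWeaklyFiltered 𝒢 l) {α : V} (hα : α ∈ 𝒢 0) : IsWeaklyFiltered 𝒢 (twist K l α) := by
  obtain ⟨Fil, N, hN, h1, h2, h3, h4, h5⟩ := h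
  refine ⟨Fil, N, hN, h1, h2, h3, h4, fun k hk d x hx => ?_⟩
  refine finsum_induction (p := fun z => z ∈ Fil k ((∑ i, d i) + 1)) (Submodule.zero_mem _)
    (fun _ _ => Submodule.add_mem _) fun n => Submodule.smul_mem _ _ ?_
  have mono : ∀ n, Fil (n + k) ((∑ i, d i) + 1) ≤ Fil k ((∑ i, d i) + 1) := by
    intro n
    induction n with
    | zero => simp
    | succ n ih =>
      rw [Nat.add_right_comm]
      exact (h2 _ (by omega) _).trans ih
  refine mono n ?_
  have := h5 (n + k) (by omega) (Fin.append (fun _ => 0) d) (Fin.append (fun _ => α) x) (by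
    intro i
    refine Fin.addCases (fun j => ?_) (fun j => ?_) i
    · simpa using hα
    · simpa using hx j)
  simpa [Fin.sum_univ_add] using this

theorem isMaurerCartan_iff {𝒢 : ℤ → Submodule K V} {l : ∀ k : ℕ, (Fin k → V) → V}
    (hz : EventuallyZero (onList l)) {α : V} (hα : α ∈ 𝒢 0) :
    IsMaurerCartan 𝒢 l α ↔ twistList K (onList l) α [] = 0 := by
  have e : ∀ k, l k (fun _ => α) = onList l (List.replicate k α ++ []) := fun k => by
    rw [← onList_ofFn l, List.ofFn_const, List.append_nil]
  obtain ⟨M, hM⟩ := hz.exists_bound α []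
  simp only [IsMaurerCartan, hα, true_and, e, twistList, and_iff_right_iff_imp]
  refine fun _ => (Set.finite_Iio M).subset fun n hn => ?_
  by_contra hc
  simp only [Set.mem_Iio, not_lt] at hc
  exact hn (hM n hc)

/-- The Maurer–Cartan elements of a twisted `L_∞`-algebra. -/
theorem isMaurerCartan_twist_iff [CharZero K] {𝒢 : ℤ → Submodule K V}
    {l : ∀ k : ℕ, (Fin k → V) → V} (h : ListLInf 𝒢 (onList l)) (hz : EventuallyZero (onList l))
    {α β : V} (hα : α ∈ 𝒢 0) (hβ : β ∈ 𝒢 0) :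
    IsMaurerCartan 𝒢 (twist K l α) β ↔ IsMaurerCartan 𝒢 l (α + β) := by
  rw [isMaurerCartan_iff hz (Submodule.add_mem _ hα hβ)]
  set m := onList l
  obtain ⟨M, hM⟩ := hz {α, β, α + β} (by simp)
  have hab : ∀ p q, M ≤ p ∨ M ≤ q → m (List.replicate p α ++ List.replicate q β) = 0 := by
    intro p q hpq
    refine hM _ (fun x hx => ?_) (by simp; omega)
    rcases List.mem_append.1 hx with hx | hx <;> simp [List.eq_of_mem_replicate hx]
  have e : ∀ k, twist K l α k (fun _ => β) = ∑ p ∈ Finset.range M,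
      ((Nat.factorial p : K)⁻¹) • m (List.replicate p α ++ List.replicate k β) := fun k => by
    rw [← onList_ofFn (twist K l α), onList_twist, List.ofFn_const,
      twistList_eq_sum (M := M) fun n hn => hab _ _ (Or.inl hn)]
  have ez : ∀ k, M ≤ k → twist K l α k (fun _ => β) = 0 := fun k hk => by
    rw [e]
    exact Finset.sum_eq_zero fun p _ => by rw [hab _ _ (Or.inr hk), smul_zero]
  have fin : {k : ℕ | twist K l α k (fun _ => β) ≠ 0}.Finite := by
    refine (Set.finite_Iio M).subset fun n hn => ?_
    by_contra hc
    simp only [Set.mem_Iio, not_lt] at hc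
    exact hn (ez n hc)
  simp only [IsMaurerCartan, hβ, fin, true_and]
  rw [finsum_eq_sum_of_support_subset (s := Finset.range M)]
  · simp only [e, Finset.smul_sum]
    -- The series of `β` under the twisted operations is a double exponential series in `p` copies
    -- of `α` and `q` copies of `β`. Regrouped by `p + q = n`, it is the binomial expansion of the
    -- series of `α + β`.
    rw [← sum_box (K := K) (fun p q => m (List.replicate p α ++ List.replicate q β)) M hab,
      twistList_eq_sum (M := 2 * M)]
    · refine Eq.congr_left (Finset.sum_congr rfl fun n _ => ?_)
      have := h.add_replicate (a := ⟨0, α, hα⟩) (b := ⟨0, β, hβ⟩) rfl n []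
      simp only [vals_nil, List.nil_append] at this
      rw [List.append_nil, this]
    · intro n hn
      refine hM _ (fun x hx => ?_) (by simp; omega)
      rw [List.append_nil] at hx
      simp [List.eq_of_mem_replicate hx]
  · intro n hn
    by_contra hc
    simp only [Finset.coe_range, Set.mem_Iio, not_lt] at hc
    exact hn (by simp [ez n hc])

end ListOperations


/-! ### The graded Lie algebra structure -/

section GradedLie

variable {K E F : Type*} [Field K] [AddCommGroup E] [Module K E] [AddCommGroup F] [Module K F]

theorem neg_one_pow_smul_hmSum (n : ℕ) (x : HmSum K E F) : ((-1 : K) ^ n) • x = sg n • x :=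
  neg_one_pow_smul_eq_sg n x

/-- The value on the first `n + 1` entries of a sequence. -/
def onSeq {n : ℕ} (f : Hm K E F n) (v : ℕ → E) : F := f fun i => v i

/-- Degrees such as `m + n + p` and `m + (n + p)` are equal only propositionally. Evaluating on
infinite sequences compares maps of such degrees without casts. -/
theorem lof_eq_of_onSeq {m n : ℕ} (e : m = n) {f : Hm K E F m} {g : Hm K E F n}
    (h : ∀ v, onSeq f v = onSeq g v) :
    DirectSum.lof K ℕ (Hm K E F) m f = DirectSum.lof K ℕ (Hm K E F) n g := by
  subst e
  congr 1
  ext v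
  have := h fun i => if hi : i < m + 1 then v ⟨i, hi⟩ else 0
  simpa only [onSeq, Fin.is_lt, dif_pos, Fin.eta] using this

/-- The insertion in position `i`, as a bilinear map; it is `0` if there is no such position. -/
def insN (i : ℕ) {m n : ℕ} : Hm K E E m →ₗ[K] Hm K E E n →ₗ[K] Hm K E E (m + n) :=
  if h : i < m + 1 then insL ⟨i, h⟩ else 0

theorem diamond_eq_sum {m n : ℕ} (f : Hm K E E m) (g : Hm K E E n) :
    diamond m n f g = ∑ i ∈ Finset.range (m + 1), ((-1 : K) ^ (i * n)) • insN i f g := by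
  rw [Finset.sum_range]
  simp only [diamond, LinearMap.sum_apply, LinearMap.smul_apply]
  refine Finset.sum_congr rfl fun i _ => ?_
  rw [insN, dif_pos i.2]

theorem onSeq_insN {i m n : ℕ} (h : i < m + 1) (f : Hm K E E m) (g : Hm K E E n) (v : ℕ → E) :
    onSeq (insN i f g) v = onSeq f fun j =>
      if j < i then v j else if j = i then onSeq g (fun t => v (i + t)) else v (j + n) := by
  simp only [insN, h, dif_pos, onSeq, insL, LinearMap.mk₂_apply, ins_apply]
  congr 1
  funext j
  simp only [insArgs, Fin.lt_def, Fin.ext_iff]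

theorem insN_insN_nested {i t m n p : ℕ} (hi : i < m + 1) (ht : t < n + 1) (f : Hm K E E m)
    (g : Hm K E E n) (h : Hm K E E p) :
    DirectSum.lof K ℕ (Hm K E E) (m + n + p) (insN (i + t) (insN i f g) h) =
      DirectSum.lof K ℕ (Hm K E E) (m + (n + p)) (insN i f (insN t g h)) := by
  refine lof_eq_of_onSeq (add_assoc _ _ _) fun v => ?_
  rw [onSeq_insN (by omega), onSeq_insN hi, onSeq_insN hi, onSeq_insN ht]
  congr 1
  funext j
  split_ifs with h1 h2 h3 h4 h5
  · rfl
  · omega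
  · omega
  · congr 1
    funext s
    split_ifs <;> first | omega | rfl | (congr 1; first | omega | (funext; congr 1; omega))
  · omega
  · omega
  · congr 1; omega

/-- Insertions in different arguments of `f` commute. Inserting `g` to the left of position `j`
first shifts that position by `n`. -/
theorem insN_insN_disjoint {i j m n p : ℕ} (hij : i < j) (hj : j < m + 1) (f : Hm K E E m)
    (g : Hm K E E n) (h : Hm K E E p) :
    DirectSum.lof K ℕ (Hm K E E) (m + n + p) (insN (j + n) (insN i f g) h) =
      DirectSum.lof K ℕ (Hm K E E) (m + p + n) (insN i (insN j f h) g) := by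
  refine lof_eq_of_onSeq (by omega) fun v => ?_
  rw [onSeq_insN (by omega), onSeq_insN (by omega), onSeq_insN (by omega), onSeq_insN hj]
  congr 1
  funext s
  rcases lt_trichotomy s i with h1 | h1 | h1
  · simp [h1, h1.trans hij, show s < j + n by omega]
  · subst h1
    simp only [lt_irrefl, if_false, if_true, hij]
    refine congrArg g (funext fun t => if_pos (by omega))
  · simp only [h1.not_gt, h1.ne', if_false]
    rcases lt_trichotomy s j with h2 | h2 | h2
    · rw [if_pos (by omega), if_pos h2]
    · subst h2
      simp only [lt_irrefl, if_false, if_true]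
      congr 1
      funext t
      rw [if_neg (by omega), if_neg (by omega)]
      congr 1; omega
    · rw [if_neg (by omega), if_neg (by omega), if_neg (by omega), if_neg (by omega),
        if_neg (by omega), if_neg (by omega)]
      congr 1; omega

variable (K E) in
/-- The operation `⋄` on `⨁_n Hom(E^{⊗ n+1}, E)`. -/
def dia : HmSum K E E →ₗ[K] HmSum K E E →ₗ[K] HmSum K E E :=
  DirectSum.toModule K ℕ _ fun m => (DirectSum.toModule K ℕ _ fun n =>
    ((diamond m n).compr₂ (DirectSum.lof K ℕ (Hm K E E) (m + n))).flip).flip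

theorem dia_lof {m n : ℕ} (f : Hm K E E m) (g : Hm K E E n) :
    dia K E (DirectSum.lof K ℕ _ m f) (DirectSum.lof K ℕ _ n g) =
      DirectSum.lof K ℕ (Hm K E E) (m + n) (diamond m n f g) := by
  simp [dia, DirectSum.toModule_lof]

theorem bracket_lof {m n : ℕ} (f : Hm K E E m) (g : Hm K E E n) :
    bracket K E (DirectSum.lof K ℕ _ m f) (DirectSum.lof K ℕ _ n g) =
      DirectSum.lof K ℕ (Hm K E E) (m + n) (diamond m n f g) -
        ((-1 : K) ^ (m * n)) • DirectSum.lof K ℕ (Hm K E E) (n + m) (diamond n m g f) := by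
  simp [bracket, DirectSum.toModule_lof, bracketHom]

/-- The sum of the insertions of `g` and `h` in different arguments of `f`, with `h` on the left of
`g`. -/
def disjointSum {m n p : ℕ} (f : Hm K E E m) (g : Hm K E E n) (h : Hm K E E p) :
    HmSum K E E :=
  ∑ i ∈ Finset.range (m + 1), ∑ j ∈ Finset.range i, ((-1 : K) ^ (j * p) * (-1 : K) ^ (i * n)) •
    DirectSum.lof K ℕ (Hm K E E) (m + n + p) (insN j (insN i f g) h)

/-- In `(f ⋄ g) ⋄ h` the map `h` is inserted into an argument of `g`, which gives `f ⋄ (g ⋄ h)`, or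
into an argument of `f` to the left or to the right of `g`. By commutation of disjoint insertions,
the terms on the right are those on the left with `g` and `h` exchanged. -/
theorem diamond_assoc {m n p : ℕ} (f : Hm K E E m) (g : Hm K E E n) (h : Hm K E E p) :
    DirectSum.lof K ℕ (Hm K E E) (m + n + p) (diamond (m + n) p (diamond m n f g) h) =
      DirectSum.lof K ℕ (Hm K E E) (m + (n + p)) (diamond m (n + p) f (diamond n p g h)) +
        (disjointSum f g h + ((-1 : K) ^ (n * p)) • disjointSum f h g) := by
  have hL : DirectSum.lof K ℕ (Hm K E E) (m + n + p) (diamond (m + n) p (diamond m n f g) h) =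
      ∑ i ∈ Finset.range (m + 1), ∑ j ∈ Finset.range (m + n + 1),
        ((-1 : K) ^ (j * p) * (-1 : K) ^ (i * n)) •
          DirectSum.lof K ℕ (Hm K E E) (m + n + p) (insN j (insN i f g) h) := by
    rw [Finset.sum_comm, diamond_eq_sum, map_sum]
    refine Finset.sum_congr rfl fun j _ => ?_
    rw [diamond_eq_sum, map_sum, LinearMap.sum_apply, map_smul, map_sum, Finset.smul_sum]
    refine Finset.sum_congr rfl fun i _ => ?_
    rw [map_smul, LinearMap.smul_apply, map_smul, smul_smul]
  have hR : DirectSum.lof K ℕ (Hm K E E) (m + (n + p)) (diamond m (n + p) f (diamond n p g h)) =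
      ∑ i ∈ Finset.range (m + 1), ∑ t ∈ Finset.range (n + 1),
        ((-1 : K) ^ (i * (n + p)) * (-1 : K) ^ (t * p)) •
          DirectSum.lof K ℕ (Hm K E E) (m + (n + p)) (insN i f (insN t g h)) := by
    rw [diamond_eq_sum, map_sum]
    refine Finset.sum_congr rfl fun i _ => ?_
    rw [diamond_eq_sum, map_sum, map_smul, map_sum, Finset.smul_sum]
    refine Finset.sum_congr rfl fun t _ => ?_
    rw [map_smul, map_smul, smul_smul]
  have hS : ((-1 : K) ^ (n * p)) • disjointSum f h g =
      ∑ i ∈ Finset.range (m + 1), ∑ j ∈ Finset.Ico (i + 1) (m + 1),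
        ((-1 : K) ^ ((j + n) * p) * (-1 : K) ^ (i * n)) •
          DirectSum.lof K ℕ (Hm K E E) (m + n + p) (insN (j + n) (insN i f g) h) := by
    rw [disjointSum, Finset.smul_sum, Finset.sum_comm' (s := Finset.range (m + 1))
      (t := fun i => Finset.Ico (i + 1) (m + 1)) (t' := Finset.range (m + 1))
      (s' := fun j => Finset.range j) (by
        intro x y; simp only [Finset.mem_range, Finset.mem_Ico]; omega)]
    refine Finset.sum_congr rfl fun j hj => ?_
    rw [Finset.smul_sum]
    refine Finset.sum_congr rfl fun i hi => ?_
    rw [insN_insN_disjoint (Finset.mem_range.1 hi) (Finset.mem_range.1 hj), smul_smul]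
    congr 1
    ring
  rw [hL, hR, hS, disjointSum, ← Finset.sum_add_distrib, ← Finset.sum_add_distrib]
  refine Finset.sum_congr rfl fun i hi => ?_
  have hi := Finset.mem_range.1 hi
  -- With `g` in position `i`, its arguments occupy the positions `i, …, i + n`, so the range of `j`
  -- is cut at `i` and at `i + (n + 1)`.
  rw [Finset.range_eq_Ico, ← Finset.sum_Ico_consecutive _ (Nat.zero_le i) (by omega),
    ← Finset.sum_Ico_consecutive _ (show i ≤ i + (n + 1) by omega) (by omega),
    Finset.sum_Ico_eq_sum_range _ i, Nat.add_sub_cancel_left, ← Finset.range_eq_Ico,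
    add_left_comm]
  congr 1
  · refine Finset.sum_congr rfl fun t ht => ?_
    rw [insN_insN_nested hi (Finset.mem_range.1 ht)]
    congr 1
    ring
  · congr 1
    refine Eq.trans ?_ (Finset.sum_Ico_add' (fun j => ((-1 : K) ^ (j * p) * (-1 : K) ^ (i * n)) •
        DirectSum.lof K ℕ (Hm K E E) (m + n + p) (insN j (insN i f g) h)) _ _ n).symm
    exact Finset.sum_congr (by congr 1 <;> omega) fun _ _ => rfl

/-- Degrees are integers but summands are indexed by naturals; negative degrees contribute only `0`.
This reduces homogeneous statements to single multilinear maps. -/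
theorem degPart_cases {d : ℤ} {x : HmSum K E F} (hx : x ∈ degPart K E F d) :
    x = 0 ∨ ∃ (n : ℕ) (f : Hm K E F n), (n : ℤ) = d ∧ x = DirectSum.lof K ℕ (Hm K E F) n f := by
  by_cases h : ∃ n : ℕ, (n : ℤ) = d
  · obtain ⟨n, rfl⟩ := h
    refine Or.inr ⟨n, x n, rfl, ?_⟩
    refine DFinsupp.ext fun k => ?_
    by_cases hk : k = n
    · subst hk
      rw [DirectSum.lof_apply]
    · rw [DirectSum.lof_eq_of, DirectSum.of_eq_of_ne _ _ _ hk]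
      exact hx k (by exact_mod_cast hk)
  · refine Or.inl (DFinsupp.ext fun k => ?_)
    exact hx k fun hk => h ⟨k, hk⟩

theorem lof_mem_degPart {n : ℕ} {d : ℤ} (h : (n : ℤ) = d) (f : Hm K E F n) :
    DirectSum.lof K ℕ (Hm K E F) n f ∈ degPart K E F d := by
  intro k hk
  have : k ≠ n := fun e => hk (by rw [e, h])
  rw [DirectSum.lof_eq_of, DirectSum.of_eq_of_ne _ _ _ this]

theorem dia_mem {m n : ℤ} {x y : HmSum K E E} (hx : x ∈ degPart K E E m)
    (hy : y ∈ degPart K E E n) : dia K E x y ∈ degPart K E E (m + n) := by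
  rcases degPart_cases hx with rfl | ⟨m, f, rfl, rfl⟩
  · simp
  rcases degPart_cases hy with rfl | ⟨n, g, rfl, rfl⟩
  · simp
  rw [dia_lof]
  exact lof_mem_degPart (by push_cast; rfl) _

theorem bracket_eq {m n : ℤ} {x y : HmSum K E E} (hx : x ∈ degPart K E E m)
    (hy : y ∈ degPart K E E n) :
    bracket K E x y = dia K E x y - sg (m * n) • dia K E y x := by
  rcases degPart_cases hx with rfl | ⟨m, f, rfl, rfl⟩
  · simp
  rcases degPart_cases hy with rfl | ⟨n, g, rfl, rfl⟩
  · simp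
  rw [bracket_lof, dia_lof, dia_lof, neg_one_pow_smul_hmSum, Nat.cast_mul]

theorem bracket_mem {m n : ℤ} {x y : HmSum K E E} (hx : x ∈ degPart K E E m)
    (hy : y ∈ degPart K E E n) : bracket K E x y ∈ degPart K E E (m + n) := by
  rw [bracket_eq hx hy]
  refine Submodule.sub_mem _ (dia_mem hx hy) (zsmul_mem ?_ _)
  rw [add_comm]
  exact dia_mem hy hx

theorem bracket_antisymm {m n : ℤ} {x y : HmSum K E E} (hx : x ∈ degPart K E E m)
    (hy : y ∈ degPart K E E n) :
    bracket K E x y = -(sg (m * n) • bracket K E y x) := by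
  rw [bracket_eq hx hy, bracket_eq hy hx, mul_comm n m]
  rcases sg_eq_or (m * n) with h | h <;> rw [h] <;> simp

/-- The graded right pre-Lie identity: by `diamond_assoc` the associator is a sum over disjoint
insertions, graded symmetric in the last two entries. -/
theorem dia_assoc {m n p : ℤ} {x y z : HmSum K E E} (hx : x ∈ degPart K E E m)
    (hy : y ∈ degPart K E E n) (hz : z ∈ degPart K E E p) :
    dia K E (dia K E x y) z - dia K E x (dia K E y z) =
      sg (n * p) • (dia K E (dia K E x z) y - dia K E x (dia K E z y)) := by
  rcases degPart_cases hx with rfl | ⟨m, f, rfl, rfl⟩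
  · simp
  rcases degPart_cases hy with rfl | ⟨n, g, rfl, rfl⟩
  · simp
  rcases degPart_cases hz with rfl | ⟨p, h, rfl, rfl⟩
  · simp
  simp only [dia_lof, diamond_assoc, add_sub_cancel_left, neg_one_pow_smul_hmSum, Nat.cast_mul,
    mul_comm (p : ℤ)]
  rw [smul_add, smul_smul, sg_mul_self, one_smul, add_comm]

theorem bracket_jacobi {m n p : ℤ} {x y z : HmSum K E E} (hx : x ∈ degPart K E E m)
    (hy : y ∈ degPart K E E n) (hz : z ∈ degPart K E E p) :
    bracket K E (bracket K E x y) z =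
      bracket K E x (bracket K E y z) + sg (n * p) • bracket K E (bracket K E x z) y := by
  rw [bracket_eq (bracket_mem hx hy) hz, bracket_eq hx (bracket_mem hy hz),
    bracket_eq (bracket_mem hx hz) hy, bracket_eq hx hy, bracket_eq hy hz, bracket_eq hx hz]
  -- One pre-Lie identity for each choice of the outermost map. After eliminating the three
  -- associators, only the signs of the pairwise products of degrees are left to check.
  have h1 := dia_assoc hx hy hz
  have h2 := dia_assoc hy hx hz
  have h3 := dia_assoc hz hx hy
  simp only [map_sub, map_zsmul, LinearMap.sub_apply, LinearMap.smul_apply, add_mul, mul_add,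
    sg_add, mul_comm p]
  rw [sub_eq_iff_eq_add] at h1 h2 h3
  simp only [h1, h2, h3]
  rcases sg_eq_or (m * n) with a | a <;> rcases sg_eq_or (n * p) with b | b <;>
    rcases sg_eq_or (m * p) with c | c <;> simp only [a, b, c] <;> module

end GradedLie


/-! ### Iterated brackets with commuting elements -/

section IterBracket

variable {K E : Type*} [Field K] [AddCommGroup E] [Module K E]

theorem iterBracket_append (p q : List (HmSum K E E)) (x : HmSum K E E) :
    iterBracket (p ++ q) x = iterBracket q (iterBracket p x) := by
  induction p generalizing x with
  | nil => rfl
  | cons f p ih => exact ih _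

theorem iterBracket_cons (f : HmSum K E E) (p : List (HmSum K E E)) (x : HmSum K E E) :
    iterBracket (f :: p) x = iterBracket p (bracket K E x f) := rfl

theorem iterBracket_zero_mem {p : List (HmSum K E E)} (h : 0 ∈ p) (x : HmSum K E E) :
    iterBracket p x = 0 := by
  obtain ⟨q, r, rfl⟩ := List.append_of_mem h
  simp [iterBracket_append, iterBracket_cons]

variable {H : Type*} {deg : H → ℤ} {e : H → HmSum K E E}

theorem iterBracket_mem (he : ∀ h, e h ∈ degPart K E E (deg h)) {n : ℤ} {x : HmSum K E E}
    (hx : x ∈ degPart K E E n) (fs : List H) :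
    iterBracket (fs.map e) x ∈ degPart K E E (n + dsum deg fs) := by
  induction fs generalizing n x with
  | nil => simpa [iterBracket] using hx
  | cons f fs ih =>
    have := ih (bracket_mem hx (he f))
    rwa [add_assoc] at this

theorem bracket_bracket_comm (he : ∀ h, e h ∈ degPart K E E (deg h))
    (hab : ∀ f g, bracket K E (e f) (e g) = 0) {n : ℤ} {x : HmSum K E E}
    (hx : x ∈ degPart K E E n) (f g : H) :
    bracket K E (bracket K E x (e f)) (e g) =
      sg (deg f * deg g) • bracket K E (bracket K E x (e g)) (e f) := by
  rw [bracket_jacobi hx (he f) (he g), hab, map_zero, zero_add]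

theorem iterBracket_swapSymm (he : ∀ h, e h ∈ degPart K E E (deg h))
    (hab : ∀ f g, bracket K E (e f) (e g) = 0) {n : ℤ} {x : HmSum K E E}
    (hx : x ∈ degPart K E E n) : SwapSymm deg fun fs => iterBracket (fs.map e) x := by
  intro p a b q
  simp only [List.map_append, List.map_cons, iterBracket_append, iterBracket_cons]
  rw [bracket_bracket_comm he hab (iterBracket_mem he hx p), map_zsmul]

theorem bracket_iterBracket_comm (he : ∀ h, e h ∈ degPart K E E (deg h))
    (hab : ∀ f g, bracket K E (e f) (e g) = 0) {n d : ℤ} {x y : HmSum K E E}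
    (hx : x ∈ degPart K E E n) (hy : y ∈ degPart K E E d) (hy0 : bracket K E y y = 0)
    (hya : ∀ f, bracket K E (e f) y = 0) (fs : List H) :
    bracket K E (iterBracket (fs.map e) x) y =
      sg (d * dsum deg fs) • iterBracket (fs.map e) (bracket K E x y) := by
  have hay : ∀ f, bracket K E y (e f) = 0 := fun f => by
    rw [bracket_antisymm hy (he f), hya, smul_zero, neg_zero]
  -- Since `y` commutes with itself and with all `e f`, it can be adjoined to the commuting family
  -- as `none`. Moving it past the whole list is then `SwapSymm.swap_sublist`.
  let e' : Option H → HmSum K E E := fun o => o.elim y e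
  have h1 : ∀ h, e' h ∈ degPart K E E (Option.elim h d deg) := by
    rintro (_ | h)
    · exact hy
    · exact he h
  have h2 : ∀ f g, bracket K E (e' f) (e' g) = 0 := by
    rintro (_ | f) (_ | g)
    · exact hy0
    · exact hay g
    · exact hya f
    · exact hab f g
  have := (iterBracket_swapSymm h1 h2 hx).swap_sublist [] none (fs.map some) []
  simp only [List.nil_append, List.append_nil, List.map_cons, List.map_map, List.map_append,
    List.map_nil, iterBracket_append, iterBracket_cons] at this
  change iterBracket (fs.map e) (bracket K E x y) = sg (d * dsum _ (fs.map some)) •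
    bracket K E (iterBracket (fs.map e) x) y at this
  have hd : dsum (fun h => Option.elim h d deg) (fs.map some) = dsum deg fs := by
    simp [dsum, Function.comp_def]
  rw [this, hd, smul_smul, sg_mul_self, one_smul]

/-- Each bracketing with an element on the right is a graded derivation, so an iterated bracket
obeys the Leibniz rule, distributing the list over `x` and `y`. The extra sign moves the list that
goes to `x` past `y`. -/
theorem iterBracket_bracket (he : ∀ h, e h ∈ degPart K E E (deg h)) {m n : ℤ}
    {x y : HmSum K E E} (hx : x ∈ degPart K E E m) (hy : y ∈ degPart K E E n) (fs : List H) :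
    iterBracket (fs.map e) (bracket K E x y) = unsh deg fs fun J I =>
      sg (n * dsum deg J) •
        bracket K E (iterBracket (J.map e) x) (iterBracket (I.map e) y) := by
  induction fs generalizing m n x y with
  | nil => simp [unsh, iterBracket]
  | cons f fs ih =>
    rw [List.map_cons, iterBracket_cons, bracket_jacobi hx hy (he f), map_add, map_zsmul,
      ih hx (bracket_mem hy (he f)), ih (bracket_mem hx (he f)) hy, unsh, add_comm, ← unsh_zsmul]
    congr 1
    · refine unsh_congr fun I J _ _ _ => ?_
      rw [smul_smul, ← sg_add, dsum_cons, ← mul_add]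
      rfl
    · refine unsh_congr fun I J _ _ _ => ?_
      rw [smul_smul, ← sg_add, ← add_mul, add_comm n]
      rfl

end IterBracket

/-! ### The projection and the inclusion -/

section Projection

variable {K A B : Type*} [Field K] [AddCommGroup A] [Module K A] [AddCommGroup B] [Module K B]

theorem incl_lof {n : ℕ} (f : Hm K A B n) : incl K A B (DirectSum.lof K ℕ _ n f) =
    DirectSum.lof K ℕ (Hm K (A × B) (A × B)) n
      ((LinearMap.inr K A B).compMultilinearMap (f.compLinearMap fun _ => LinearMap.fst K A B)) := by
  simp [incl, DirectSum.toModule_lof]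

theorem projP_lof {n : ℕ} (f : Hm K (A × B) (A × B) n) :
    projP K A B (DirectSum.lof K ℕ _ n f) =
      DirectSum.lof K ℕ (Hm K A B) n
        ((LinearMap.snd K A B).compMultilinearMap
          (f.compLinearMap fun _ => LinearMap.inl K A B)) := by
  simp [projP, DirectSum.toModule_lof]

theorem incl_mem {d : ℤ} {f : Abel K A B} (hf : f ∈ degPart K A B d) :
    incl K A B f ∈ degPart K (A × B) (A × B) d := by
  rcases degPart_cases hf with rfl | ⟨n, f, rfl, rfl⟩
  · simp
  rw [incl_lof]
  exact lof_mem_degPart rfl _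

theorem projP_mem {d : ℤ} {F : HmSum K (A × B) (A × B)} (hF : F ∈ degPart K (A × B) (A × B) d) :
    projP K A B F ∈ degPart K A B d := by
  rcases degPart_cases hF with rfl | ⟨n, f, rfl, rfl⟩
  · simp
  rw [projP_lof]
  exact lof_mem_degPart rfl _

/-- The inserted value lies in `B`, while the outer map reads only the `A`-components of its
arguments. -/
theorem dia_incl_incl (f g : Abel K A B) :
    dia K (A × B) (incl K A B f) (incl K A B g) = 0 := by
  have h : (dia K (A × B)).compl₁₂ (incl K A B) (incl K A B) = 0 := by
    refine DirectSum.linearMap_ext K fun m => LinearMap.ext fun f => ?_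
    refine DirectSum.linearMap_ext K fun n => LinearMap.ext fun g => ?_
    simp only [LinearMap.comp_apply, LinearMap.compl₁₂_apply, incl_lof, dia_lof,
      LinearMap.zero_apply]
    rw [diamond_eq_sum, Finset.sum_eq_zero, map_zero]
    intro i hi
    have hi := Finset.mem_range.1 hi
    rw [insN, dif_pos hi]
    convert smul_zero _
    ext1 v
    simp only [insL, LinearMap.mk₂_apply, ins_apply, LinearMap.compMultilinearMap_apply,
      MultilinearMap.compLinearMap_apply]
    rw [f.map_coord_zero ⟨i, hi⟩ (by simp [insArgs]), map_zero]
    rfl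
  exact LinearMap.congr_fun₂ h f g

theorem bracket_incl_incl (f g : Abel K A B) :
    bracket K (A × B) (incl K A B f) (incl K A B g) = 0 := by
  have h : (bracket K (A × B)).compl₁₂ (incl K A B) (incl K A B) = 0 := by
    refine DirectSum.linearMap_ext K fun m => LinearMap.ext fun f => ?_
    refine DirectSum.linearMap_ext K fun n => LinearMap.ext fun g => ?_
    simp only [LinearMap.comp_apply, LinearMap.compl₁₂_apply, LinearMap.zero_apply]
    rw [bracket_eq (incl_mem (lof_mem_degPart rfl f)) (incl_mem (lof_mem_degPart rfl g)),
      dia_incl_incl, dia_incl_incl, smul_zero, sub_zero]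
  exact LinearMap.congr_fun₂ h f g

/-- On arguments from `A`, the inserted value of `y` splits into its `B`- and its `A`-component. The
former is what `Py` contributes; after the latter, all arguments of `x` lie in `A`, so only `Px`
matters. In particular the kernel of `P` is closed under `⋄`. -/
theorem projP_dia (x y : HmSum K (A × B) (A × B)) :
    projP K A B (dia K (A × B) x y) =
      projP K A B (dia K (A × B) x (incl K A B (projP K A B y))) +
        projP K A B (dia K (A × B) (incl K A B (projP K A B x)) y) := by
  have h : (dia K (A × B)).compr₂ (projP K A B) =
      ((dia K (A × B)).compr₂ (projP K A B)).compl₂ (incl K A B ∘ₗ projP K A B) +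
        (dia K (A × B)).compr₂ (projP K A B) ∘ₗ (incl K A B ∘ₗ projP K A B) := by
    refine DirectSum.linearMap_ext K fun m => LinearMap.ext fun f => ?_
    refine DirectSum.linearMap_ext K fun n => LinearMap.ext fun g => ?_
    simp only [LinearMap.comp_apply, LinearMap.compr₂_apply, LinearMap.compl₂_apply,
      LinearMap.add_apply, incl_lof, projP_lof, dia_lof, diamond_eq_sum]
    rw [← map_add]
    congr 1
    ext1 v
    rw [_root_.add_apply]
    simp only [LinearMap.compMultilinearMap_apply, MultilinearMap.compLinearMap_apply,
      _root_.sum_apply, _root_.smul_apply, map_sum, map_smul]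
    rw [← Finset.sum_add_distrib]
    refine Finset.sum_congr rfl fun i hi => ?_
    have hi := Finset.mem_range.1 hi
    rw [← smul_add]
    congr 1
    simp only [insN, dif_pos hi, insL, LinearMap.mk₂_apply, ins_apply,
      LinearMap.compMultilinearMap_apply, MultilinearMap.compLinearMap_apply]
    set v' : Fin (m + n + 1) → A × B := fun j => LinearMap.inl K A B (v j) with hv'
    set w := insArgs (⟨i, hi⟩ : Fin (m + 1)) (0 : (Fin (n + 1) → A × B) → A × B) v' with hw
    set z := g (fun t => v' ⟨i + (t : ℕ), by omega⟩) with hz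
    have e1 : insArgs ⟨i, hi⟩ g v' =
        Function.update w ⟨i, hi⟩ (LinearMap.inl K A B z.1 + LinearMap.inr K A B z.2) := by
      rw [insArgs_eq_update _ _ 0]
      simp [hw, hz]
    have e2 : insArgs ⟨i, hi⟩ ((LinearMap.inr K A B).compMultilinearMap
        (((LinearMap.snd K A B).compMultilinearMap (g.compLinearMap fun _ =>
          LinearMap.inl K A B)).compLinearMap fun _ => LinearMap.fst K A B)) v' =
        Function.update w ⟨i, hi⟩ (LinearMap.inr K A B z.2) := by
      rw [insArgs_eq_update _ _ 0]
      simp [hw, hz, hv']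
    have e3 : (fun j => LinearMap.inl K A B (LinearMap.fst K A B (insArgs ⟨i, hi⟩ g v' j))) =
        Function.update w ⟨i, hi⟩ (LinearMap.inl K A B z.1) := by
      funext j
      rw [e1]
      by_cases hj : j = ⟨i, hi⟩
      · subst hj; simp
      · rw [Function.update_of_ne hj, Function.update_of_ne hj]
        simp only [hw, insArgs, hj, if_false, hv']
        split_ifs <;> simp
    rw [e2, e3, e1, f.map_update_add, map_add, add_comm]
    rfl
  exact LinearMap.congr_fun₂ h x y

theorem projP_bracket {m n : ℤ} {x y : HmSum K (A × B) (A × B)}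
    (hx : x ∈ degPart K (A × B) (A × B) m) (hy : y ∈ degPart K (A × B) (A × B) n) :
    projP K A B (bracket K (A × B) x y) =
      projP K A B (bracket K (A × B) x (incl K A B (projP K A B y))) -
        sg (m * n) • projP K A B (bracket K (A × B) y (incl K A B (projP K A B x))) := by
  rw [bracket_eq hx hy, bracket_eq hx (incl_mem (projP_mem hy)),
    bracket_eq hy (incl_mem (projP_mem hx)), map_sub, map_sub, map_sub, map_zsmul, map_zsmul,
    map_zsmul, projP_dia x y, projP_dia y x, mul_comm n m]
  rcases sg_eq_or (m * n) with h | h <;> rw [h] <;> module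

/-- The identity behind the Jacobi identities of the higher derived brackets. -/
theorem projP_iterBracket_bracket {H : Type*} {deg : H → ℤ} {e : H → Abel K A B}
    (he : ∀ h, e h ∈ degPart K A B (deg h)) {m n : ℤ} {x y : HmSum K (A × B) (A × B)}
    (hx : x ∈ degPart K (A × B) (A × B) m) (hy : y ∈ degPart K (A × B) (A × B) n)
    (fs : List H) :
    projP K A B (iterBracket (fs.map fun h => incl K A B (e h)) (bracket K (A × B) x y)) =
      unsh deg fs (fun I J =>
        projP K A B (iterBracket (J.map fun h => incl K A B (e h)) (bracket K (A × B) x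
          (incl K A B (projP K A B (iterBracket (I.map fun h => incl K A B (e h)) y)))))) -
      sg (m * n) • unsh deg fs (fun I J =>
        projP K A B (iterBracket (J.map fun h => incl K A B (e h)) (bracket K (A × B) y
          (incl K A B (projP K A B (iterBracket (I.map fun h => incl K A B (e h)) x)))))) := by
  have he' := fun h => incl_mem (he h)
  have hab : ∀ f g, bracket K (A × B) (incl K A B (e f)) (incl K A B (e g)) = 0 := fun f g =>
    bracket_incl_incl _ _
  -- The Leibniz rule distributes `fs`, then `projP_bracket` replaces one of the two factors by its
  -- image in `𝔞`. That image commutes with the entries still outside, so it can be bracketed in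
  -- before them.
  rw [iterBracket_bracket he' hx hy, ← unsh_map (projP K A B), ← unsh_zsmul,
    ← unsh_swap fs (fun I J => projP K A B (iterBracket (J.map fun h => incl K A B (e h))
      (bracket K (A × B) x (incl K A B (projP K A B
        (iterBracket (I.map fun h => incl K A B (e h)) y)))))), sub_eq_add_neg,
    ← neg_one_zsmul (unsh _ _ _), ← unsh_zsmul, ← unsh_add]
  refine unsh_congr fun J I _ _ _ => ?_
  have hxJ := iterBracket_mem he' hx J
  have hyI := iterBracket_mem he' hy I
  rw [map_zsmul, projP_bracket hxJ hyI,
    bracket_iterBracket_comm he' hab hx (incl_mem (projP_mem hyI)) (bracket_incl_incl _ _)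
      (fun f => bracket_incl_incl _ _),
    bracket_iterBracket_comm he' hab hy (incl_mem (projP_mem hxJ)) (bracket_incl_incl _ _)
      (fun f => bracket_incl_incl _ _), map_zsmul, map_zsmul, smul_sub, sub_eq_add_neg]
  simp only [smul_smul, ← sg_add]
  congr 1
  · congr 1
    apply sg_congr
    push_cast
    generalize (n : ZMod 2) = a
    generalize (dsum deg J : ZMod 2) = b
    generalize (dsum deg I : ZMod 2) = c
    revert a b c; decide
  · rw [← neg_one_zsmul]
    simp only [smul_smul]
    congr 2
    apply sg_congr
    push_cast
    generalize (n : ZMod 2) = a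
    generalize (m : ZMod 2) = d
    generalize (dsum deg J : ZMod 2) = b
    generalize (dsum deg I : ZMod 2) = c
    revert a b c d; decide

/-! ### Weights -/

variable (K A B) in
/-- The projection to `B`, as an element of degree `0`. -/
def euler : HmSum K (A × B) (A × B) :=
  DirectSum.lof K ℕ (Hm K (A × B) (A × B)) 0
    (MultilinearMap.ofSubsingleton K (A × B) (A × B) (0 : Fin 1) (proj K A B False))

theorem euler_mem : euler K A B ∈ degPart K (A × B) (A × B) 0 := lof_mem_degPart rfl _

theorem dia_lof_euler {n : ℕ} (f : Hm K (A × B) (A × B) n) :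
    dia K (A × B) (DirectSum.lof K ℕ _ n f) (euler K A B) =
      DirectSum.lof K ℕ (Hm K (A × B) (A × B)) n (∑ i : Fin (n + 1),
        f.compLinearMap (Function.update (fun _ => LinearMap.id) i (proj K A B False))) := by
  rw [euler, dia_lof, diamond_eq_sum, Finset.sum_range, map_sum, map_sum]
  refine Finset.sum_congr rfl fun i _ => ?_
  rw [mul_zero, pow_zero, one_smul]
  refine lof_eq_of_onSeq rfl fun v => ?_
  rw [onSeq_insN i.2]
  refine congrArg f (funext fun j => ?_)
  simp only [Function.update_apply, Fin.ext_iff]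
  split_ifs with h1 h3 h3
  · omega
  · rfl
  · simp [onSeq, h3]
  · rfl

theorem dia_euler_lof {n : ℕ} (f : Hm K (A × B) (A × B) n) :
    dia K (A × B) (euler K A B) (DirectSum.lof K ℕ _ n f) =
      DirectSum.lof K ℕ (Hm K (A × B) (A × B)) n ((proj K A B False).compMultilinearMap f) := by
  rw [euler, dia_lof, diamond_eq_sum, Finset.sum_eq_single_of_mem 0 (by simp) (fun i hi h => by
    rw [Finset.mem_range] at hi; omega), zero_mul, pow_zero, one_smul]
  refine lof_eq_of_onSeq (zero_add n) fun v => ?_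
  rw [onSeq_insN (by omega)]
  simp [onSeq]

theorem bracket_lof_euler {n : ℕ} (f : Hm K (A × B) (A × B) n) :
    bracket K (A × B) (DirectSum.lof K ℕ _ n f) (euler K A B) =
      DirectSum.lof K ℕ (Hm K (A × B) (A × B)) n ((∑ i : Fin (n + 1),
        f.compLinearMap (Function.update (fun _ => LinearMap.id) i (proj K A B False))) -
          (proj K A B False).compMultilinearMap f) := by
  rw [bracket_eq (lof_mem_degPart rfl f) euler_mem, mul_zero, sg_zero, one_smul, dia_lof_euler,
    dia_euler_lof, map_sub]

theorem ext_of_pure {n : ℕ} {f g : Hm K (A × B) (A × B) n}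
    (h : ∀ (s : Finset (Fin (n + 1))) (v : Fin (n + 1) → A × B),
      (∀ i ∈ s, (v i).2 = 0) → (∀ i ∉ s, (v i).1 = 0) → f v = g v) : f = g := by
  ext1 v
  have hv : v = (fun i => ((v i).1, (0 : B))) + (fun i => ((0 : A), (v i).2)) := by
    funext i; simp
  rw [hv, f.map_add_univ, g.map_add_univ]
  refine Finset.sum_congr rfl fun s _ => h s _ (fun i hi => ?_) (fun i hi => ?_)
  · simp [hi]
  · simp [hi]

/-- Bracketing with the projection to `B` counts arguments from `B` minus outputs in `B`. On
`C^{k|l}` this is `l - 0` for values in `A` and `(l + 1) - 1` for values in `B`. -/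
theorem bracket_euler_of_bidegree {n : ℕ} {k l : ℤ} {f : Hm K (A × B) (A × B) n}
    (hf : f ∈ bidegree K A B n k l) :
    bracket K (A × B) (DirectSum.lof K ℕ _ n f) (euler K A B) =
      (l : K) • DirectSum.lof K ℕ (Hm K (A × B) (A × B)) n f := by
  rw [bracket_lof_euler, ← map_smul]
  congr 1
  refine ext_of_pure fun s v h1 h2 => ?_
  rw [_root_.sub_apply, _root_.sum_apply, _root_.smul_apply]
  have e : ∀ i, f.compLinearMap (Function.update (fun _ => LinearMap.id) i (proj K A B False)) v =
      if i ∈ sᶜ then f v else 0 := by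
    intro i
    rw [MultilinearMap.compLinearMap_apply]
    split_ifs with hi
    · refine congrArg f (funext fun j => ?_)
      by_cases hj : j = i
      · subst hj
        rw [Function.update_self]
        ext
        · simp [proj, h2 j (by simpa using hi)]
        · simp [proj]
      · rw [Function.update_of_ne hj]; rfl
    · refine f.map_coord_zero i ?_
      rw [Function.update_self]
      simp [proj, h1 i (by simpa using hi)]
  simp only [e]
  rw [← Finset.sum_filter, Finset.filter_univ_mem, Finset.sum_const, ← Nat.cast_smul_eq_nsmul K]
  obtain ⟨a1, a2, a3⟩ := hf s v h1 h2
  by_cases c1 : (s.card : ℤ) = k + 1 ∧ (sᶜ.card : ℤ) = l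
  · have : (l : K) = (sᶜ.card : K) := by rw [← c1.2, Int.cast_natCast]
    rw [this]
    simp [proj, a1 c1]
  · by_cases c2 : (s.card : ℤ) = k ∧ (sᶜ.card : ℤ) = l + 1
    · have : (l : K) = (sᶜ.card : K) - 1 := by
        have := congrArg (Int.cast : ℤ → K) c2.2
        push_cast at this
        rw [this]; ring
      rw [this, sub_smul, one_smul]
      congr 1
      ext
      · simp [proj, a2 c2]
      · simp [proj]
    · simp [a3 c1 c2, proj]

/-- The part seen by `P` has no argument from `B` and its output in `B`, hence weight `-1`. -/
theorem projP_bracket_euler (x : HmSum K (A × B) (A × B)) :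
    projP K A B (bracket K (A × B) x (euler K A B)) = -projP K A B x := by
  have h : projP K A B ∘ₗ (bracket K (A × B)).flip (euler K A B) = -projP K A B := by
    refine DirectSum.linearMap_ext K fun n => LinearMap.ext fun f => ?_
    simp only [LinearMap.comp_apply, LinearMap.flip_apply, LinearMap.neg_apply]
    rw [bracket_lof_euler, projP_lof, projP_lof, ← map_neg]
    congr 1
    ext1 v
    simp only [LinearMap.compMultilinearMap_apply, MultilinearMap.compLinearMap_apply,
      _root_.sub_apply, _root_.sum_apply, _root_.neg_apply]
    rw [Finset.sum_eq_zero fun i _ => f.map_coord_zero i (by simp [proj])]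
    simp [proj]
  exact LinearMap.congr_fun h x

theorem bracket_incl_euler (f : Abel K A B) :
    bracket K (A × B) (incl K A B f) (euler K A B) = -incl K A B f := by
  have h : (bracket K (A × B)).flip (euler K A B) ∘ₗ incl K A B = -incl K A B := by
    refine DirectSum.linearMap_ext K fun n => LinearMap.ext fun f => ?_
    simp only [LinearMap.comp_apply, LinearMap.flip_apply, LinearMap.neg_apply]
    rw [incl_lof, bracket_lof_euler, ← map_neg]
    congr 1
    ext1 v
    simp only [LinearMap.compMultilinearMap_apply, MultilinearMap.compLinearMap_apply,
      _root_.sub_apply, _root_.sum_apply, _root_.neg_apply]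
    rw [Finset.sum_eq_zero fun i _ => by
      rw [f.map_coord_zero i (by simp [proj]), map_zero]]
    simp [proj]
  exact LinearMap.congr_fun h f

theorem bracket_bracket_euler (x y : HmSum K (A × B) (A × B)) :
    bracket K (A × B) (bracket K (A × B) x y) (euler K A B) =
      bracket K (A × B) x (bracket K (A × B) y (euler K A B)) +
        bracket K (A × B) (bracket K (A × B) x (euler K A B)) y := by
  induction x using DirectSum.induction_on with
  | zero => simp
  | add x x' hx hx' => simp only [map_add, LinearMap.add_apply, hx, hx']; abel
  | of m f =>
    induction y using DirectSum.induction_on with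
    | zero => simp
    | add y y' hy hy' => simp only [map_add, LinearMap.add_apply, hy, hy']; abel
    | of n g =>
      have hf := lof_mem_degPart (K := K) (E := A × B) (F := A × B) rfl f
      have hg := lof_mem_degPart (K := K) (E := A × B) (F := A × B) rfl g
      have := bracket_jacobi hf hg euler_mem
      rwa [mul_zero, sg_zero, one_smul] at this

/-- `euler` has degree `0`, so bracketing with it is a derivation without signs. Elements of `𝔞`
have weight `-1`, so each bracket with one lowers the weight by `1`. -/
theorem iterBracket_euler {w : K} {x : HmSum K (A × B) (A × B)}
    (hw : bracket K (A × B) x (euler K A B) = w • x) (fs : List (Abel K A B)) :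
    bracket K (A × B) (iterBracket (fs.map (incl K A B)) x) (euler K A B) =
      (w - fs.length) • iterBracket (fs.map (incl K A B)) x := by
  induction fs generalizing w x with
  | nil => simpa [iterBracket] using hw
  | cons f fs ih =>
    rw [List.map_cons, iterBracket_cons, ih (w := w - 1)]
    · congr 1
      rw [List.length_cons]
      push_cast
      ring
    · rw [bracket_bracket_euler, hw, bracket_incl_euler, map_neg, map_smul, LinearMap.smul_apply]
      module

/-- `P[⋯[[F, f_1], f_2], …, f_r]` vanishes if `F` has fewer than `r` arguments. -/
theorem projP_iterBracket_eq_zero [CharZero K] {n : ℕ} {f : Hm K (A × B) (A × B) n}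
    (hf : f ∈ quasiPart K A B n) {fs : List (Abel K A B)} (hfs : n + 1 < fs.length) :
    projP K A B (iterBracket (fs.map (incl K A B)) (DirectSum.lof K ℕ _ n f)) = 0 := by
  have key : quasiPart K A B n ≤ LinearMap.ker (projP K A B ∘ₗ
      iterBracket (fs.map (incl K A B)) ∘ₗ
      DirectSum.lof K ℕ (Hm K (A × B) (A × B)) n) := by
    refine iSup₂_le fun k _ g hg => ?_
    rw [LinearMap.mem_ker, LinearMap.comp_apply, LinearMap.comp_apply]
    -- The iterated bracket has weight `n - k - r` with `r = fs.length`, but `P` only sees weight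
    -- `-1`; hence `n - k - r + 1` annihilates its projection. This integer is negative because `k ≥
    -- 0` and `r > n + 1`, so it is non-zero in `K`.
    have h1 := iterBracket_euler (bracket_euler_of_bidegree hg) fs
    have h2 := projP_bracket_euler
      (iterBracket (fs.map (incl K A B)) (DirectSum.lof K ℕ _ n g))
    rw [h1, map_smul, eq_neg_iff_add_eq_zero, ← one_smul K (projP K A B _), smul_smul, mul_one,
      ← add_smul] at h2
    refine (smul_eq_zero.1 h2).resolve_left fun h => ?_
    have : ((n - k - fs.length + 1 : ℤ) : K) = 0 := by
      rw [← h]; push_cast; ring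
    rw [Int.cast_eq_zero] at this
    omega
  exact key hf

end Projection


/-! ### The higher derived brackets in terms of lists -/

section DerivedBrackets

variable {K A B : Type*} [Field K] [AddCommGroup A] [Module K A] [AddCommGroup B] [Module K B]

theorem parity_of_mem {E F : Type*} [AddCommGroup E] [Module K E] [AddCommGroup F] [Module K F]
    {d : ℤ} {x : HmSum K E F} (hx : x ∈ degPart K E F d) : parity K E F x = sg d • x := by
  rcases degPart_cases hx with rfl | ⟨n, f, rfl, rfl⟩
  · simp
  · rw [parity, DirectSum.toModule_lof, LinearMap.smul_apply, neg_one_pow_smul_hmSum]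

theorem parity_pow_of_mem {d : ℤ} {x : Abel K A B} (hx : x ∈ degPart K A B d) (n : ℕ) :
    (parity K A B ^ n) x = sg (n * d) • x := by
  induction n with
  | zero => simp
  | succ n ih =>
    rw [pow_succ', Module.End.mul_apply, ih, map_zsmul, parity_of_mem hx, smul_smul, ← sg_add]
    congr 2
    push_cast
    ring

theorem iterBracket_linear {E : Type*} [AddCommGroup E] [Module K E] (p : List (HmSum K E E))
    (c : K) (u v : HmSum K E E) (q : List (HmSum K E E)) (x : HmSum K E E) :
    iterBracket (p ++ (c • u + v) :: q) x =
      c • iterBracket (p ++ u :: q) x + iterBracket (p ++ v :: q) x := by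
  simp [iterBracket_append, iterBracket_cons]

/-- The derived bracket of `F` with the elements of two lists that are on its left and on its
right. -/
def mixPair (p q : List (Abel K A B)) : HmSum K (A × B) (A × B) →ₗ[K] Abel K A B :=
  DirectSum.toModule K ℕ (Abel K A B) fun n => projP K A B ∘ₗ
    iterBracket ((p.map fun f => incl K A B ((parity K A B ^ (n + 1)) f)) ++
      q.map (incl K A B)) ∘ₗ DirectSum.lof K ℕ (Hm K (A × B) (A × B)) n

theorem mixPair_lof (p q : List (Abel K A B)) {n : ℕ} (f : Hm K (A × B) (A × B) n) :
    mixPair p q (DirectSum.lof K ℕ _ n f) = projP K A B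
      (iterBracket ((p.map fun f => incl K A B ((parity K A B ^ (n + 1)) f)) ++
        q.map (incl K A B)) (DirectSum.lof K ℕ (Hm K (A × B) (A × B)) n f)) := by
  simp [mixPair, DirectSum.toModule_lof]

theorem mixPair_nil (q : List (Abel K A B)) (F : HmSum K (A × B) (A × B)) :
    mixPair [] q F = projP K A B (iterBracket (q.map (incl K A B)) F) := by
  have : mixPair [] q = projP K A B ∘ₗ iterBracket (q.map (incl K A B)) :=
    DirectSum.linearMap_ext K fun n => LinearMap.ext fun f => by
      simp only [LinearMap.comp_apply]
      rw [mixPair_lof]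
      rfl
  exact LinearMap.congr_fun this F

theorem mixPair_linear_left (p p' q : List (Abel K A B)) (c : K) (u v : Abel K A B)
    (F : HmSum K (A × B) (A × B)) :
    mixPair (p ++ (c • u + v) :: p') q F =
      c • mixPair (p ++ u :: p') q F + mixPair (p ++ v :: p') q F := by
  have : mixPair (p ++ (c • u + v) :: p') q =
      c • mixPair (p ++ u :: p') q + mixPair (p ++ v :: p') q :=
    DirectSum.linearMap_ext K fun n => LinearMap.ext fun f => by
      simp only [LinearMap.comp_apply, LinearMap.add_apply, LinearMap.smul_apply, mixPair_lof,
        List.map_append, List.map_cons, map_add, map_smul, List.append_assoc, List.cons_append,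
        iterBracket_linear]
  exact LinearMap.congr_fun this F

theorem mixPair_linear_right (p q q' : List (Abel K A B)) (c : K) (u v : Abel K A B)
    (F : HmSum K (A × B) (A × B)) :
    mixPair p (q ++ (c • u + v) :: q') F =
      c • mixPair p (q ++ u :: q') F + mixPair p (q ++ v :: q') F := by
  have : mixPair p (q ++ (c • u + v) :: q') =
      c • mixPair p (q ++ u :: q') + mixPair p (q ++ v :: q') :=
    DirectSum.linearMap_ext K fun n => LinearMap.ext fun f => by
      simp only [LinearMap.comp_apply, LinearMap.add_apply, LinearMap.smul_apply, mixPair_lof,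
        List.map_append, List.map_cons, map_add, map_smul, ← List.append_assoc,
        iterBracket_linear]
  exact LinearMap.congr_fun this F

theorem mixPair_eq_zero_of_mem {p q : List (Abel K A B)} (h : 0 ∈ p ∨ 0 ∈ q)
    (F : HmSum K (A × B) (A × B)) : mixPair p q F = 0 := by
  have : mixPair p q = 0 :=
    DirectSum.linearMap_ext K fun n => LinearMap.ext fun f => by
      simp only [LinearMap.comp_apply, mixPair_lof, LinearMap.zero_apply]
      rw [iterBracket_zero_mem, map_zero]
      rcases h with h | h
      · exact List.mem_append_left _ (List.mem_map.2 ⟨0, h, by simp⟩)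
      · exact List.mem_append_right _ (List.mem_map.2 ⟨0, h, by simp⟩)
  exact LinearMap.congr_fun this F

theorem mixPair_eq_zero_of_length [CharZero K] {p q : List (Abel K A B)}
    {F : HmSum K (A × B) (A × B)} (hF : F ∈ quasi K A B)
    (h : ∀ n, F n ≠ 0 → n + 1 < p.length + q.length) : mixPair p q F = 0 := by
  classical
  rw [eq_sum_lof F, map_sum]
  refine Finset.sum_eq_zero fun n hn => ?_
  rw [mixPair_lof]
  have := projP_iterBracket_eq_zero (hF n)
    (fs := (p.map fun f => (parity K A B ^ (n + 1)) f) ++ q)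
    (by simpa using h n (by simpa using hn))
  simpa [Function.comp_def] using this

/-- The sum of the derived brackets of the entries of a list with the other entries. -/
def mixSum : List (Abel K A B) → List (Total K A B) → Abel K A B
  | _, [] => 0
  | p, x :: xs => mixPair p (xs.map Prod.snd) x.1 + mixSum (p ++ [x.2]) xs

theorem map_otherArgs {X Y : Type*} {k : ℕ} (i : Fin k) (f : Fin k → X) (a b : X → Y) :
    (((List.finRange k).filter fun j => j ≠ i).map fun j => if j < i then a (f j) else b (f j)) =
      ((List.ofFn f).take i).map a ++ ((List.ofFn f).drop (i + 1)).map b := by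
  induction k with
  | zero => exact i.elim0
  | succ k ih =>
    rw [List.finRange_succ, List.ofFn_succ]
    refine Fin.cases ?_ (fun i => ?_) i
    · rw [List.filter_cons_of_neg (by simp), List.filter_map, List.filter_eq_self.2 (by simp)]
      simp [List.ofFn_eq_map, Function.comp_def]
    · rw [List.filter_cons_of_pos (by simp [Fin.ext_iff]), List.filter_map]
      have := ih i (fun j => f j.succ)
      simp only [List.map_cons, Fin.succ_pos, if_true, List.map_map, Fin.val_succ,
        List.take_succ_cons, List.drop_succ_cons, List.cons_append, ← this]
      congr 1
      simp [Function.comp_def]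

theorem mixedTerm_eq {k : ℕ} (i : Fin k) (F : HmSum K (A × B) (A × B)) (f : Fin k → Abel K A B) :
    mixedTerm i F f = mixPair ((List.ofFn f).take i) ((List.ofFn f).drop (i + 1)) F := by
  rw [mixedTerm, mixPair]
  congr 2
  funext n
  congr 3
  rw [otherArgs, ← map_otherArgs]
  congr 1
  funext j
  split_ifs <;> rfl

theorem mixSum_eq_sum (p : List (Abel K A B)) (xs : List (Total K A B)) :
    mixSum p xs = ∑ i : Fin xs.length, mixPair (p ++ (xs.map Prod.snd).take i)
      ((xs.map Prod.snd).drop (i + 1)) (xs.get i).1 := by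
  induction xs generalizing p with
  | nil => simp [mixSum]
  | cons x xs ih =>
    rw [mixSum, ih]
    refine Eq.symm ((Fin.sum_univ_succ (n := xs.length) _).trans ?_)
    simp

theorem snd_lTilde (xs : List (Total K A B)) :
    (onList (lTilde K A B) xs).2 = mixSum [] xs := by
  rw [mixSum_eq_sum]
  change ∑ i : Fin xs.length, mixedTerm i (xs.get i).1 (fun j => (xs.get j).2) = _
  refine Finset.sum_congr rfl fun i _ => ?_
  rw [mixedTerm_eq]
  have : (List.ofFn fun j => (xs.get j).2) = xs.map Prod.snd := by
    rw [show (fun j => (xs.get j).2) = Prod.snd ∘ xs.get from rfl, ← List.map_ofFn, List.ofFn_get]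
  rw [this]
  rfl

theorem fst_lTilde_of_ne {xs : List (Total K A B)} (h : xs.length ≠ 2) :
    (onList (lTilde K A B) xs).1 = 0 := by
  have key : ∀ (k : ℕ) (x : Fin k → Total K A B), k ≠ 2 → quasiTerm k x = 0 := by
    intro k x hk
    match k, x, hk with
    | 0, _, _ => rfl
    | 1, _, _ => rfl
    | 2, _, hk => exact absurd rfl hk
    | _ + 3, _, _ => rfl
  exact key _ _ h

theorem fst_lTilde_pair (x y : Total K A B) :
    ((onList (lTilde K A B) [x, y]).1 : HmSum K (A × B) (A × B)) =
      bracket K (A × B) (parity K (A × B) (A × B) x.1) y.1 := rfl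

theorem mixSum_linear_left (p p' : List (Abel K A B)) (c : K) (u v : Abel K A B)
    (xs : List (Total K A B)) :
    mixSum (p ++ (c • u + v) :: p') xs =
      c • mixSum (p ++ u :: p') xs + mixSum (p ++ v :: p') xs := by
  induction xs generalizing p' with
  | nil => simp [mixSum]
  | cons x xs ih =>
    simp only [mixSum, mixPair_linear_left, List.append_assoc, List.cons_append, ih]
    module

theorem mixSum_linear (r : List (Abel K A B)) (p : List (Total K A B)) (c : K)
    (x y : Total K A B) (q : List (Total K A B)) :
    mixSum r (p ++ (c • x + y) :: q) =
      c • mixSum r (p ++ x :: q) + mixSum r (p ++ y :: q) := by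
  induction p generalizing r with
  | nil =>
    simp only [List.nil_append, mixSum, Prod.fst_add, Prod.smul_fst, Prod.snd_add, Prod.smul_snd,
      Submodule.coe_add, Submodule.coe_smul, map_add, map_smul]
    rw [mixSum_linear_left]
    module
  | cons z p ih =>
    simp only [List.cons_append, mixSum, List.map_append, List.map_cons, Prod.snd_add,
      Prod.smul_snd, mixPair_linear_right, ih]
    module

theorem lTilde_linear (p : List (Total K A B)) (c : K) (x y : Total K A B)
    (q : List (Total K A B)) :
    onList (lTilde K A B) (p ++ (c • x + y) :: q) =
      c • onList (lTilde K A B) (p ++ x :: q) + onList (lTilde K A B) (p ++ y :: q) := by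
  refine Prod.ext ?_ ?_
  · by_cases h : p.length + q.length = 1
    · rcases p with _ | ⟨z, p⟩
      · rcases q with _ | ⟨w, q⟩
        · simp at h
        · obtain rfl : q = [] := by simpa using h
          refine Subtype.ext ?_
          simp [fst_lTilde_pair]
      · obtain ⟨rfl, rfl⟩ : p = [] ∧ q = [] := by
          simp at h
          constructor <;> rw [← List.length_eq_zero_iff] <;> omega
        refine Subtype.ext ?_
        simp [fst_lTilde_pair]
    · rw [Prod.fst_add, Prod.smul_fst]
      rw [fst_lTilde_of_ne, fst_lTilde_of_ne, fst_lTilde_of_ne, smul_zero, add_zero] <;>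
      · simp; omega
  · rw [Prod.snd_add, Prod.smul_snd, snd_lTilde, snd_lTilde, snd_lTilde, mixSum_linear]

/-! ### Homogeneous arguments -/

variable (K A B) in
/-- The homogeneous elements of `𝒬[1] ⊕ 𝔞`, together with their degrees. -/
abbrev HTotal := Homog (K := K) (V := Total K A B) (grading K A B)

theorem fst_mem (x : HTotal K A B) :
    (x.2.1.1 : HmSum K (A × B) (A × B)) ∈ degPart K (A × B) (A × B) (x.1 + 1) := x.2.2.1

theorem snd_mem (x : HTotal K A B) : x.2.1.2 ∈ degPart K A B x.1 := x.2.2.2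

/-- The component in `𝔞`, as an element of `𝔤`. -/
def inclSnd (x : HTotal K A B) : HmSum K (A × B) (A × B) := incl K A B x.2.1.2

theorem inclSnd_mem (x : HTotal K A B) :
    inclSnd x ∈ degPart K (A × B) (A × B) x.1 := incl_mem (snd_mem x)

theorem bracket_inclSnd (x y : HTotal K A B) :
    bracket K (A × B) (inclSnd x) (inclSnd y) = 0 := bracket_incl_incl _ _

/-- The components in `𝔞`. -/
def snds (xs : List (HTotal K A B)) : List (Abel K A B) := xs.map fun x => x.2.1.2

theorem map_snd_vals (xs : List (HTotal K A B)) : (vals xs).map Prod.snd = snds xs := by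
  simp [vals, snds, Function.comp_def]

theorem iterBracket_map_sg {H : Type*} {deg : H → ℤ} {e : H → HmSum K (A × B) (A × B)} (c : ℤ)
    (p : List H) (q : List (HmSum K (A × B) (A × B))) (x : HmSum K (A × B) (A × B)) :
    iterBracket ((p.map fun h => sg (c * deg h) • e h) ++ q) x =
      sg (c * dsum deg p) • iterBracket (p.map e ++ q) x := by
  induction p generalizing x with
  | nil => simp
  | cons h p ih =>
    simp only [List.map_cons, List.cons_append, iterBracket_cons, ih, map_zsmul, smul_smul,
      ← sg_add, dsum_cons]
    congr 2
    ring

/-- For `F` of degree `n`, the powers `n + 1` of `parity` have the parity of the degree `n - 1` of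
`F[1]` and avoid subtraction at `n = 0`. On homogeneous entries they multiply to the Koszul sign of
moving `F[1]` to the front. -/
theorem mixPair_snds (p q : List (HTotal K A B)) (x : HTotal K A B) :
    mixPair (snds p) (snds q) x.2.1.1 = sg (x.1 * dsum Sigma.fst p) •
      projP K A B (iterBracket ((p ++ q).map inclSnd) x.2.1.1) := by
  rcases degPart_cases (fst_mem x) with h | ⟨n, f, hn, h⟩
  · simp [h]
  · rw [h, mixPair_lof, ← map_zsmul, List.map_append, ← iterBracket_map_sg]
    refine congrArg (fun L => projP K A B (iterBracket L _)) (congrArg₂ (· ++ ·) ?_ ?_)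
    · simp only [snds, List.map_map, Function.comp_def]
      refine List.map_congr_left fun y _ => ?_
      rw [parity_pow_of_mem (snd_mem y), map_zsmul]
      change _ = sg (x.1 * y.1) • incl K A B y.2.1.2
      congr 1
      apply sg_congr
      have := congrArg (Int.cast : ℤ → ZMod 2) hn
      push_cast at this ⊢
      rw [this]
      generalize (x.1 : ZMod 2) = a
      generalize (y.1 : ZMod 2) = b
      revert a b; decide
    · simp only [snds, List.map_map, Function.comp_def]
      rfl

theorem mixSum_cons (p : List (HTotal K A B)) (x : HTotal K A B)
    (xs : List (HTotal K A B)) :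
    mixSum (snds p) (vals (x :: xs)) = sg (x.1 * dsum Sigma.fst p) •
      projP K A B (iterBracket ((p ++ xs).map inclSnd) x.2.1.1) +
        mixSum (snds (p ++ [x])) (vals xs) := by
  rw [vals_cons, mixSum, map_snd_vals, mixPair_snds]
  simp [snds]

theorem mixSum_mem (p xs : List (HTotal K A B)) :
    mixSum (snds p) (vals xs) ∈
      degPart K A B (dsum Sigma.fst p + dsum Sigma.fst xs + 1) := by
  induction xs generalizing p with
  | nil => exact Submodule.zero_mem _
  | cons x xs ih =>
    rw [mixSum_cons]
    refine Submodule.add_mem _ (zsmul_mem ?_ _) ?_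
    · have := projP_mem (iterBracket_mem inclSnd_mem (fst_mem x) (p ++ xs))
      convert this using 1
      rw [dsum_append, dsum_cons]; ring_nf
    · convert ih (p ++ [x]) using 1
      simp only [dsum_append, dsum_cons, dsum_nil]; ring_nf

theorem mixSum_swap_left (p q xs : List (HTotal K A B)) (a b : HTotal K A B) :
    mixSum (snds (p ++ a :: b :: q)) (vals xs) =
      sg (a.1 * b.1) • mixSum (snds (p ++ b :: a :: q)) (vals xs) := by
  induction xs generalizing q with
  | nil => simp [mixSum]
  | cons x xs ih =>
    have e := ih (q ++ [x])
    rw [mixSum_cons, mixSum_cons, smul_add, List.append_assoc, List.append_assoc,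
      List.append_assoc]
    simp only [List.cons_append] at e ⊢
    rw [e, List.append_assoc]
    have := iterBracket_swapSymm inclSnd_mem bracket_inclSnd (fst_mem x) p a b (q ++ xs)
    simp only [List.cons_append] at this ⊢
    rw [this, map_zsmul, smul_comm]
    congr 3
    simp only [dsum_append, dsum_cons]
    congr 1
    ring

/-- Where `a` and `b` both enter through `𝔞`, their brackets commute up to sign. The two terms in
which `a` or `b` supplies the outer map are interchanged. -/
theorem mixSum_swap (r p q : List (HTotal K A B)) (a b : HTotal K A B) :
    mixSum (snds r) (vals (p ++ a :: b :: q)) =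
      sg (a.1 * b.1) • mixSum (snds r) (vals (p ++ b :: a :: q)) := by
  induction p generalizing r with
  | nil =>
    simp only [List.nil_append]
    rw [mixSum_cons, mixSum_cons, mixSum_cons, mixSum_cons]
    have := mixSum_swap_left r [] q a b
    simp only [List.append_assoc, List.cons_append, List.nil_append] at this ⊢
    rw [this]
    simp only [dsum_append, dsum_cons, dsum_nil, add_zero, mul_add, sg_add, mul_comm b.1 a.1]
    rcases sg_eq_or (a.1 * b.1) with h | h <;> rw [h] <;> module
  | cons z p ih =>
    simp only [List.cons_append]
    rw [mixSum_cons, mixSum_cons, ih, smul_add]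
    have := iterBracket_swapSymm inclSnd_mem bracket_inclSnd (fst_mem z) (r ++ p) a b q
    simp only [List.append_assoc] at this
    rw [this, map_zsmul, smul_comm]

/-- In the binary case, the sign `(-1)^{|F|}` and the degree shift turn the graded antisymmetry of
the bracket into graded symmetry. -/
theorem lTilde_swapSymm : SwapSymm Sigma.fst fun xs : List (HTotal K A B) =>
    onList (lTilde K A B) (vals xs) := by
  intro p a b q
  refine Prod.ext ?_ ?_
  · by_cases h : p.length + q.length = 0
    · obtain ⟨rfl, rfl⟩ : p = [] ∧ q = [] := by
        constructor <;> rw [← List.length_eq_zero_iff] <;> omega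
      refine Subtype.ext ?_
      simp only [List.nil_append, vals_cons, vals_nil, Prod.smul_fst]
      rw [fst_lTilde_pair]
      change _ = sg (a.1 * b.1) • ((onList (lTilde K A B) [b.2.1, a.2.1]).1 : HmSum K (A × B) (A × B))
      rw [fst_lTilde_pair, parity_of_mem (fst_mem a), parity_of_mem (fst_mem b), map_zsmul,
        map_zsmul, LinearMap.smul_apply, LinearMap.smul_apply,
        bracket_antisymm (fst_mem a) (fst_mem b), smul_neg, smul_smul, smul_smul, ← sg_add,
        ← sg_add, ← neg_one_smul ℤ, smul_smul, ← sg_one, ← sg_add]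
      congr 1
      apply sg_congr
      push_cast
      generalize (a.1 : ZMod 2) = x
      generalize (b.1 : ZMod 2) = y
      revert x y; decide
    · rw [Prod.smul_fst]
      rw [fst_lTilde_of_ne, fst_lTilde_of_ne, smul_zero] <;>
      · simp; omega
  · rw [Prod.smul_snd]
    simp only [snd_lTilde]
    exact mixSum_swap [] p q a b

theorem lTilde_mem (xs : List (HTotal K A B)) :
    onList (lTilde K A B) (vals xs) ∈ grading K A B (dsum Sigma.fst xs + 1) := by
  refine ⟨?_, ?_⟩
  · by_cases h : xs.length = 2
    · obtain ⟨a, b, rfl⟩ := List.length_eq_two.1 h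
      change ((onList (lTilde K A B) [a.2.1, b.2.1]).1 : HmSum K (A × B) (A × B)) ∈
      degPart K (A × B) (A × B) (dsum Sigma.fst [a, b] + 1 + 1)
      rw [fst_lTilde_pair, parity_of_mem (fst_mem a), map_zsmul, LinearMap.smul_apply]
      refine zsmul_mem ?_ _
      convert bracket_mem (fst_mem a) (fst_mem b) using 1
      simp only [dsum_cons, dsum_nil]; ring_nf
    · rw [fst_lTilde_of_ne (by simpa using h)]
      exact Submodule.zero_mem _
  · rw [snd_lTilde]
    have := mixSum_mem [] xs
    rw [dsum_nil, zero_add] at this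
    exact this

end DerivedBrackets


/-! ### The Jacobi identities -/

section Jacobi

variable {K A B : Type*} [Field K] [AddCommGroup A] [Module K A] [AddCommGroup B] [Module K B]

theorem lTilde_zero (p q : List (Total K A B)) : onList (lTilde K A B) (p ++ 0 :: q) = 0 := by
  have := lTilde_linear p (1 : K) 0 0 q
  simpa using this

theorem lTilde_add (p : List (Total K A B)) (x y : Total K A B) (q : List (Total K A B)) :
    onList (lTilde K A B) (p ++ (x + y) :: q) =
      onList (lTilde K A B) (p ++ x :: q) + onList (lTilde K A B) (p ++ y :: q) := by
  have := lTilde_linear p (1 : K) x y q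
  simpa only [one_smul] using this

theorem lTilde_smul (p : List (Total K A B)) (c : K) (x : Total K A B)
    (q : List (Total K A B)) :
    onList (lTilde K A B) (p ++ (c • x) :: q) = c • onList (lTilde K A B) (p ++ x :: q) := by
  have := lTilde_linear p c x 0 q
  rwa [add_zero, lTilde_zero, add_zero] at this

theorem lTilde_zsmul (p : List (Total K A B)) (c : ℤ) (x : Total K A B)
    (q : List (Total K A B)) :
    onList (lTilde K A B) (p ++ (c • x) :: q) = c • onList (lTilde K A B) (p ++ x :: q) := by
  exact map_zsmul (AddMonoidHom.mk' (fun x => onList (lTilde K A B) (p ++ x :: q))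
    fun x y => lTilde_add p x y q) c x

theorem mixSum_eq_zero_of_mem {p : List (Abel K A B)} (h : 0 ∈ p) (xs : List (Total K A B)) :
    mixSum p xs = 0 := by
  induction xs generalizing p with
  | nil => rfl
  | cons x xs ih =>
    rw [mixSum, mixPair_eq_zero_of_mem (Or.inl h), ih (List.mem_append_left _ h), add_zero]

theorem mixSum_eq_zero_of_fst {p : List (Abel K A B)} {xs : List (Total K A B)}
    (h : ∀ x ∈ xs, x.1 = 0) : mixSum p xs = 0 := by
  induction xs generalizing p with
  | nil => rfl
  | cons x xs ih =>
    rw [mixSum, ih fun y hy => h y (List.mem_cons_of_mem _ hy), h x List.mem_cons_self]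
    simp

/-- `l_k(F[1], f_1, …, f_{k-1}) = P[⋯[[F, f_1], f_2], …, f_{k-1}]` -/
theorem lTilde_mixed (x : Total K A B) {xs : List (Total K A B)}
    (hxs : ∀ y ∈ xs, y.1 = 0) : onList (lTilde K A B) (x :: xs) =
      (0, projP K A B (iterBracket ((xs.map Prod.snd).map (incl K A B)) x.1)) := by
  refine Prod.ext ?_ ?_
  · by_cases h : xs.length = 1
    · obtain ⟨y, rfl⟩ := List.length_eq_one_iff.1 h
      refine Subtype.ext ?_
      rw [fst_lTilde_pair, hxs y (by simp)]
      simp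
    · rw [fst_lTilde_of_ne]
      simp; omega
  · rw [snd_lTilde, mixSum, mixPair_nil, mixSum_eq_zero_of_fst hxs, add_zero]

/-- The operations vanish on `𝔞`. -/
theorem lTilde_abelian {xs : List (Total K A B)} (hxs : ∀ y ∈ xs, y.1 = 0) :
    onList (lTilde K A B) xs = 0 := by
  rcases xs with _ | ⟨x, xs⟩
  · refine Prod.ext (fst_lTilde_of_ne (by simp)) ?_
    rw [snd_lTilde]
    rfl
  · rw [show x = 0 + x by simp] at hxs ⊢
    refine Prod.ext ?_ ?_
    · by_cases h : xs.length = 1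
      · obtain ⟨y, rfl⟩ := List.length_eq_one_iff.1 h
        refine Subtype.ext ?_
        rw [fst_lTilde_pair, hxs y (by simp)]
        simp
      · rw [fst_lTilde_of_ne]
        · rfl
        · simp; omega
    · rw [snd_lTilde, mixSum_eq_zero_of_fst hxs]
      rfl

theorem snd_lTilde_two (x y : Total K A B) (xs : List (Total K A B)) (hx : x.2 = 0)
    (hy : y.2 = 0) : (onList (lTilde K A B) (x :: y :: xs)).2 = 0 := by
  rw [snd_lTilde, mixSum, mixSum, mixSum_eq_zero_of_mem (by simp [hx]),
    mixPair_eq_zero_of_mem (Or.inr (by simp [hy])), mixPair_eq_zero_of_mem (Or.inl (by simp [hx])),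
    add_zero, add_zero]

/-- For `k ≥ 3`, `l_k` vanishes if two of its arguments are from `𝒬[1]`. -/
theorem lTilde_vanish (x y : Total K A B) {xs : List (Total K A B)} (hx : x.2 = 0)
    (hy : y.2 = 0) (hxs : xs ≠ []) : onList (lTilde K A B) (x :: y :: xs) = 0 := by
  refine Prod.ext ?_ (snd_lTilde_two x y xs hx hy)
  rw [fst_lTilde_of_ne]
  · rfl
  · simpa using hxs

theorem lTilde_binary {a b : HTotal K A B} (ha : a.2.1.2 = 0) (hb : b.2.1.2 = 0) :
    onList (lTilde K A B) [a.2.1, b.2.1] =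
      (⟨sg (a.1 + 1) • bracket K (A × B) a.2.1.1 b.2.1.1,
        zsmul_mem (bracket_mem_quasi a.2.1.1.2 b.2.1.1.2) _⟩, 0) := by
  refine Prod.ext (Subtype.ext ?_) (snd_lTilde_two _ _ _ ha hb)
  rw [fst_lTilde_pair, parity_of_mem (fst_mem a), map_zsmul, LinearMap.smul_apply]

/-- The value of the operations on a list of homogeneous elements, as a homogeneous element. -/
def lHom (xs : List (HTotal K A B)) : HTotal K A B :=
  ⟨dsum Sigma.fst xs + 1, onList (lTilde K A B) (vals xs), lTilde_mem xs⟩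

/-- The left-hand side of the Jacobi identity. -/
def jacobiator (xs : List (HTotal K A B)) : Total K A B :=
  unsh Sigma.fst xs fun I J => onList (lTilde K A B) (vals (lHom I :: J))

theorem lTilde_perm {xs ys : List (HTotal K A B)} (h : xs.Perm ys)
    (h0 : onList (lTilde K A B) (vals ys) = 0) : onList (lTilde K A B) (vals xs) = 0 := by
  have key : ∀ (Φ : List (HTotal K A B) → Total K A B), SwapSymm Sigma.fst Φ →
      ∃ s : ℤ, Φ xs = s • Φ ys := by
    clear h0
    induction h with
    | nil => exact fun Φ _ => ⟨1, by simp⟩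
    | cons x _ ih => exact fun Φ hΦ => ih _ (hΦ.cons x)
    | swap x y l => exact fun Φ hΦ => ⟨_, hΦ [] y x l⟩
    | trans _ _ ih1 ih2 =>
      intro Φ hΦ
      obtain ⟨s, hs⟩ := ih1 Φ hΦ
      obtain ⟨t, ht⟩ := ih2 Φ hΦ
      exact ⟨s * t, by rw [hs, ht, smul_smul]⟩
  obtain ⟨s, hs⟩ := key _ lTilde_swapSymm
  exact hs.trans (by rw [h0, smul_zero])

/-- Graded symmetry of inner and outer operation makes the jacobiator symmetric up to sign, so its
vanishing may be tested on any ordering of the entries. -/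
theorem jacobiator_perm {xs ys : List (HTotal K A B)} (h : xs.Perm ys)
    (h0 : jacobiator ys = 0) : jacobiator xs = 0 := by
  obtain ⟨s, hs⟩ := unsh_perm (M := Total K A B) (deg := Sigma.fst) h
  rw [jacobiator, hs, ← jacobiator, h0, smul_zero]
  · intro J p a b q
    simp only [vals_cons, lHom]
    rw [show onList (lTilde K A B) (vals (p ++ a :: b :: q)) = _ from lTilde_swapSymm p a b q]
    exact lTilde_zsmul [] _ _ _
  · intro I p a b q
    exact lTilde_swapSymm (lHom I :: p) a b q

/-- Entries carry their degree along with their value. Since `x`, `y` and `z` have the same degree,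
the Koszul signs agree and additivity passes through the recursion. -/
theorem unsh_add_entry {H M : Type*} [AddCommGroup M] {deg : H → ℤ} {x y z : H}
    (hx : deg x = deg z) (hy : deg y = deg z) {φ : List H → List H → M}
    (h1 : ∀ p q J, φ (p ++ z :: q) J = φ (p ++ x :: q) J + φ (p ++ y :: q) J)
    (h2 : ∀ I p q, φ I (p ++ z :: q) = φ I (p ++ x :: q) + φ I (p ++ y :: q))
    (p q : List H) :
    unsh deg (p ++ z :: q) φ = unsh deg (p ++ x :: q) φ + unsh deg (p ++ y :: q) φ := by
  induction p generalizing φ with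
  | nil =>
    simp only [List.nil_append, unsh, hx, hy, ← unsh_add]
    refine unsh_congr fun I J _ _ _ => ?_
    have e1 := h1 [] I J
    have e2 := h2 I [] J
    simp only [List.nil_append] at e1 e2
    rw [e1, e2, smul_add]
    abel
  | cons w p ih =>
    simp only [List.cons_append, unsh]
    rw [ih (fun p q J => h1 (w :: p) q J) (fun I p q => h2 _ p q), ih]
    · abel
    · intro p q J
      simp only [dsum_append, dsum_cons, hx, hy]
      rw [h1, smul_add]
    · intro I p q
      have := h2 I (w :: p) q
      simp only [List.cons_append] at this
      rw [this, smul_add]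

theorem jacobiator_add (p q : List (HTotal K A B)) (d : ℤ) (x y : grading K A B d) :
    jacobiator (p ++ ⟨d, x + y⟩ :: q) =
      jacobiator (p ++ ⟨d, x⟩ :: q) + jacobiator (p ++ ⟨d, y⟩ :: q) := by
  refine unsh_add_entry (M := Total K A B) (deg := Sigma.fst) (x := ⟨d, x⟩) (y := ⟨d, y⟩)
    (z := ⟨d, x + y⟩) rfl rfl ?_ ?_ p q
  · intro p q J
    simp only [vals_cons, lHom, vals_append, Submodule.coe_add]
    rw [lTilde_add]
    exact lTilde_add [] _ _ _
  · intro I p q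
    simp only [vals_cons, vals_append, Submodule.coe_add]
    exact lTilde_add (_ :: _) _ _ _

/-- An element of `𝒬[1]`. -/
def IsQ (h : HTotal K A B) : Prop := h.2.1.2 = 0

/-- An element of `𝔞`. -/
def IsA (h : HTotal K A B) : Prop := h.2.1.1 = 0

theorem lTilde_vals_of_isA {xs : List (HTotal K A B)} (h : ∀ x ∈ xs, IsA x) :
    onList (lTilde K A B) (vals xs) = 0 := by
  refine lTilde_abelian fun y hy => ?_
  obtain ⟨x, hx, rfl⟩ := List.mem_map.1 hy
  exact h x hx

theorem lHom_isA_of_cons {x : HTotal K A B} {xs : List (HTotal K A B)}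
    (hxs : ∀ y ∈ xs, IsA y) : IsA (lHom (x :: xs)) := by
  have := lTilde_mixed x.2.1 (xs := vals xs) (by
    intro y hy
    obtain ⟨z, hz, rfl⟩ := List.mem_map.1 hy
    exact hxs z hz)
  exact congrArg Prod.fst this

/-- The Jacobi identity for two elements of `𝒬[1]`. -/
theorem jacobiator_two {a b : HTotal K A B} (ha : IsQ a) (hb : IsQ b)
    {fs : List (HTotal K A B)} (hfs : ∀ x ∈ fs, IsA x) : jacobiator (a :: b :: fs) = 0 := by
  have hmix : ∀ {x : HTotal K A B} {I : List (HTotal K A B)}, (∀ y ∈ I, IsA y) →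
      onList (lTilde K A B) (vals (x :: I)) =
        (0, projP K A B (iterBracket (I.map inclSnd) x.2.1.1)) := by
    intro x I hI
    have := lTilde_mixed x.2.1 (xs := vals I) (by
      intro y hy
      obtain ⟨z, hz, rfl⟩ := List.mem_map.1 hy
      exact hI z hz)
    rw [map_snd_vals] at this
    rw [vals_cons, this]
    simp only [snds, List.map_map]
    rfl
  set m := a.1 + 1 with hm
  set n := b.1 + 1 with hn
  -- `U x y I J` is the cross term: `y` is bracketed with `I` and projected to `𝔞`, and the result
  -- is bracketed into `x`, followed by `J`.
  let U : HTotal K A B → HTotal K A B → List (HTotal K A B) → List (HTotal K A B) → Abel K A B :=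
    fun x y I J => projP K A B (iterBracket (J.map inclSnd) (bracket K (A × B) x.2.1.1
      (incl K A B (projP K A B (iterBracket (I.map inclSnd) y.2.1.1)))))
  have hcross : ∀ {x y : HTotal K A B} {I J : List (HTotal K A B)},
      (∀ z ∈ I, IsA z) → (∀ z ∈ J, IsA z) →
      onList (lTilde K A B) (vals (lHom (x :: I) :: y :: J)) =
        sg ((x.1 + dsum Sigma.fst I + 1) * y.1) • ((0, U y x I J) : Total K A B) := by
    intro x y I J hI hJ
    have h1 := lTilde_swapSymm [] (lHom (x :: I)) y J
    simp only [List.nil_append] at h1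
    rw [h1, hmix (by
      intro z hz
      rcases List.mem_cons.1 hz with rfl | hz
      · exact lHom_isA_of_cons hI
      · exact hJ z hz), List.map_cons, iterBracket_cons]
    have h2 : inclSnd (lHom (x :: I)) =
        incl K A B (projP K A B (iterBracket (I.map inclSnd) x.2.1.1)) :=
      congrArg (fun t : Total K A B => incl K A B t.2) (hmix hI)
    rw [h2]
    simp only [lHom, dsum_cons]
    rfl
  have hI : ∀ {I J : List (HTotal K A B)}, (I ++ J).Perm fs →
      (∀ x ∈ I, IsA x) ∧ ∀ x ∈ J, IsA x := fun h =>
    ⟨fun x hx => hfs x (h.subset (List.mem_append_left _ hx)),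
      fun x hx => hfs x (h.subset (List.mem_append_right _ hx))⟩
  -- With `a` and `b` both inside, a further inner entry kills the operation, so only `I = []`
  -- contributes. With one of them inside, the terms are the cross terms `U`. With both outside, the
  -- inner operation acts on `𝔞` alone and vanishes. What remains is `projP_iterBracket_bracket`.
  simp only [jacobiator, unsh]
  rw [unsh_eq_left, show unsh Sigma.fst fs (fun I J => sg (b.1 * dsum Sigma.fst I) •
      onList (lTilde K A B) (vals (lHom (a :: I) :: b :: J))) =
      sg (b.1 * m) • unsh Sigma.fst fs (fun I J => ((0, U b a I J) : Total K A B)) by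
    rw [← unsh_zsmul]
    refine unsh_congr fun I J h _ _ => ?_
    rw [hcross (hI h).1 (hI h).2, smul_smul, ← sg_add]
    congr 1
    apply sg_congr
    rw [hm]
    push_cast
    generalize (a.1 : ZMod 2) = x
    generalize (b.1 : ZMod 2) = y
    generalize (dsum Sigma.fst I : ZMod 2) = z
    revert x y z; decide,
    show unsh Sigma.fst fs (fun I J => sg (a.1 * dsum Sigma.fst (b :: I)) •
      onList (lTilde K A B) (vals (lHom (b :: I) :: a :: J))) =
      sg a.1 • unsh Sigma.fst fs (fun I J => ((0, U a b I J) : Total K A B)) by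
    rw [← unsh_zsmul]
    refine unsh_congr fun I J h _ _ => ?_
    rw [hcross (hI h).1 (hI h).2, smul_smul, ← sg_add, dsum_cons]
    congr 1
    apply sg_congr
    push_cast
    generalize (a.1 : ZMod 2) = x
    generalize (b.1 : ZMod 2) = y
    generalize (dsum Sigma.fst I : ZMod 2) = z
    revert x y z; decide,
    show unsh Sigma.fst fs (fun I J => sg (b.1 * dsum Sigma.fst I) •
      sg (a.1 * dsum Sigma.fst I) • onList (lTilde K A B) (vals (lHom I :: a :: b :: J))) = 0 by
    refine unsh_eq_zero fun I J h => ?_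
    have : onList (lTilde K A B) (vals (lHom I :: a :: b :: J)) = 0 := by
      rw [vals_cons, lHom]
      simp only [lTilde_vals_of_isA (hI h).1]
      exact lTilde_zero [] _
    rw [this, smul_zero, smul_zero]]
  · have hab := lTilde_binary (a := a) (b := b) ha hb
    have hv : ((lHom [a, b]).2.1.1 : HmSum K (A × B) (A × B)) =
        sg m • bracket K (A × B) a.2.1.1 b.2.1.1 :=
      congrArg (fun t : Total K A B => (t.1 : HmSum K (A × B) (A × B))) hab
    have key : projP K A B (iterBracket (fs.map inclSnd) (bracket K (A × B) a.2.1.1 b.2.1.1)) =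
        unsh Sigma.fst fs (U a b) - sg (m * n) • unsh Sigma.fst fs (U b a) :=
      projP_iterBracket_bracket (e := fun x : HTotal K A B => x.2.1.2) snd_mem
        (fst_mem a) (fst_mem b) fs
    have hinr : ∀ x y, unsh Sigma.fst fs (fun I J => ((0, U x y I J) : Total K A B)) =
        (0, unsh Sigma.fst fs (U x y)) := fun x y =>
      unsh_map (LinearMap.inr K (quasi K A B) (Abel K A B)) fs (U x y)
    rw [hmix hfs, hv, map_zsmul, map_zsmul, key, hinr, hinr]
    refine Prod.ext (by simp) ?_
    simp only [Prod.snd_add, Prod.smul_snd, Prod.snd_zero, hm, hn, mul_add, add_mul, sg_add,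
      mul_one, one_mul, sg_one, mul_comm b.1 a.1]
    rcases sg_eq_or (a.1 * b.1) with h1 | h1 <;> rcases sg_eq_or a.1 with h2 | h2 <;>
      rcases sg_eq_or b.1 with h3 | h3 <;> rw [h1, h2, h3] <;> module
  · intro z I J
    have : onList (lTilde K A B) (vals (a :: b :: z :: I)) = 0 :=
      lTilde_vanish _ _ ha hb (by simp)
    rw [vals_cons, lHom]
    simp only [this]
    exact lTilde_zero [] _

/-- The Jacobi identity for three elements of `𝒬[1]`. -/
theorem jacobiator_three {a b c : HTotal K A B} (ha : IsQ a) (hb : IsQ b) (hc : IsQ c) :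
    jacobiator [a, b, c] = 0 := by
  have h0 : ∀ J : List (HTotal K A B), onList (lTilde K A B) (vals (lHom [] :: J)) = 0 := by
    intro J
    have : onList (lTilde K A B) (vals ([] : List (HTotal K A B))) = 0 :=
      lTilde_vals_of_isA (by simp)
    rw [vals_cons, lHom]
    simp only [this]
    exact lTilde_zero [] _
  have h1 : ∀ {x y z : HTotal K A B}, IsQ y → IsQ z →
      onList (lTilde K A B) (vals [lHom [x], y, z]) = 0 := by
    intro x y z hy hz
    refine lTilde_perm (ys := [y, z, lHom [x]]) ?_ (lTilde_vanish _ _ hy hz (by simp))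
    exact (List.perm_append_comm (l₁ := [lHom [x]]) (l₂ := [y, z]))
  have h3 : onList (lTilde K A B) (vals [lHom [a, b, c]]) = 0 := by
    have : onList (lTilde K A B) (vals [a, b, c]) = 0 := lTilde_vanish _ _ ha hb (by simp)
    rw [vals_cons, lHom]
    simp only [this]
    exact lTilde_zero [] _
  have h2 : ∀ {x y z : HTotal K A B}, IsQ x → IsQ y → IsQ z →
      onList (lTilde K A B) (vals [lHom [x, y], z]) =
        (⟨sg (y.1 + 1) • bracket K (A × B) (bracket K (A × B) x.2.1.1 y.2.1.1) z.2.1.1,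
          zsmul_mem (bracket_mem_quasi (bracket_mem_quasi x.2.1.1.2 y.2.1.1.2) z.2.1.1.2) _⟩,
          0) := by
    intro x y z hx hy hz
    have hab := lTilde_binary (a := x) (b := y) hx hy
    have hq : IsQ (lHom [x, y]) := congrArg Prod.snd hab
    have hv : ((lHom [x, y]).2.1.1 : HmSum K (A × B) (A × B)) =
        sg (x.1 + 1) • bracket K (A × B) x.2.1.1 y.2.1.1 :=
      congrArg (fun t : Total K A B => (t.1 : HmSum K (A × B) (A × B))) hab
    rw [show vals [lHom [x, y], z] = [(lHom [x, y]).2.1, z.2.1] from rfl, lTilde_binary hq hz]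
    refine Prod.ext (Subtype.ext ?_) rfl
    simp only [hv, map_zsmul, LinearMap.smul_apply, smul_smul, ← sg_add]
    congr 1
    apply sg_congr
    simp only [lHom, dsum_cons, dsum_nil]
    push_cast
    generalize (x.1 : ZMod 2) = s
    generalize (y.1 : ZMod 2) = t
    revert s t; decide
  -- Only the three splittings with two inner entries survive; they give the double brackets of the
  -- graded Jacobi identity.
  simp only [jacobiator, unsh, h0, h1 hb hc, h1 ha hc, h1 ha hb, h3, h2 ha hb hc, h2 ha hc hb,
    h2 hb hc ha, smul_zero, add_zero, zero_add]
  refine Prod.ext (Subtype.ext ?_) (by simp)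
  have j1 := bracket_jacobi (fst_mem a) (fst_mem b) (fst_mem c)
  have j2 := bracket_antisymm (fst_mem a) (bracket_mem (fst_mem b) (fst_mem c))
  simp only [Prod.fst_add, Prod.smul_fst, Submodule.coe_add, Submodule.coe_zero, Prod.fst_zero,
    Submodule.coe_smul_of_tower]
  rw [j1, j2]
  have eY : sg (b.1 * dsum Sigma.fst [c]) * sg (c.1 + 1) =
      sg (b.1 + 1) * (sg ((b.1 + 1) * (c.1 + 1)) * sg 1) := by
    simp only [← sg_add, dsum_cons, dsum_nil]
    apply sg_congr
    push_cast
    generalize (b.1 : ZMod 2) = s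
    generalize (c.1 : ZMod 2) = t
    revert s t; decide
  have eZ : sg (a.1 * dsum Sigma.fst [b, c]) * sg (c.1 + 1) =
      sg (b.1 + 1) * sg ((a.1 + 1) * (b.1 + 1 + (c.1 + 1))) := by
    simp only [← sg_add, dsum_cons, dsum_nil]
    apply sg_congr
    push_cast
    generalize (a.1 : ZMod 2) = r
    generalize (b.1 : ZMod 2) = s
    generalize (c.1 : ZMod 2) = t
    revert r s t; decide
  rw [smul_smul (sg (b.1 * _)), smul_smul (sg (a.1 * _)), eY, eZ, dsum_nil, mul_zero, sg_zero,
    sg_one]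
  module

theorem exists_perm_of_pure (xs : List (HTotal K A B)) (h : ∀ x ∈ xs, IsQ x ∨ IsA x) :
    ∃ qs fs : List (HTotal K A B), xs.Perm (qs ++ fs) ∧ (∀ x ∈ qs, IsQ x) ∧ (∀ x ∈ fs, IsA x) := by
  induction xs with
  | nil => exact ⟨[], [], by simp⟩
  | cons x xs ih =>
    obtain ⟨qs, fs, h1, h2, h3⟩ := ih fun y hy => h y (List.mem_cons_of_mem _ hy)
    rcases h x List.mem_cons_self with hx | hx
    · exact ⟨x :: qs, fs, h1.cons x, by simpa using ⟨hx, h2⟩, h3⟩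
    · exact ⟨qs, x :: fs, (h1.cons x).trans List.perm_middle.symm, h2, by simpa using ⟨hx, h3⟩⟩

/-- Two elements of `𝒬[1]` among at least three arguments. -/
theorem lTilde_vanish_of_append {qs fs xs : List (HTotal K A B)} (h : xs.Perm (qs ++ fs))
    (hqs : ∀ x ∈ qs, IsQ x) (h2 : 2 ≤ qs.length) (h3 : 3 ≤ xs.length) :
    onList (lTilde K A B) (vals xs) = 0 := by
  refine lTilde_perm h ?_
  rcases qs with _ | ⟨a, _ | ⟨b, qs⟩⟩
  · simp at h2
  · simp at h2
  · refine lTilde_vanish _ _ (hqs a (by simp)) (hqs b (by simp)) ?_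
    intro h0
    have h1 : (vals (qs ++ fs)).length = 0 := congrArg List.length h0
    have h4 := h.length_eq
    rw [length_vals] at h1
    simp only [List.cons_append, List.length_cons] at h4
    omega

theorem lTilde_lHom_of_isA {I : List (HTotal K A B)} (h : ∀ x ∈ I, IsA x)
    (J : List (HTotal K A B)) : onList (lTilde K A B) (vals (lHom I :: J)) = 0 := by
  rw [vals_cons, lHom]
  simp only [lTilde_vals_of_isA h]
  exact lTilde_zero [] _

/-- The Jacobi identity for at least three elements of `𝒬[1]` among at least four arguments. -/
theorem jacobiator_of_three_le {qs fs : List (HTotal K A B)} (hqs : ∀ x ∈ qs, IsQ x)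
    (hfs : ∀ x ∈ fs, IsA x) (h3 : 3 ≤ qs.length) (h4 : 4 ≤ (qs ++ fs).length) :
    jacobiator (qs ++ fs) = 0 := by
  classical
  refine unsh_eq_zero fun I J h => ?_
  have hpure : ∀ x ∈ I ++ J, IsQ x ∨ IsA x := fun x hx => by
    rcases List.mem_append.1 (h.subset hx) with hx | hx
    · exact Or.inl (hqs x hx)
    · exact Or.inr (hfs x hx)
  have hcount : 3 ≤ I.countP (fun x => IsQ x) + J.countP (fun x => IsQ x) := by
    rw [← List.countP_append, h.countP_eq, List.countP_append]
    have : qs.countP (fun x => IsQ x) = qs.length := by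
      rw [List.countP_eq_length]
      simpa using hqs
    omega
  have hlen : 4 ≤ I.length + J.length := by
    rw [← List.length_append, h.length_eq]; exact h4
  have split : ∀ L : List (HTotal K A B),
      L.Perm (L.filter (fun x => IsQ x) ++ L.filter (fun x => ¬ IsQ x)) := fun L => by
    have := List.filter_append_perm (fun x : HTotal K A B => decide (IsQ x)) L
    simpa using this.symm
  have vanish : ∀ L : List (HTotal K A B), 2 ≤ L.countP (fun x => IsQ x) → 3 ≤ L.length →
      onList (lTilde K A B) (vals L) = 0 := fun L h2 h3 =>
    lTilde_vanish_of_append (split L) (fun x hx => by simpa using (List.mem_filter.1 hx).2)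
      (by rwa [← List.countP_eq_length_filter]) h3
  -- With no `𝒬`-entry in `I` the inner operation vanishes. With one, `J` has at least two and the
  -- outer operation vanishes. With at least two among three or more entries the inner operation
  -- vanishes. If `I` is exactly a pair from `𝒬[1]`, its value is again in `𝒬[1]`, `J` has another
  -- such entry, and the outer operation has at least three arguments.
  by_cases c0 : I.countP (fun x => IsQ x) = 0
  · refine lTilde_lHom_of_isA (fun x hx => ?_) J
    rw [List.countP_eq_zero] at c0
    exact (hpure x (List.mem_append_left _ hx)).resolve_left (by simpa using c0 x hx)
  by_cases c1 : I.countP (fun x => IsQ x) = 1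
  · refine vanish _ ?_ ?_
    · rw [List.countP_cons]; omega
    · have := List.countP_le_length (p := fun x : HTotal K A B => decide (IsQ x)) (l := J)
      rw [List.length_cons]; omega
  by_cases hl : 3 ≤ I.length
  · rw [vals_cons, lHom]
    simp only [vanish I (by omega) hl]
    exact lTilde_zero [] _
  · have hle := List.countP_le_length (p := fun x : HTotal K A B => decide (IsQ x)) (l := I)
    obtain ⟨a, b, rfl⟩ := List.length_eq_two.1 (show I.length = 2 by omega)
    have hab : ∀ x ∈ [a, b], IsQ x := by
      have := (List.countP_eq_length (p := fun x : HTotal K A B => decide (IsQ x))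
        (l := [a, b])).1 (by omega)
      simpa using this
    have hq : IsQ (lHom [a, b]) :=
      congrArg Prod.snd (lTilde_binary (hab a (by simp)) (hab b (by simp)))
    refine vanish _ ?_ ?_
    · rw [List.countP_cons_of_pos (by simpa using hq)]
      simp only [List.length_cons, List.length_nil] at hle
      omega
    · simp only [List.length_cons, List.length_nil] at hlen ⊢
      omega

theorem jacobiator_of_append {qs fs : List (HTotal K A B)} (hqs : ∀ x ∈ qs, IsQ x)
    (hfs : ∀ x ∈ fs, IsA x) : jacobiator (qs ++ fs) = 0 := by
  rcases qs with _ | ⟨a, _ | ⟨b, _ | ⟨c, qs⟩⟩⟩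
  · exact unsh_eq_zero fun I J h => lTilde_lHom_of_isA
      (fun x hx => hfs x (h.subset (List.mem_append_left _ hx))) J
  · have hI : ∀ {I J : List (HTotal K A B)}, (I ++ J).Perm fs →
        (∀ x ∈ I, IsA x) ∧ ∀ x ∈ J, IsA x := fun h =>
      ⟨fun x hx => hfs x (h.subset (List.mem_append_left _ hx)),
        fun x hx => hfs x (h.subset (List.mem_append_right _ hx))⟩
    simp only [List.cons_append, List.nil_append, jacobiator, unsh]
    rw [unsh_eq_zero, unsh_eq_zero, add_zero]
    · intro I J h
      rw [lTilde_lHom_of_isA (hI h).1, smul_zero]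
    · intro I J h
      refine lTilde_vals_of_isA fun x hx => ?_
      rcases List.mem_cons.1 hx with rfl | hx
      · exact lHom_isA_of_cons (hI h).1
      · exact (hI h).2 x hx
  · exact jacobiator_two (hqs a (by simp)) (hqs b (by simp)) hfs
  · by_cases h : (a :: b :: c :: qs ++ fs).length ≤ 3
    · obtain ⟨rfl, rfl⟩ : qs = [] ∧ fs = [] := by
        simp only [List.cons_append, List.length_cons, List.length_append] at h
        exact ⟨List.length_eq_zero_iff.1 (by omega), List.length_eq_zero_iff.1 (by omega)⟩
      exact jacobiator_three (hqs a (by simp)) (hqs b (by simp)) (hqs c (by simp))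
    · exact jacobiator_of_three_le hqs hfs (by simp) (by omega)

/-- Additivity splits each entry into its `𝒬[1]`- and its `𝔞`-part, with `ps` collecting the entries
already split. Symmetry then sorts the pure entries. -/
theorem jacobiator_eq_zero (xs : List (HTotal K A B)) : jacobiator xs = 0 := by
  have key : ∀ (xs ps : List (HTotal K A B)), (∀ x ∈ ps, IsQ x ∨ IsA x) →
      jacobiator (ps ++ xs) = 0 := by
    intro xs
    induction xs with
    | nil =>
      intro ps h
      obtain ⟨qs, fs, h1, h2, h3⟩ := exists_perm_of_pure ps h
      rw [List.append_nil]
      exact jacobiator_perm h1 (jacobiator_of_append h2 h3)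
    | cons x xs ih =>
      intro ps h
      have hx1 : ((x.2.1.1, 0) : Total K A B) ∈ grading K A B x.1 :=
        ⟨x.2.2.1, Submodule.zero_mem _⟩
      have hx2 : ((0, x.2.1.2) : Total K A B) ∈ grading K A B x.1 :=
        ⟨Submodule.zero_mem _, x.2.2.2⟩
      have hx : x = ⟨x.1, ⟨_, hx1⟩ + ⟨_, hx2⟩⟩ := by
        refine Sigma.ext rfl (heq_of_eq (Subtype.ext ?_))
        simp
      rw [hx, jacobiator_add]
      have e1 := ih (ps ++ [⟨x.1, ⟨_, hx1⟩⟩]) (by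
        intro y hy
        rcases List.mem_append.1 hy with hy | hy
        · exact h y hy
        · rw [List.mem_singleton.1 hy]; exact Or.inl rfl)
      have e2 := ih (ps ++ [⟨x.1, ⟨_, hx2⟩⟩]) (by
        intro y hy
        rcases List.mem_append.1 hy with hy | hy
        · exact h y hy
        · rw [List.mem_singleton.1 hy]; exact Or.inr rfl)
      rw [List.append_assoc] at e1 e2
      exact (congrArg₂ (· + ·) e1 e2).trans (add_zero 0)
  exact key xs [] (by simp)

theorem listLInf_lTilde : ListLInf (grading K A B) (onList (lTilde K A B)) where
  add := lTilde_add
  smul := lTilde_smul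
  degree := lTilde_mem
  symm := lTilde_swapSymm
  jacobi := jacobiator_eq_zero

end Jacobi


/-! ### The grading and the filtration of `𝒬[1] ⊕ 𝔞` -/

section Vanishing

variable {K V : Type*} [Field K] [AddCommGroup V] [Module K V]

/-- The filtration that vanishes in degree `d` from the index `d + 3` on. -/
def degreeFiltration (𝒢 : ℤ → Submodule K V) (k : ℕ) (d : ℤ) : Submodule K V :=
  if (k : ℤ) ≤ d + 2 then 𝒢 d else ⊥

theorem degreeFiltration_le (𝒢 : ℤ → Submodule K V) (k : ℕ) (d : ℤ) :
    degreeFiltration 𝒢 (k + 1) d ≤ degreeFiltration 𝒢 k d := by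
  unfold degreeFiltration
  split_ifs with h1 h2
  · exact le_rfl
  · push_cast at h1; omega
  · exact bot_le
  · exact le_rfl

/-- Operations on a graded space that is bounded below are weakly filtered if, in each degree, only
finitely many of them can take non-zero values. -/
theorem isWeaklyFiltered_of_vanish {𝒢 : ℤ → Submodule K V} {l : ∀ k : ℕ, (Fin k → V) → V}
    (hbot : ∀ d, d < -1 → 𝒢 d = ⊥)
    (hdeg : ∀ (k : ℕ) (d : Fin k → ℤ) (x : Fin k → V), (∀ i, x i ∈ 𝒢 (d i)) →
      l k x ∈ 𝒢 ((∑ i, d i) + 1))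
    (hl : ∀ k : ℕ, 3 ≤ k → ∀ (d : Fin k → ℤ) (x : Fin k → V), (∀ i, x i ∈ 𝒢 (d i)) →
      (∑ i, d i) + 3 < k → l k x = 0) : IsWeaklyFiltered 𝒢 l := by
  refine ⟨degreeFiltration 𝒢, 3, by omega, fun d => ?_, fun k _ => degreeFiltration_le 𝒢 k,
    ?_, ?_, ?_⟩
  -- The space lives in degrees `d ≥ -1`, which is exactly where `1 ≤ d + 2`; so the offset `2`
  -- makes `Fil 1` everything.
  · unfold degreeFiltration
    split_ifs with h
    · rfl
    · exact (hbot d (by push_cast at h; omega)).symm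
  · intro d x hx
    -- From this index on the filtration is zero in degree `d`. Hence the intersection is zero, and
    -- below, compatible sequences become stationary, with their stationary value as limit.
    have := hx (max 1 (d + 3).toNat) (by omega)
    rw [degreeFiltration, if_neg (by omega)] at this
    exact this
  · intro d u hu hc
    have const : ∀ k, max 1 (d + 3).toNat ≤ k → u k = u (max 1 (d + 3).toNat) := by
      intro k hk
      induction k, hk using Nat.le_induction with
      | base => rfl
      | succ k hk ih =>
        have := hc k (by omega)
        rw [degreeFiltration, if_neg (by omega), Submodule.mem_bot, sub_eq_zero] at this
        rw [this, ih]
    have key : ∀ m k, 1 ≤ k → u (k + m) - u k ∈ degreeFiltration 𝒢 k d := by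
      intro m
      induction m with
      | zero => intro k _; simp
      | succ m ih =>
        intro k hk
        have h1 := degreeFiltration_le 𝒢 k d (ih (k + 1) (by omega))
        have h2 := Submodule.add_mem _ h1 (hc k hk)
        rwa [sub_add_sub_cancel, show k + 1 + m = k + (m + 1) by ring] at h2
    refine ⟨u (max 1 (d + 3).toNat), hu _ (by omega), fun k hk => ?_⟩
    rw [← const (k + max 1 (d + 3).toNat) (by omega)]
    exact key _ k hk
  · intro k hk d x hx
    unfold degreeFiltration
    split_ifs with h
    · exact hdeg k d x hx
    · rw [hl k hk d x hx (by omega)]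
      exact Submodule.zero_mem _

/-- The spaces `C d` contain all pieces of other degrees and can be tested coefficientwise, which
avoids handling the supremum of those pieces. -/
theorem isInternal_of_compl {𝒢 : ℤ → Submodule K V} (C : ℤ → Submodule K V)
    (hle : ∀ {d e}, e ≠ d → 𝒢 e ≤ C d) (hzero : ∀ {d x}, x ∈ 𝒢 d → x ∈ C d → x = 0)
    (htop : ∀ x, x ∈ ⨆ d, 𝒢 d) : DirectSum.IsInternal 𝒢 :=
  DirectSum.isInternal_submodule_of_iSupIndep_of_iSup_eq_top
    (iSupIndep_def.2 fun _ => Disjoint.mono_right (iSup₂_le fun _ he => hle he)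
      (Submodule.disjoint_def.2 fun _ => hzero)) (eq_top_iff.2 fun x _ => htop x)

end Vanishing

/-! ### The internal grading, vanishing of long operations, and the untwisted `L_∞`-structure -/

section Filtration

variable {K A B : Type*} [Field K] [AddCommGroup A] [Module K A] [AddCommGroup B] [Module K B]

/-- The elements of `𝒬[1] ⊕ 𝔞` without component of degree `d`. -/
def gradingCompl (d : ℤ) : Submodule K (Total K A B) where
  carrier := {x | ∀ n : ℕ, ((n : ℤ) = d + 1 → (x.1 : HmSum K (A × B) (A × B)) n = 0) ∧
    ((n : ℤ) = d → x.2 n = 0)}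
  add_mem' hx hy n := by
    constructor
    · intro h
      rw [Prod.fst_add, Submodule.coe_add, DirectSum.add_apply, (hx n).1 h, (hy n).1 h, add_zero]
    · intro h
      rw [Prod.snd_add, DirectSum.add_apply, (hx n).2 h, (hy n).2 h, add_zero]
  zero_mem' n := ⟨fun _ => rfl, fun _ => rfl⟩
  smul_mem' c x hx n := by
    constructor
    · intro h
      rw [Prod.smul_fst, Submodule.coe_smul, DirectSum.smul_apply, (hx n).1 h, smul_zero]
    · intro h
      rw [Prod.smul_snd, DirectSum.smul_apply, (hx n).2 h, smul_zero]

theorem grading_le_gradingCompl {d e : ℤ} (he : e ≠ d) :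
    grading K A B e ≤ gradingCompl d := by
  refine fun x hx n => ⟨fun hn => hx.1 n ?_, fun hn => hx.2 n ?_⟩
  · intro h; exact he (by omega)
  · intro h; exact he (by omega)

theorem eq_zero_of_mem_gradingCompl {d : ℤ} {x : Total K A B} (hx : x ∈ grading K A B d)
    (hx' : x ∈ gradingCompl d) : x = 0 := by
  refine Prod.ext (Subtype.ext (DFinsupp.ext fun n => ?_)) (DFinsupp.ext fun n => ?_)
  · by_cases hn : (n : ℤ) = d + 1
    · exact (hx' n).1 hn
    · exact hx.1 n hn
  · by_cases hn : (n : ℤ) = d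
    · exact (hx' n).2 hn
    · exact hx.2 n hn

theorem mem_iSup_grading (x : Total K A B) : x ∈ ⨆ d, grading K A B d := by
  classical
  have e : x = ∑ n ∈ DFinsupp.support (x.1 : HmSum K (A × B) (A × B)),
        ((⟨DirectSum.lof K ℕ (Hm K (A × B) (A × B)) n (x.1.1 n),
          lof_mem_quasi (x.1.2 n)⟩, 0) : Total K A B) +
      ∑ n ∈ DFinsupp.support x.2,
        ((0, DirectSum.lof K ℕ (Hm K A B) n (x.2 n)) : Total K A B) := by
    refine Prod.ext (Subtype.ext ?_) ?_
    · rw [Prod.fst_add, Prod.fst_sum, Prod.fst_sum, Finset.sum_const_zero, add_zero,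
        AddSubmonoidClass.coe_finsetSum]
      exact eq_sum_lof _
    · rw [Prod.snd_add, Prod.snd_sum, Prod.snd_sum, Finset.sum_const_zero, zero_add]
      exact (DirectSum.sum_support_of x.2).symm
  rw [e]
  refine Submodule.add_mem _ (Submodule.sum_mem _ fun n _ => ?_)
    (Submodule.sum_mem _ fun n _ => ?_)
  · exact Submodule.mem_iSup_of_mem ((n : ℤ) - 1)
      ⟨lof_mem_degPart (by ring) _, Submodule.zero_mem _⟩
  · exact Submodule.mem_iSup_of_mem (n : ℤ)
      ⟨Submodule.zero_mem _, lof_mem_degPart rfl _⟩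

theorem grading_isInternal : DirectSum.IsInternal (grading K A B) := by
  have h := @isInternal_of_compl K (Total K A B) _ _ _ (grading K A B)
  have h' := h (gradingCompl (K := K) (A := A) (B := B))
  have h'' := h' (fun he => grading_le_gradingCompl he)
    (fun hx hx' => eq_zero_of_mem_gradingCompl hx hx') mem_iSup_grading
  exact h''

theorem grading_eq_bot {d : ℤ} (hd : d < -1) : grading K A B d = ⊥ := by
  refine (Submodule.eq_bot_iff _).2 fun x hx => ?_
  refine Prod.ext (Subtype.ext (DFinsupp.ext fun n => hx.1 n ?_))
    (DFinsupp.ext fun n => hx.2 n ?_) <;> omega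

theorem mixedTerm_eq_zero_of_eq_zero {k : ℕ} {i j : Fin k} (hij : j ≠ i)
    (F : HmSum K (A × B) (A × B)) {f : Fin k → Abel K A B} (h : f j = 0) :
    mixedTerm i F f = 0 := by
  rw [mixedTerm_eq]
  refine mixPair_eq_zero_of_mem ?_ F
  rcases lt_or_gt_of_ne hij with hlt | hgt
  · refine Or.inl (List.mem_take_iff_getElem.2 ⟨j, ?_, by simpa using h⟩)
    rw [List.length_ofFn]
    exact lt_min hlt j.2
  · refine Or.inr (List.mem_drop_iff_getElem.2 ⟨j - (i + 1), ?_, ?_⟩)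
    · rw [List.length_ofFn]
      have := Fin.lt_def.1 hgt
      omega
    · have e : (i : ℕ) + 1 + (j - (i + 1)) = j := by
        have := Fin.lt_def.1 hgt
        omega
      simpa [e] using h

theorem mixedTerm_eq_zero_of_degree [CharZero K] {k : ℕ} (i : Fin k)
    {F : HmSum K (A × B) (A × B)} (hF : F ∈ quasi K A B) (f : Fin k → Abel K A B)
    (h : ∀ n, F n ≠ 0 → n + 2 < k) : mixedTerm i F f = 0 := by
  rw [mixedTerm_eq]
  refine mixPair_eq_zero_of_length hF fun n hn => ?_
  have := h n hn
  have := i.2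
  simp only [List.length_take, List.length_drop, List.length_ofFn]
  omega

theorem quasiTerm_eq_zero {k : ℕ} (hk : 3 ≤ k) (x : Fin k → Total K A B) : quasiTerm k x = 0 := by
  obtain ⟨k, rfl⟩ := Nat.exists_eq_add_of_le' hk
  rfl

theorem lTilde_eq_zero {k : ℕ} {x : Fin k → Total K A B} (h1 : quasiTerm k x = 0)
    (h2 : ∀ i, mixedTerm i (x i).1 (fun j => (x j).2) = 0) : lTilde K A B k x = 0 :=
  Prod.ext h1 (show ∑ i : Fin k, mixedTerm i (x i).1 (fun j => (x j).2) = 0 from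
    Finset.sum_eq_zero fun i _ => h2 i)

theorem lTilde_eventuallyZero [CharZero K] : EventuallyZero (onList (lTilde K A B)) := by
  classical
  intro S hS
  have hfin : (⋃ x ∈ S, {n : ℕ | (x.1 : HmSum K (A × B) (A × B)) n ≠ 0}).Finite := by
    refine hS.biUnion fun x _ => ?_
    refine (DFinsupp.support (x.1 : HmSum K (A × B) (A × B))).finite_toSet.subset fun n hn => ?_
    simpa using hn
  obtain ⟨N, hN⟩ := hfin.bddAbove
  -- All `𝒬`-components in `S` have degree at most `N`. The weight argument needs more than `N + 2`
  -- entries, one of which supplies the outer map.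
  refine ⟨N + 3, fun xs hxs hlen => ?_⟩
  refine lTilde_eq_zero (quasiTerm_eq_zero (by omega) _) fun i => ?_
  refine mixedTerm_eq_zero_of_degree i (xs.get i).1.2 _ fun n hn => ?_
  have : n ≤ N := hN (Set.mem_biUnion (hxs _ (List.get_mem xs i)) hn)
  omega

theorem lTilde_isLInfinity : IsLInfinity (grading K A B) (lTilde K A B) where
  toIsCurvedLInfinity := listLInf_lTilde.isCurvedLInfinity grading_isInternal
  flat _ := lTilde_eq_zero rfl fun i => i.elim0

theorem lTilde_isVoronov : IsVoronov K A B (lTilde K A B) where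
  mixed r F f := by
    rw [← onList_ofFn (lTilde K A B), List.ofFn_cons, lTilde_mixed]
    · simp [List.map_ofFn, Function.comp_def]
    · intro y hy
      obtain ⟨j, rfl⟩ := List.mem_ofFn.1 hy
      rfl
  binary n F G hF := by
    rw [← onList_ofFn (lTilde K A B)]
    refine ⟨?_, snd_lTilde_two _ _ _ rfl rfl⟩
    change bracket K (A × B) (parity K (A × B) (A × B) F) G = _
    rw [parity_of_mem hF, map_zsmul, LinearMap.smul_apply, neg_one_pow_smul_hmSum]
  abelian k f := by
    rw [← onList_ofFn (lTilde K A B)]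
    refine lTilde_abelian fun y hy => ?_
    obtain ⟨j, rfl⟩ := List.mem_ofFn.1 hy
    rfl
  vanish k x i j hk hij hi hj := by
    refine lTilde_eq_zero (quasiTerm_eq_zero hk _) fun t => ?_
    by_cases h : i = t
    · exact mixedTerm_eq_zero_of_eq_zero (j := j) (fun e => hij (h.trans e.symm)) _ hj
    · exact mixedTerm_eq_zero_of_eq_zero h _ hi

/-- An `𝔞`-component in negative degree is zero. If all the other degrees are non-negative, the
outer map has degree `d i + 1 ≤ ∑ d + 1`, too small for a non-zero bracket with `k - 1` elements of
`𝔞`. -/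
theorem lTilde_eq_zero_of_lt [CharZero K] {k : ℕ} (hk : 3 ≤ k) {d : Fin k → ℤ}
    {x : Fin k → Total K A B} (hx : ∀ i, x i ∈ grading K A B (d i))
    (h : (∑ i, d i) + 3 < k) : lTilde K A B k x = 0 := by
  classical
  refine lTilde_eq_zero (quasiTerm_eq_zero hk _) fun i => ?_
  by_cases hd : ∃ j, j ≠ i ∧ d j < 0
  · obtain ⟨j, hj, hneg⟩ := hd
    refine mixedTerm_eq_zero_of_eq_zero hj _ (DFinsupp.ext fun n => (hx j).2 n ?_)
    omega
  · push Not at hd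
    refine mixedTerm_eq_zero_of_degree i (x i).1.2 _ fun n hn => ?_
    have hn : (n : ℤ) = d i + 1 := by
      by_contra hne
      exact hn ((hx i).1 n hne)
    have hsum : d i ≤ ∑ j, d j := by
      rw [← Finset.add_sum_erase _ _ (Finset.mem_univ i)]
      have : 0 ≤ ∑ j ∈ Finset.univ.erase i, d j :=
        Finset.sum_nonneg fun j hj => hd j (Finset.ne_of_mem_erase hj)
      omega
    omega

theorem lTilde_isWeaklyFiltered [CharZero K] :
    IsWeaklyFiltered (grading K A B) (lTilde K A B) :=
  isWeaklyFiltered_of_vanish (fun _ => grading_eq_bot) lTilde_isLInfinity.degree_one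
    fun _ hk _ _ hx h => lTilde_eq_zero_of_lt hk hx h

end Filtration


/-! ### The elements of degree `0` -/

section DegreeZero

variable {K A B : Type*} [Field K] [AddCommGroup A] [Module K A] [AddCommGroup B] [Module K B]

/-- The multiplication with the components `T`, as an element of `Hom((A ⊕ B)^{⊗ 2}, A ⊕ B)`. -/
def omegaMap (T : Ops K A B) : Hm K (A × B) (A × B) 1 :=
  ofBilin T.thetaTilde + ofBilin T.muTilde + ofBilin T.nuTilde

theorem omegaMap_apply (T : Ops K A B) (v : Fin 2 → A × B) :
    omegaMap T v = T.mul (v 0) (v 1) := by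
  change T.thetaTilde (v 0) (v 1) + T.muTilde (v 0) (v 1) + T.nuTilde (v 0) (v 1) = _
  refine Prod.ext ?_ ?_
  · simp only [Ops.thetaTilde, Ops.muTilde, Ops.nuTilde, Ops.mul, LinearMap.mk₂_apply,
      Prod.fst_add]
    abel
  · simp only [Ops.thetaTilde, Ops.muTilde, Ops.nuTilde, Ops.mul, LinearMap.mk₂_apply,
      Prod.snd_add]
    abel

theorem lof_injective {E F : Type*} [AddCommGroup E] [Module K E] [AddCommGroup F] [Module K F]
    (n : ℕ) : Function.Injective (DirectSum.lof K ℕ (Hm K E F) n) :=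
  DirectSum.of_injective n

theorem Ops.ext_mul {T S : Ops K A B} (h : ∀ p q, T.mul p q = S.mul p q) : T = S := by
  have h1 : ∀ p q, (T.mul p q).1 = (S.mul p q).1 := fun p q => congrArg Prod.fst (h p q)
  have h2 : ∀ p q, (T.mul p q).2 = (S.mul p q).2 := fun p q => congrArg Prod.snd (h p q)
  obtain ⟨_, _, _, _, _, _, _⟩ := T
  obtain ⟨_, _, _, _, _, _, _⟩ := S
  simp only [Ops.mul] at h1 h2
  congr 1
  · refine LinearMap.ext₂ fun a b => ?_
    simpa using h1 (a, 0) (b, 0)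
  · refine LinearMap.ext₂ fun x y => ?_
    simpa using h2 (0, x) (0, y)
  · refine LinearMap.ext₂ fun a y => ?_
    simpa using h2 (a, 0) (0, y)
  · refine LinearMap.ext₂ fun x b => ?_
    simpa using h2 (0, x) (b, 0)
  · refine LinearMap.ext₂ fun x b => ?_
    simpa using h1 (0, x) (b, 0)
  · refine LinearMap.ext₂ fun a y => ?_
    simpa using h1 (a, 0) (0, y)
  · refine LinearMap.ext₂ fun a b => ?_
    simpa using h2 (a, 0) (b, 0)

theorem update_pair_zero {E : Type*} (p q x : E) :
    Function.update (![p, q] : Fin (1 + 1) → E) 0 x = ![x, q] := by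
  funext i
  fin_cases i <;> rfl

theorem update_pair_one {E : Type*} (p q x : E) :
    Function.update (![p, q] : Fin (1 + 1) → E) 1 x = ![p, x] := by
  funext i
  fin_cases i <;> rfl

/-- An element of `Hom(E^{⊗ 2}, E)` as a bilinear map. -/
def toBilin {E : Type*} [AddCommGroup E] [Module K E] (f : Hm K E E 1) : E →ₗ[K] E →ₗ[K] E :=
  LinearMap.mk₂ K (fun p q => f ![p, q])
    (fun p p' q => by
      have := f.map_update_add ![p, q] 0 p p'
      rwa [update_pair_zero, update_pair_zero, update_pair_zero] at this)
    (fun c p q => by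
      have := f.map_update_smul ![p, q] 0 c p
      rwa [update_pair_zero, update_pair_zero] at this)
    (fun p q q' => by
      have := f.map_update_add ![p, q] 1 q q'
      rwa [update_pair_one, update_pair_one, update_pair_one] at this)
    (fun c p q => by
      have := f.map_update_smul ![p, q] 1 c q
      rwa [update_pair_one, update_pair_one] at this)

/-- The components of a bilinear map on `A ⊕ B`, except for the component from `B ⊗ B` to `A`. -/
def opsOf (m : (A × B) →ₗ[K] (A × B) →ₗ[K] (A × B)) : Ops K A B where
  mu := (m.compl₁₂ (LinearMap.inl K A B) (LinearMap.inl K A B)).compr₂ (LinearMap.fst K A B)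
  nu := (m.compl₁₂ (LinearMap.inr K A B) (LinearMap.inr K A B)).compr₂ (LinearMap.snd K A B)
  actL := (m.compl₁₂ (LinearMap.inl K A B) (LinearMap.inr K A B)).compr₂ (LinearMap.snd K A B)
  actR := (m.compl₁₂ (LinearMap.inr K A B) (LinearMap.inl K A B)).compr₂ (LinearMap.snd K A B)
  harL := (m.compl₁₂ (LinearMap.inr K A B) (LinearMap.inl K A B)).compr₂ (LinearMap.fst K A B)
  harR := (m.compl₁₂ (LinearMap.inl K A B) (LinearMap.inr K A B)).compr₂ (LinearMap.fst K A B)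
  theta := (m.compl₁₂ (LinearMap.inl K A B) (LinearMap.inl K A B)).compr₂ (LinearMap.snd K A B)

/-- A bilinear map on `A ⊕ B` has eight components; the seven maps in `Ops` omit the one from `B ⊗
B` to `A`, which is the one excluded in `𝒬_1`. -/
theorem opsOf_mul (m : (A × B) →ₗ[K] (A × B) →ₗ[K] (A × B))
    (hm : ∀ x y : B, (m (0, x) (0, y)).1 = 0) (p q : A × B) : (opsOf m).mul p q = m p q := by
  have hp : ∀ p : A × B, p = LinearMap.inl K A B p.1 + LinearMap.inr K A B p.2 := fun p => by simp
  have h0 : (m (LinearMap.inr K A B p.2) (LinearMap.inr K A B q.2)).1 = 0 := hm _ _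
  conv_rhs => rw [hp p, hp q]
  simp only [map_add, LinearMap.add_apply]
  refine Prod.ext ?_ ?_
  · simp only [Ops.mul, opsOf, LinearMap.compr₂_apply, LinearMap.compl₁₂_apply,
      LinearMap.fst_apply, Prod.fst_add, h0]
    abel
  · simp only [Ops.mul, opsOf, LinearMap.compr₂_apply, LinearMap.compl₁₂_apply,
      LinearMap.snd_apply, Prod.snd_add]
    abel

theorem omegaMap_surjOn {f : Hm K (A × B) (A × B) 1} (hf : f ∈ quasiPart K A B 1) :
    omegaMap (opsOf (toBilin f)) = f := by
  ext1 v
  rw [omegaMap_apply, opsOf_mul]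
  · change f ![v 0, v 1] = f v
    congr 1
    funext i
    fin_cases i <;> rfl
  · intro x y
    refine (mem_quasiPart_iff f).1 hf ![(0, x), (0, y)] fun i => ?_
    fin_cases i <;> rfl

theorem mcElement_mem (T : Ops K A B) (D : A →ₗ[K] B) : mcElement T D ∈ grading K A B 0 :=
  ⟨lof_mem_degPart rfl _, lof_mem_degPart rfl _⟩

theorem mcElement_injective {T S : Ops K A B} {D D' : A →ₗ[K] B}
    (h : mcElement T D = mcElement S D') : T = S ∧ D = D' := by
  constructor
  · have h1 : omegaMap T = omegaMap S :=
      lof_injective 1 (congrArg Subtype.val (congrArg Prod.fst h))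
    refine Ops.ext_mul fun p q => ?_
    have := congrArg (fun f => f ![p, q]) h1
    simpa [omegaMap_apply] using this
  · have h2 := lof_injective 0 (congrArg Prod.snd h)
    exact (MultilinearMap.ofSubsingleton K A B (0 : Fin 1)).injective h2

/-- The elements of degree `0` are exactly the `(Ω[1], D)`. -/
theorem mem_grading_zero_iff (α : Total K A B) : α ∈ grading K A B 0 ↔
    ∃! p : Ops K A B × (A →ₗ[K] B), mcElement p.1 p.2 = α := by
  constructor
  · intro hα
    have h1 : (α.1 : HmSum K (A × B) (A × B)) = DirectSum.lof K ℕ _ 1 (α.1.1 1) := by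
      refine DFinsupp.ext fun n => ?_
      by_cases hn : n = 1
      · subst hn
        rw [DirectSum.lof_apply]
      · rw [DirectSum.lof_eq_of, DirectSum.of_eq_of_ne _ _ _ hn]
        exact hα.1 n (by omega)
    have h2 : α.2 = DirectSum.lof K ℕ _ 0 (α.2 0) := by
      refine DFinsupp.ext fun n => ?_
      by_cases hn : n = 0
      · subst hn
        rw [DirectSum.lof_apply]
      · rw [DirectSum.lof_eq_of, DirectSum.of_eq_of_ne _ _ _ hn]
        exact hα.2 n (by omega)
    have e : mcElement (opsOf (toBilin (α.1.1 1)))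
        ((MultilinearMap.ofSubsingleton K A B (0 : Fin 1)).symm (α.2 0)) = α := by
      refine Prod.ext (Subtype.ext ?_) ?_
      · change DirectSum.lof K ℕ _ 1 (omegaMap _) = _
        rw [omegaMap_surjOn (α.1.2 1)]
        exact h1.symm
      · change ofLinear _ = _
        rw [ofLinear, Equiv.apply_symm_apply]
        exact h2.symm
    refine ⟨(_, _), e, fun p hp => ?_⟩
    obtain ⟨h3, h4⟩ := mcElement_injective (hp.trans e.symm)
    exact Prod.ext h3 h4
  · rintro ⟨p, rfl, -⟩
    exact mcElement_mem _ _

theorem mcElement_add (T T' : Ops K A B) (D D' : A →ₗ[K] B) :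
    mcElement T D + mcElement T' D' = mcElement (T + T') (D + D') := by
  refine Prod.ext (Subtype.ext ?_) ?_
  · change DirectSum.lof K ℕ _ 1 (omegaMap T) + DirectSum.lof K ℕ _ 1 (omegaMap T') =
      DirectSum.lof K ℕ _ 1 (omegaMap (T + T'))
    rw [← map_add]
    congr 1
    ext1 v
    change omegaMap T v + omegaMap T' v = _
    rw [omegaMap_apply, omegaMap_apply, omegaMap_apply]
    refine Prod.ext ?_ ?_
    · change (T.mul _ _).1 + (T'.mul _ _).1 =
        (T.mu + T'.mu) (v 0).1 (v 1).1 + (T.harR + T'.harR) (v 0).1 (v 1).2 +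
          (T.harL + T'.harL) (v 0).2 (v 1).1
      simp only [Ops.mul, LinearMap.add_apply]
      abel
    · change (T.mul _ _).2 + (T'.mul _ _).2 =
        (T.nu + T'.nu) (v 0).2 (v 1).2 + (T.actL + T'.actL) (v 0).1 (v 1).2 +
          (T.actR + T'.actR) (v 0).2 (v 1).1 + (T.theta + T'.theta) (v 0).1 (v 1).1
      simp only [Ops.mul, LinearMap.add_apply]
      abel
  · change ofLinear D + ofLinear D' = ofLinear (D + D')
    rw [ofLinear, ofLinear, ofLinear, ← map_add]
    rfl

end DegreeZero

/-! ### The Maurer–Cartan elements -/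

section MaurerCartan

variable {K E : Type*} [Field K] [AddCommGroup E] [Module K E]

/-- The bilinear map `[f, g]` for `f` in degree `1` and `g` in degree `0`. -/
def bracketOneZero (f : Hm K E E 1) (g : Hm K E E 0) : Hm K E E 1 :=
  (show Hm K E E 1 from diamond 1 0 f g) - show Hm K E E 1 from diamond 0 1 g f

theorem bracket_lof_one_zero (f : Hm K E E 1) (g : Hm K E E 0) :
    bracket K E (DirectSum.lof K ℕ _ 1 f) (DirectSum.lof K ℕ _ 0 g) =
      DirectSum.lof K ℕ (Hm K E E) 1 (bracketOneZero f g) := by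
  rw [bracket_lof, mul_zero, pow_zero, one_smul, bracketOneZero, map_sub]

theorem insN_apply {i m n : ℕ} (h : i < m + 1) (f : Hm K E E m) (g : Hm K E E n)
    (v : Fin (m + n + 1) → E) : insN i f g v = f (insArgs ⟨i, h⟩ g v) := by
  rw [insN, dif_pos h]
  rfl

theorem bracketOneZero_apply (f : Hm K E E 1) (g : Hm K E E 0) (p q : E) :
    bracketOneZero f g ![p, q] = f ![g ![p], q] + f ![p, g ![q]] - g ![f ![p, q]] := by
  have h1 : diamond 1 0 f g ![p, q] = f ![g ![p], q] + f ![p, g ![q]] := by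
    have e : diamond 1 0 f g = insN 0 f g + insN 1 f g := by
      simp [diamond_eq_sum, Finset.sum_range_succ]
    rw [e, _root_.add_apply, insN_apply (by omega), insN_apply (by omega)]
    congr 2
    · funext j
      fin_cases j
      · refine congrArg g (funext fun t => ?_)
        fin_cases t
        rfl
      · rfl
    · funext j
      fin_cases j
      · rfl
      · refine congrArg g (funext fun t => ?_)
        fin_cases t
        rfl
  have h2 : diamond 0 1 g f ![p, q] = g ![f ![p, q]] := by
    have e : diamond 0 1 g f = insN 0 g f := by
      simp [diamond_eq_sum]
    rw [e, insN_apply (by omega)]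
    congr 1
    funext j
    fin_cases j
    refine congrArg f (funext fun t => ?_)
    fin_cases t <;> rfl
  rw [← h1, ← h2]
  rfl

theorem diamond_one_one_apply (f : Hm K E E 1) (p q r : E) :
    diamond 1 1 f f ![p, q, r] = f ![f ![p, q], r] - f ![p, f ![q, r]] := by
  have e : diamond 1 1 f f = insN 0 f f - insN 1 f f := by
    simp [diamond_eq_sum, Finset.sum_range_succ, sub_eq_add_neg]
  rw [e, _root_.sub_apply, insN_apply (by omega), insN_apply (by omega)]
  congr 2
  · funext j
    fin_cases j
    · refine congrArg f (funext fun t => ?_)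
      fin_cases t <;> rfl
    · rfl
  · funext j
    fin_cases j
    · rfl
    · refine congrArg f (funext fun t => ?_)
      fin_cases t <;> rfl

/-- For `f` of degree `1` one has `[f, f] = 2 f ⋄ f`, and `f ⋄ f` is the associator. -/
theorem bracket_self_eq_zero_iff [CharZero K] (f : Hm K E E 1) :
    bracket K E (DirectSum.lof K ℕ _ 1 f) (DirectSum.lof K ℕ _ 1 f) = 0 ↔
      ∀ p q r, f ![f ![p, q], r] = f ![p, f ![q, r]] := by
  have e : bracket K E (DirectSum.lof K ℕ _ 1 f) (DirectSum.lof K ℕ _ 1 f) =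
      (2 : K) • DirectSum.lof K ℕ (Hm K E E) (1 + 1) (diamond 1 1 f f) := by
    rw [bracket_lof, mul_one, pow_one]
    module
  rw [e, smul_eq_zero_iff_right two_ne_zero, map_eq_zero_iff _ (lof_injective _)]
  constructor
  · intro h p q r
    rw [← sub_eq_zero, ← diamond_one_one_apply, h]
    rfl
  · intro h
    ext1 v
    have hv : v = ![v 0, v 1, v 2] := by
      funext i
      fin_cases i <;> rfl
    rw [hv]
    exact (diamond_one_one_apply f _ _ _).trans (sub_eq_zero.2 (h _ _ _))

end MaurerCartan


/-! ### Evaluation of the Maurer–Cartan series at `(Ω[1], D)` -/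

section MaurerCartanEquation

variable {K A B : Type*} [Field K] [AddCommGroup A] [Module K A] [AddCommGroup B] [Module K B]

theorem parity_pow_ofLinear (D : A →ₗ[K] B) (n : ℕ) :
    (parity K A B ^ n) (ofLinear D) = ofLinear D := by
  rw [parity_pow_of_mem (x := ofLinear D) (lof_mem_degPart rfl _), Nat.cast_zero, mul_zero, sg_zero, one_smul]

/-- The derived bracket `P[⋯[[Ω, D], D], …, D]`. -/
def mcBracket (T : Ops K A B) (D : A →ₗ[K] B) (n : ℕ) : Abel K A B :=
  projP K A B (iterBracket (List.replicate n (incl K A B (ofLinear D))) (Omega T))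

/-- Because `D` has degree `0`, no signs arise and each of the `n` choices of the entry supplying
`Ω` gives the same bracket. The truncated subtraction matters only for `m = n = 0`, where the factor
`n` is zero. -/
theorem mixSum_mcElement (T : Ops K A B) (D : A →ₗ[K] B) (m n : ℕ) :
    mixSum (List.replicate m (ofLinear D)) (List.replicate n (mcElement T D)) =
      n • mcBracket T D (m + n - 1) := by
  induction n generalizing m with
  | zero => simp [mixSum]
  | succ n ih =>
    have e : mixPair (List.replicate m (ofLinear D)) (List.replicate n (ofLinear D))
        (Omega T : HmSum K (A × B) (A × B)) = mcBracket T D (m + n) := by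
      change mixPair _ _ (DirectSum.lof K ℕ _ 1 (omegaMap T)) = _
      rw [mixPair_lof, mcBracket, List.map_replicate, List.map_replicate, parity_pow_ofLinear,
        List.replicate_append_replicate]
      rfl
    have e' := ih (m + 1)
    rw [List.replicate_succ', show m + 1 + n - 1 = m + n by omega] at e'
    rw [List.replicate_succ, mixSum, List.map_replicate]
    change mixPair (List.replicate m (ofLinear D)) (List.replicate n (ofLinear D))
        (Omega T : HmSum K (A × B) (A × B)) +
      mixSum (List.replicate m (ofLinear D) ++ [ofLinear D]) _ = _
    rw [e, e', show m + (n + 1) - 1 = m + n by omega, add_comm, ← succ_nsmul]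

theorem lTilde_mcElement_snd (T : Ops K A B) (D : A →ₗ[K] B) (n : ℕ) :
    (onList (lTilde K A B) (List.replicate n (mcElement T D))).2 = n • mcBracket T D (n - 1) := by
  rw [snd_lTilde]
  simpa using mixSum_mcElement T D 0 n

theorem mcBracket_eq_zero [CharZero K] (T : Ops K A B) (D : A →ₗ[K] B) {n : ℕ} (hn : 3 ≤ n) :
    mcBracket T D n = 0 := by
  have := projP_iterBracket_eq_zero (n := 1) ((Omega T).2 1)
    (fs := List.replicate n (ofLinear D)) (by simp; omega)
  rw [List.map_replicate] at this
  have e : DirectSum.lof K ℕ _ 1 ((Omega T : HmSum K (A × B) (A × B)) 1) = Omega T := by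
    change DirectSum.lof K ℕ _ 1 (DirectSum.lof K ℕ _ 1 (omegaMap T) 1) =
      DirectSum.lof K ℕ _ 1 (omegaMap T)
    rw [DirectSum.lof_apply]
  rwa [e] at this

/-- In `𝒬[1]` only `l_2` contributes, with `1/2!` and with `(-1)^{|Ω|} = -1`. In `𝔞` the `n`-th term
carries `n/n! = 1/(n-1)!`, and it vanishes for `n ≥ 4` because `Ω` has only two arguments. -/
theorem twistList_mcElement [CharZero K] (T : Ops K A B) (D : A →ₗ[K] B) :
    ((twistList K (onList (lTilde K A B)) (mcElement T D) []).1 : HmSum K (A × B) (A × B)) =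
        -((2 : K)⁻¹ • bracket K (A × B) (Omega T) (Omega T)) ∧
      (twistList K (onList (lTilde K A B)) (mcElement T D) []).2 =
        mcBracket T D 0 + mcBracket T D 1 + (2 : K)⁻¹ • mcBracket T D 2 := by
  have hz : ∀ n, 4 ≤ n →
      onList (lTilde K A B) (List.replicate n (mcElement T D) ++ []) = 0 := by
    intro n hn
    rw [List.append_nil]
    refine Prod.ext (fst_lTilde_of_ne (by simp; omega)) ?_
    rw [lTilde_mcElement_snd, mcBracket_eq_zero T D (by omega), smul_zero]
    rfl
  rw [twistList_eq_sum hz]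
  constructor
  · have h : ∀ n, n ≠ 2 →
        (onList (lTilde K A B) (List.replicate n (mcElement T D) ++ [])).1 = 0 := fun n hn => by
      rw [List.append_nil]
      exact fst_lTilde_of_ne (by simpa using hn)
    have h2 : ((onList (lTilde K A B) (List.replicate 2 (mcElement T D) ++ [])).1 :
        HmSum K (A × B) (A × B)) = -bracket K (A × B) (Omega T) (Omega T) := by
      change bracket K (A × B) (parity K (A × B) (A × B) (Omega T)) (Omega T) = _
      rw [parity_of_mem (d := 1) (x := (Omega T : HmSum K (A × B) (A × B))) (lof_mem_degPart rfl _), sg_one, neg_one_smul, map_neg]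
      rfl
    simp only [Finset.sum_range_succ, Finset.sum_range_zero, zero_add, Prod.fst_add, Prod.smul_fst,
      h 0 (by omega), h 1 (by omega), h 3 (by omega), smul_zero, add_zero, Submodule.coe_smul, h2]
    simp [Nat.factorial]
  · have h : ∀ n, (onList (lTilde K A B) (List.replicate n (mcElement T D) ++ [])).2 =
        n • mcBracket T D (n - 1) := fun n => by
      rw [List.append_nil, lTilde_mcElement_snd]
    simp only [Finset.sum_range_succ, Finset.sum_range_zero, zero_add, Prod.snd_add, Prod.smul_snd,
      h]
    have h6 : ((Nat.factorial 3 : ℕ) : K)⁻¹ * 3 = 2⁻¹ := by norm_num [Nat.factorial]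
    have h2 : ((Nat.factorial 2 : ℕ) : K)⁻¹ * 2 = 1 := by norm_num [Nat.factorial]
    simp only [← Nat.cast_smul_eq_nsmul K, smul_smul]
    norm_num [Nat.factorial]

/-- The linear map `(a, x) ↦ (0, D a)`, as an element of `Hom(A ⊕ B, A ⊕ B)`. -/
def linearMapHm (D : A →ₗ[K] B) : Hm K (A × B) (A × B) 0 :=
  (LinearMap.inr K A B).compMultilinearMap
    ((MultilinearMap.ofSubsingleton K A B (0 : Fin 1) D).compLinearMap fun _ => LinearMap.fst K A B)

theorem linearMapHm_apply (D : A →ₗ[K] B) (p : A × B) : linearMapHm D ![p] = (0, D p.1) := rfl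

theorem incl_ofLinear (D : A →ₗ[K] B) :
    incl K A B (ofLinear D) = DirectSum.lof K ℕ _ 0 (linearMapHm D) := incl_lof _

/-- `P` on the maps of degree `1`. -/
def projOne (f : Hm K (A × B) (A × B) 1) : Hm K A B 1 :=
  (LinearMap.snd K A B).compMultilinearMap (f.compLinearMap fun _ => LinearMap.inl K A B)

theorem projOne_apply (f : Hm K (A × B) (A × B) 1) (a b : A) :
    projOne f ![a, b] = (f ![(a, 0), (b, 0)]).2 := by
  change (f _).2 = _
  congr 2
  funext i
  fin_cases i <;> rfl

theorem mcBracket_sum (T : Ops K A B) (D : A →ₗ[K] B) :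
    mcBracket T D 0 + mcBracket T D 1 + (2 : K)⁻¹ • mcBracket T D 2 =
      DirectSum.lof K ℕ (Hm K A B) 1 (projOne (omegaMap T) +
        projOne (bracketOneZero (omegaMap T) (linearMapHm D)) +
        (2 : K)⁻¹ • projOne (bracketOneZero (bracketOneZero (omegaMap T) (linearMapHm D))
          (linearMapHm D))) := by
  have h : ∀ n, mcBracket T D n = projP K A B (iterBracket
      (List.replicate n (DirectSum.lof K ℕ _ 0 (linearMapHm D)))
        (DirectSum.lof K ℕ _ 1 (omegaMap T))) := fun n => by
    rw [mcBracket, incl_ofLinear]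
    rfl
  rw [h, h, h]
  simp only [List.replicate_succ, List.replicate_zero, iterBracket_cons, bracket_lof_one_zero,
    map_add, map_smul]
  refine congrArg₂ (· + ·) (congrArg₂ (· + ·) ?_ ?_) (congrArg _ ?_) <;> exact projP_lof _

/-- The terms are sorted by the number of occurrences of `D`. In the double bracket each
contribution occurs twice, once for each order of inserting the two copies of `D`, which cancels the
factor `½`. -/
theorem mcSum_apply [CharZero K] (T : Ops K A B) (D : A →ₗ[K] B) (a b : A) :
    (projOne (omegaMap T) + projOne (bracketOneZero (omegaMap T) (linearMapHm D)) +
        (2 : K)⁻¹ • projOne (bracketOneZero (bracketOneZero (omegaMap T) (linearMapHm D))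
          (linearMapHm D))) ![a, b] =
      T.nu (D a) (D b) + T.actL a (D b) + T.actR (D a) b + T.theta a b -
        D (T.mu a b + T.harR a (D b) + T.harL (D a) b) := by
  have h0 : projOne (omegaMap T) ![a, b] = T.theta a b := by
    rw [projOne_apply, omegaMap_apply]
    simp [Ops.mul]
  have h1 : projOne (bracketOneZero (omegaMap T) (linearMapHm D)) ![a, b] =
      T.actR (D a) b + T.actL a (D b) - D (T.mu a b) := by
    rw [projOne_apply, bracketOneZero_apply]
    simp [omegaMap_apply, linearMapHm_apply, Ops.mul]
  have h2 : projOne (bracketOneZero (bracketOneZero (omegaMap T) (linearMapHm D))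
      (linearMapHm D)) ![a, b] =
      (2 : K) • (T.nu (D a) (D b) - D (T.harR a (D b) + T.harL (D a) b)) := by
    rw [projOne_apply, bracketOneZero_apply]
    simp only [bracketOneZero_apply, omegaMap_apply, linearMapHm_apply, Ops.mul]
    simp
    module
  change projOne (omegaMap T) ![a, b] +
    projOne (bracketOneZero (omegaMap T) (linearMapHm D)) ![a, b] +
    (2 : K)⁻¹ • projOne (bracketOneZero (bracketOneZero (omegaMap T) (linearMapHm D))
          (linearMapHm D)) ![a, b] = _
  rw [h0, h1, h2, smul_smul, inv_mul_cancel₀ two_ne_zero, one_smul]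
  simp only [map_add]
  abel

/-- The subalgebra condition is automatic, as `Ops` has no component from `B ⊗ B` to `A`; only
associativity is a condition. -/
theorem isQuasiTwilled_iff [CharZero K] (T : Ops K A B) : T.IsQuasiTwilled ↔
    bracket K (A × B) (Omega T) (Omega T) = 0 := by
  have h := bracket_self_eq_zero_iff (omegaMap T)
  simp only [omegaMap_apply] at h
  refine Iff.trans ⟨fun hT => hT.assoc, fun hT => ⟨hT, fun x y => ?_⟩⟩ h.symm
  simp [Ops.mul]

/-- The Maurer–Cartan elements of `𝒬[1] ⊕ 𝔞`. -/
theorem isMaurerCartan_mcElement_iff [CharZero K] (T : Ops K A B) (D : A →ₗ[K] B) :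
    (T.IsQuasiTwilled ∧ T.IsStrongDeformationMap D) ↔
      IsMaurerCartan (grading K A B) (lTilde K A B) (mcElement T D) := by
  rw [isMaurerCartan_iff lTilde_eventuallyZero (mcElement_mem T D), isQuasiTwilled_iff,
    Prod.ext_iff, ← Subtype.coe_inj, (twistList_mcElement T D).1, (twistList_mcElement T D).2,
    mcBracket_sum]
  refine and_congr ?_ ?_
  · change _ ↔ _ = (0 : HmSum K (A × B) (A × B))
    rw [neg_eq_zero, smul_eq_zero_iff_right (inv_ne_zero two_ne_zero)]
  · change _ ↔ _ = (0 : Abel K A B)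
    rw [map_eq_zero_iff _ (lof_injective 1)]
    constructor
    · intro h
      ext1 v
      have hv : v = ![v 0, v 1] := by
        funext i
        fin_cases i <;> rfl
      rw [hv]
      exact (mcSum_apply T D _ _).trans (sub_eq_zero.2 (h _ _).symm)
    · intro h a b
      refine (sub_eq_zero.1 ?_).symm
      rw [← mcSum_apply, h]
      rfl

/-- Twisting always gives a curved structure; its curvature is the Maurer–Cartan expression of `α`,
so flatness is the equation for `(Ω[1], D)`. -/
theorem isLInfinity_twist_mcElement [CharZero K] {T : Ops K A B} {D : A →ₗ[K] B}
    (h : IsMaurerCartan (grading K A B) (lTilde K A B) (mcElement T D)) :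
    IsLInfinity (grading K A B) (twist K (lTilde K A B) (mcElement T D)) where
  toIsCurvedLInfinity := by
    refine ListLInf.isCurvedLInfinity ?_ grading_isInternal
    rw [onList_twist]
    exact listLInf_lTilde.twistList lTilde_eventuallyZero (mcElement_mem T D)
  flat x := by
    rw [← onList_ofFn (twist K (lTilde K A B) (mcElement T D)), onList_twist, List.ofFn_zero]
    exact (isMaurerCartan_iff lTilde_eventuallyZero (mcElement_mem T D)).1 h

end MaurerCartanEquation

end QTwilled

theorem mainTheorem8 {K A B : Type*} [Field K] [CharZero K] [AddCommGroup A] [Module K A]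
    [AddCommGroup B] [Module K B] :
    -- Voronov's operations make `𝒬[1] ⊕ 𝔞` a (weakly filtered) `L_∞`-algebra
    QTwilled.IsLInfinity (QTwilled.grading K A B) (QTwilled.lTilde K A B) ∧
    QTwilled.IsVoronov K A B (QTwilled.lTilde K A B) ∧
    QTwilled.IsWeaklyFiltered (QTwilled.grading K A B) (QTwilled.lTilde K A B) ∧
    -- the elements of degree `0` are exactly the `(Ω[1], D)`
    (∀ α : QTwilled.Total K A B, α ∈ QTwilled.grading K A B 0 ↔
      ∃! p : QTwilled.Ops K A B × (A →ₗ[K] B), QTwilled.mcElement p.1 p.2 = α) ∧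
    -- the Maurer–Cartan elements
    (∀ (T : QTwilled.Ops K A B) (D : A →ₗ[K] B),
      (T.IsQuasiTwilled ∧ T.IsStrongDeformationMap D) ↔
        QTwilled.IsMaurerCartan (QTwilled.grading K A B) (QTwilled.lTilde K A B)
          (QTwilled.mcElement T D)) ∧
    -- the twisted `L_∞`-algebra and the simultaneous deformations
    QTwilled.TwistConverges (QTwilled.lTilde K A B) ∧
    (∀ (T : QTwilled.Ops K A B) (D : A →ₗ[K] B), T.IsQuasiTwilled → T.IsStrongDeformationMap D →
      QTwilled.IsLInfinity (QTwilled.grading K A B)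
        (QTwilled.twist K (QTwilled.lTilde K A B) (QTwilled.mcElement T D)) ∧
      QTwilled.IsWeaklyFiltered (QTwilled.grading K A B)
        (QTwilled.twist K (QTwilled.lTilde K A B) (QTwilled.mcElement T D)) ∧
      ∀ (T' : QTwilled.Ops K A B) (D' : A →ₗ[K] B),
        ((T + T').IsQuasiTwilled ∧ (T + T').IsStrongDeformationMap (D + D')) ↔
          QTwilled.IsMaurerCartan (QTwilled.grading K A B)
            (QTwilled.twist K (QTwilled.lTilde K A B) (QTwilled.mcElement T D))
            (QTwilled.mcElement T' D')) := by
  have mc := @QTwilled.isMaurerCartan_mcElement_iff K A B _ _ _ _ _ _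
  refine ⟨QTwilled.lTilde_isLInfinity, QTwilled.lTilde_isVoronov,
    QTwilled.lTilde_isWeaklyFiltered, QTwilled.mem_grading_zero_iff, mc,
    QTwilled.lTilde_eventuallyZero.twistConverges, fun T D hT hD => ⟨?_, ?_, fun T' D' => ?_⟩⟩
  · exact QTwilled.isLInfinity_twist_mcElement ((mc T D).1 ⟨hT, hD⟩)
  · exact QTwilled.isWeaklyFiltered_twist QTwilled.lTilde_isWeaklyFiltered
      (QTwilled.mcElement_mem T D)
  -- Deforming the pair means adding elements of degree `0`, so the criterion for `(Ω + Ω', D + D')`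
  -- is the untwisted one applied to the sum.
  · rw [QTwilled.isMaurerCartan_twist_iff QTwilled.listLInf_lTilde
      QTwilled.lTilde_eventuallyZero (QTwilled.mcElement_mem T D) (QTwilled.mcElement_mem T' D'),
      QTwilled.mcElement_add]
    exact mc _ _
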